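/- Let $C=(C_{i,j})_{1\le i,j\le l}$, $C_{i,j}=\alpha_i(h_{\alpha_j})$, be the Cartan matrix of a real split simple Lie algebra with simple roots $\Pi=\{\alpha_1,\dots,\alpha_l\}$, and let $W$ be its Weyl group, generated by the simple reflections $s_i$, with length function $\ell$. The group $W$ acts on sign tuples $\epsilon=(\epsilon_1,\dots,\epsilon_l)\in\{\pm1\}^l$ by $s_i:\epsilon_j\mapsto\epsilon_j\,\epsilon_i^{-C_{j,i}}$. For $1\le k\le l$ let $W_{[\alpha_k]}$ be the set of minimal length representatives of the cosets in $W/\langle s_i : i\neq k\rangle$, and let $$W^-_{[\alpha_k]}=\{\,w\in W_{[\alpha_k]} : (w^{-1}\cdot(-,\dots,-))_j=- \text{ for all } j\ne k\,\}.$$ The incidence number of the top cell $\langle\emptyset\rangle=(*\cdots*)$ and the codimension-one cell $\langle\{\alpha_k\}\rangle=(\overbrace{*\cdots*}^{n_1}\,0\,\overbrace{*\cdots*}^{n_2})$, where $n_1=k-1$ and $n_2=l-k$, is $$[\emptyset;\{\alpha_k\}]=(-1)^{k-1}\Big|\sum_{w\in W^-_{[\alpha_k]}}(-1)^{\ell(w)}\Big|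 .$$ There is an edge $\langle\emptyset\rangle\Rightarrow\langle\{\alpha_k\}\rangle$ in the graph $\mathcal G$ of the chain complex iff $[\emptyset;\{\alpha_k\}]\neq0$. The boundary of the top cell is $\partial_l\langle\emptyset\rangle=\sum_k[\emptyset;\{\alpha_k\}]\langle\{\alpha_k\}\rangle$; the type is called orientable if the top homology $H_l=\ker\partial_l$ of the chain complex is isomorphic to $\mathbb Z$, and nonorientable if $H_l=0$. The simple roots are labelled as follows. In types $A_l,B_l,C_l,F_4,G_2$ the roots $\alpha_1,\dots,\alpha_l$ form a chain in this order; in $B_l$ the last root $\alpha_l$ is short, and in $C_l$ it is long. In type $D_l$ the roots $\alpha_1,\dots,\alpha_{l-2}$ form a chain and $\alpha_{l-1},\alpha_l$ are both joined to $\alpha_{l-2}$. In type $E_l$ ($l=6,7,8$) the roots $\alpha_1,\dots,\alpha_{l-1}$ form a chain and $\alpha_l$ is joined to $\alpha_{l-3}$. Then the edges from the top cell are as follows. - Type $A_l$ ($l\ge1$): there is an edge $(*\cdots*)\Rightarrow(\overbrace{*\cdots*}^{n_1}\,0\,\overbrace{*\cdots*}^{n_2})$ iff $n_1$ or $n_2$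 is odd. - Types $B_l$ and $C_l$ ($l\ge2$): there are no edges, and the type is orientable. - Type $D_l$ ($l\ge3$), $l$ even: there are no edges, and the type is orientable. - Type $D_l$ ($l\ge3$), $l$ odd: there is an edge iff $n_1=0$; its incidence number is $4$, and the type is nonorientable. - Type $E_6$: there is an edge iff $n_1=0$ or $n_1=4$; both incidence numbers are $6$, and the type is nonorientable. - Types $E_7$, $E_8$, $F_4$ and $G_2$: there are no edges, and the type is orientable. -/

import Mathlib

namespace NilpotentToda

/-- A square integer matrix `C` with `2` on the diagonal, thought of as the Cartan matrix
`C i j = α_i (h_{α_j})`.  The simple roots `α_1, …, α_l` are indexed by `Fin l`, so that the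
index `k : Fin l` stands for `α_{k+1}`. -/
structure CartanDatum (l : ℕ) where
  /-- the Cartan matrix -/
  mat : Matrix (Fin l) (Fin l) ℤ
  diag : ∀ i, mat i i = 2

/-- The root lattice, with the simple roots as its standard basis. -/
abbrev RootLattice (l : ℕ) : Type := Fin l → ℤ

/-- The simple root `α_i`. -/
def simpleRoot {l : ℕ} (i : Fin l) : RootLattice l := Pi.single i 1

/-- Evaluation of a root lattice element at the simple coroot `h_{α_i}`. -/
def coroot {l : ℕ} (X : CartanDatum l) (i : Fin l) : Module.Dual ℤ (RootLattice l) :=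
  ∑ j, X.mat j i • LinearMap.proj j

theorem coroot_apply {l : ℕ} (X : CartanDatum l) (i : Fin l) (v : RootLattice l) :
    coroot X i v = ∑ j, X.mat j i * v j := by
  simp [coroot]

theorem coroot_simpleRoot {l : ℕ} (X : CartanDatum l) (i j : Fin l) :
    coroot X i (simpleRoot j) = X.mat j i := by
  simp [coroot_apply, simpleRoot, Pi.single_apply]

/-- The simple reflection `s_i`. -/
def simpleReflection {l : ℕ} (X : CartanDatum l) (i : Fin l) :
    RootLattice l ≃ₗ[ℤ] RootLattice l :=
  Module.reflection (x := simpleRoot i) (f := coroot X i)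
    ((coroot_simpleRoot X i i).trans (X.diag i))

theorem simpleReflection_simpleRoot {l : ℕ} (X : CartanDatum l) (i j : Fin l) :
    simpleReflection X i (simpleRoot j) = simpleRoot j - X.mat j i • simpleRoot i := by
  simp only [simpleReflection, Module.reflection_apply, coroot_simpleRoot]

/-- The Weyl group `W`, acting on the root lattice. -/
def weylGroup {l : ℕ} (X : CartanDatum l) : Subgroup (RootLattice l ≃ₗ[ℤ] RootLattice l) :=
  Subgroup.closure (Set.range (simpleReflection X))

/-- The parabolic subgroup `W^J` generated by the `s_i` with `α_i ∉ J`. -/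
def parabolic {l : ℕ} (X : CartanDatum l) (J : Finset (Fin l)) :
    Subgroup (RootLattice l ≃ₗ[ℤ] RootLattice l) :=
  Subgroup.closure {s | ∃ i, i ∉ J ∧ s = simpleReflection X i}

/-- The length `ℓ(w)` of a Weyl group element: the least number of factors in an expression of
`w` as a product of simple reflections. -/
noncomputable def length {l : ℕ} (X : CartanDatum l)
    (w : RootLattice l ≃ₗ[ℤ] RootLattice l) : ℕ :=
  sInf {n | ∃ L : List (Fin l), L.length = n ∧ (L.map (simpleReflection X)).prod = w}

/-- The set `W_{[J]}` of the shortest representatives of the cosets in `W / W^J`. -/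
def minCosetReps {l : ℕ} (X : CartanDatum l) (J : Finset (Fin l)) :
    Set (RootLattice l ≃ₗ[ℤ] RootLattice l) :=
  {w | w ∈ weylGroup X ∧ ∀ v ∈ parabolic X J, length X w ≤ length X (w * v)}

/-- The action of `W` on signs.  A tuple of signs `ε` is a character of the root lattice, with
the value `ε i` at `α_i`; the character `w · ε` has the value of `ε` at `w⁻¹ α_j` as its value
at `α_j`. -/
def signAction {l : ℕ} (w : RootLattice l ≃ₗ[ℤ] RootLattice l) (ε : Fin l → ℤˣ) :
    Fin l → ℤˣ :=
  fun j => ∏ i, ε i ^ (w⁻¹ (simpleRoot j)) i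

/-- The simple reflection `s_i` acts on signs by `ε_j ↦ ε_j ε_i ^ (-C_{j,i})`. -/
theorem signAction_simpleReflection {l : ℕ} (X : CartanDatum l) (i j : Fin l)
    (ε : Fin l → ℤˣ) :
    signAction (simpleReflection X i) ε j = ε j * ε i ^ (-X.mat j i) := by
  have h : (simpleReflection X i)⁻¹ = simpleReflection X i := by
    exact Module.reflection_inv _
  simp only [signAction, h, simpleReflection_simpleRoot]
  simp only [simpleRoot, Pi.sub_apply, Pi.smul_apply, zpow_sub, Finset.prod_mul_distrib,
    Finset.prod_inv_distrib, zpow_neg, Pi.single_apply, smul_eq_mul, mul_ite, mul_one, mul_zero]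
  congr 1
  · rw [Finset.prod_eq_single j] <;> simp +contextual
  · congr 1
    rw [Finset.prod_eq_single i] <;> simp +contextual

theorem signAction_one {l : ℕ} (ε : Fin l → ℤˣ) : signAction 1 ε = ε := by
  funext j
  simp only [signAction, inv_one, LinearEquiv.coe_one, id, simpleRoot, Pi.single_apply]
  rw [Finset.prod_eq_single j] <;> simp +contextual

theorem signAction_mul {l : ℕ} (w v : RootLattice l ≃ₗ[ℤ] RootLattice l) (ε : Fin l → ℤˣ) :
    signAction (w * v) ε = signAction w (signAction v ε) := by
  have zpow_sum : ∀ (a : ℤˣ) (f : Fin l → ℤ) (s : Finset (Fin l)),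
      a ^ ∑ x ∈ s, f x = ∏ x ∈ s, a ^ f x := by
    intro a f s
    induction s using Finset.induction_on with
    | empty => simp
    | insert x s hx ih => rw [Finset.sum_insert hx, Finset.prod_insert hx, zpow_add, ih]
  funext j
  have h : v⁻¹ (w⁻¹ (simpleRoot j)) = ∑ k, (w⁻¹ (simpleRoot j)) k • v⁻¹ (simpleRoot k) := by
    conv_lhs => rw [pi_eq_sum_univ' (w⁻¹ (simpleRoot j)), map_sum]
    refine Finset.sum_congr rfl fun k _ => ?_
    rw [map_smul]
    congr 2
  simp only [signAction, mul_inv_rev, LinearEquiv.mul_apply, h, Finset.sum_apply, Pi.smul_apply,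
    smul_eq_mul, ← Finset.prod_zpow]
  rw [Finset.prod_comm]
  refine Finset.prod_congr rfl fun i _ => ?_
  rw [zpow_sum]
  refine Finset.prod_congr rfl fun k _ => ?_
  rw [mul_comm, zpow_mul]

/-- The function `σ_J`: it puts `0` at the places in `J` and keeps the signs elsewhere. -/
def sigma {l : ℕ} (J : Finset (Fin l)) (ε : Fin l → ℤˣ) : Fin l → ℤ :=
  fun k => if k ∈ J then 0 else (ε k : ℤ)

/-- The set `W_{[J]}^-` of all `w ∈ W_{[J]}` for which `σ_J (w⁻¹ · (-, …, -))` has the sign `-`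
at every place outside of `J`. -/
def negCosetReps {l : ℕ} (X : CartanDatum l) (J : Finset (Fin l)) :
    Set (RootLattice l ≃ₗ[ℤ] RootLattice l) :=
  {w | w ∈ minCosetReps X J ∧ ∀ j, j ∉ J → sigma J (signAction w⁻¹ (fun _ => -1)) j = -1}

/-- The incidence number `[∅; {α_k}]` of the top cell `⟨∅⟩ = (*⋯*)` and the cell
`⟨{α_k}⟩ = (*⋯*0*⋯*)`, that is, `(-1)^(k-1) |∑ (-1)^ℓ(w)|` with `w` running over `W_{[α_k]}^-`.
Here the places are numbered from `0`, so that `k.val` is the number of stars before the zero. -/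
noncomputable def incidence {l : ℕ} (X : CartanDatum l) (k : Fin l) : ℤ :=
  (-1) ^ k.val * |∑ᶠ w ∈ negCosetReps X {k}, (-1 : ℤ) ^ length X w|

/-- There is an edge `⟨∅⟩ ⇒ ⟨{α_k}⟩` in the weighted graph of the chain complex. -/
def TopEdge {l : ℕ} (X : CartanDatum l) (k : Fin l) : Prop :=
  incidence X k ≠ 0

/-- The boundary map `∂_l` from `ℤ ⟨∅⟩` to the free module on the cells `⟨{α_k}⟩`. -/
noncomputable def topBoundary {l : ℕ} (X : CartanDatum l) : ℤ →ₗ[ℤ] (Fin l → ℤ) :=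
  LinearMap.toSpanSingleton ℤ (Fin l → ℤ) (incidence X)

/-- The homology of the chain complex in the top degree `l`; there are no cells of higher
dimension, so it is the kernel of `∂_l`. -/
noncomputable def topHomology {l : ℕ} (X : CartanDatum l) : Submodule ℤ ℤ :=
  LinearMap.ker (topBoundary X)

/-- Orientability: the top homology is `ℤ`. -/
def Orientable {l : ℕ} (X : CartanDatum l) : Prop :=
  Nonempty (topHomology X ≃ₗ[ℤ] ℤ)

/-- Nonorientability: the top homology is zero. -/
def Nonorientable {l : ℕ} (X : CartanDatum l) : Prop :=
  topHomology X = ⊥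

/-- Type `A_l`. -/
def typeA (l : ℕ) : CartanDatum l where
  mat := CartanMatrix.A l
  diag := fun i => by simp [CartanMatrix.A]

/-- Type `B_l`. -/
def typeB (l : ℕ) : CartanDatum l where
  mat := CartanMatrix.B l
  diag := CartanMatrix.B_diag l

/-- Type `C_l`. -/
def typeC (l : ℕ) : CartanDatum l where
  mat := CartanMatrix.C l
  diag := CartanMatrix.C_diag l

/-- Type `D_l`, with `α_{l-1}` and `α_l` both joined to `α_{l-2}`. -/
def typeD (l : ℕ) : CartanDatum l where
  mat := CartanMatrix.D l
  diag := CartanMatrix.D_diag l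

/-- Type `E_6`, labelled so that `α_1, …, α_5` form a chain and `α_6` is joined to `α_3`. -/
def typeE₆ : CartanDatum 6 where
  mat :=
    !![ 2, -1,  0,  0,  0,  0;
       -1,  2, -1,  0,  0,  0;
        0, -1,  2, -1,  0, -1;
        0,  0, -1,  2, -1,  0;
        0,  0,  0, -1,  2,  0;
        0,  0, -1,  0,  0,  2]
  diag := by decide

/-- Type `E_7`, labelled so that `α_1, …, α_6` form a chain and `α_7` is joined to `α_4`. -/
def typeE₇ : CartanDatum 7 where
  mat :=
    !![ 2, -1,  0,  0,  0,  0,  0;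
       -1,  2, -1,  0,  0,  0,  0;
        0, -1,  2, -1,  0,  0,  0;
        0,  0, -1,  2, -1,  0, -1;
        0,  0,  0, -1,  2, -1,  0;
        0,  0,  0,  0, -1,  2,  0;
        0,  0,  0, -1,  0,  0,  2]
  diag := by decide

/-- Type `E_8`, labelled so that `α_1, …, α_7` form a chain and `α_8` is joined to `α_5`. -/
def typeE₈ : CartanDatum 8 where
  mat :=
    !![ 2, -1,  0,  0,  0,  0,  0,  0;
       -1,  2, -1,  0,  0,  0,  0,  0;
        0, -1,  2, -1,  0,  0,  0,  0;
        0,  0, -1,  2, -1,  0,  0,  0;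
        0,  0,  0, -1,  2, -1,  0, -1;
        0,  0,  0,  0, -1,  2, -1,  0;
        0,  0,  0,  0,  0, -1,  2,  0;
        0,  0,  0,  0, -1,  0,  0,  2]
  diag := by decide

/-- Type `F_4`. -/
def typeF₄ : CartanDatum 4 where
  mat := CartanMatrix.F₄
  diag := CartanMatrix.F₄_diag

/-- Type `G_2`. -/
def typeG₂ : CartanDatum 2 where
  mat := CartanMatrix.G₂
  diag := CartanMatrix.G₂_diag

end NilpotentToda

/-! ### Weyl group, exchange property and minimal coset representatives -/

namespace NilpotentToda

variable {l : ℕ}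

/-! The signed count of coset representatives is a sum of determinants over a set cut out by
conditions on roots. This sum is either killed by a sign reversing bijection or evaluated.

Reduction. An element `w` is shortest in its coset of the parabolic subgroup without `s_k` exactly
when `w α_j` is a positive root for all `j ≠ k` (`IsPositiveSystem.mem_minCosetReps_iff`). The sign
`(-1) ^ ℓ(w)` is `det w`. The tuple of minus signs is the character `v ↦ (-1) ^ height v`, so the
sign condition says that `w α_j` has odd height. Hence the incidence number is, up to the sign `(-1)
^ (k - 1)`, the absolute value of the sum of `det w` over `oddReps`. The boundary map multiplies the
vector of incidence numbers by an integer, so its kernel is everything or zero according to whether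
all these numbers vanish.

Classical types. The Weyl group acts by signed permutations (`SignedModel`), and membership in
`oddReps` becomes an order, sign and parity condition on neighbouring places. For B, C and D the
chain of roots before `α_k` forces the places of the images of the first coordinates to rise and
then fall, so the `r` largest of them come from an interval. Exchanging the ends of that interval,
with suitable sign changes, respects all conditions and reverses the determinant. Here `r = 1`
serves for B; `r = 2` for C, or `r = 1` if the chain is a single place; and `r = 3` for D, or `r =
2` if the chain has two places. In type D the root `α_{l-1}` reduces to a full chain by a sign
change of the last coordinate, and for `α_1` only four elements are left, with the sum `2 + 2 (-1) ^
(l - 1)`. In type A the elements are shuffles of two blocks with alternating parities. If `n₁` and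
`n₂` are even, reversing the values and both blocks changes the sign; otherwise all these shuffles
are even, and the identity is one of them.

Exceptional types. If `w₀ = -1`, right multiplication by `w₀ w_J`, with `w_J` longest in the
parabolic subgroup, permutes the simple roots other than `α_k` and so preserves `oddReps`. Its
determinant is `-1` when the number of positive roots outside the parabolic subsystem is odd, which
gives zero. The other cases are searched by kernel computation: images of simple roots are chosen
one at a time with the prescribed inner products, and a complete frame is reduced by simple
reflections. Reaching the identity certifies membership in the Weyl group and yields the
determinant. In `E_8` the search is first cut down by left multiplication with the reflection in
`α_a + α_b` for neighbours `a`, `b`: this root has height 2, so parities survive, and all elements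
cancel for which neither `α_a` nor `α_b` is among the images. Sets, tables and frames are packed
into single natural numbers so that the kernel works with arithmetic on literals. -/

/-- The determinant of an automorphism of the root lattice, as an integer. -/
noncomputable def detZ (w : RootLattice l ≃ₗ[ℤ] RootLattice l) : ℤ := LinearMap.det w.toLinearMap

theorem detZ_one : detZ (1 : RootLattice l ≃ₗ[ℤ] RootLattice l) = 1 := by
  have : (1 : RootLattice l ≃ₗ[ℤ] RootLattice l).toLinearMap = LinearMap.id := rfl
  rw [detZ, this, LinearMap.det_id]

theorem detZ_mul (v w : RootLattice l ≃ₗ[ℤ] RootLattice l) :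
    detZ (v * w) = detZ v * detZ w := by
  have : (v * w).toLinearMap = v.toLinearMap ∘ₗ w.toLinearMap := rfl
  rw [detZ, this, LinearMap.det_comp, detZ, detZ]

theorem detZ_simpleReflection (X : CartanDatum l) (i : Fin l) :
    detZ (simpleReflection X i) = -1 := by
  have : (simpleReflection X i).toLinearMap =
      LinearMap.transvection (-coroot X i) (simpleRoot i) := by
    ext1 j
    ext1
    simp [simpleReflection, Module.reflection_apply, LinearMap.transvection.apply,
      sub_eq_add_neg]
  rw [detZ, this, LinearMap.transvection.det, LinearMap.neg_apply, coroot_simpleRoot, X.diag]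
  norm_num

theorem simpleReflection_apply (X : CartanDatum l) (i : Fin l) (v : RootLattice l) :
    simpleReflection X i v = v - coroot X i v • simpleRoot i := by
  simp [simpleReflection, Module.reflection_apply]

theorem simpleReflection_mul_self (X : CartanDatum l) (i : Fin l) :
    simpleReflection X i * simpleReflection X i = 1 := by
  have h : (simpleReflection X i)⁻¹ = simpleReflection X i := Module.reflection_inv _
  nth_rewrite 2 [← h]
  exact mul_inv_cancel _

theorem simpleReflection_inv (X : CartanDatum l) (i : Fin l) :
    (simpleReflection X i)⁻¹ = simpleReflection X i := Module.reflection_inv _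

theorem simpleReflection_self (X : CartanDatum l) (i : Fin l) :
    simpleReflection X i (simpleRoot i) = -simpleRoot i := by
  rw [simpleReflection_simpleRoot, X.diag, two_smul]
  abel

theorem simpleRoot_apply (i j : Fin l) : simpleRoot i j = if j = i then 1 else 0 := by
  simp [simpleRoot, Pi.single_apply]

theorem eq_sum_simpleRoot (v : RootLattice l) : v = ∑ j, v j • simpleRoot j := by
  funext i
  simp [Finset.sum_apply, simpleRoot_apply]

theorem equiv_ext_simpleRoot {v w : RootLattice l ≃ₗ[ℤ] RootLattice l}
    (h : ∀ i, v (simpleRoot i) = w (simpleRoot i)) : v = w := by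
  ext1 x
  rw [eq_sum_simpleRoot x]
  simp only [map_sum, map_smul, h]

/-- The product of the simple reflections along a word. -/
def wordProd (X : CartanDatum l) (L : List (Fin l)) : RootLattice l ≃ₗ[ℤ] RootLattice l :=
  (L.map (simpleReflection X)).prod

@[simp] theorem wordProd_nil (X : CartanDatum l) : wordProd X [] = 1 := rfl

@[simp] theorem wordProd_cons (X : CartanDatum l) (i : Fin l) (L : List (Fin l)) :
    wordProd X (i :: L) = simpleReflection X i * wordProd X L := by
  simp [wordProd]

@[simp] theorem wordProd_append (X : CartanDatum l) (L M : List (Fin l)) :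
    wordProd X (L ++ M) = wordProd X L * wordProd X M := by
  simp [wordProd]

theorem detZ_wordProd (X : CartanDatum l) (L : List (Fin l)) :
    detZ (wordProd X L) = (-1) ^ L.length := by
  induction L with
  | nil => simp [detZ_one]
  | cons i L ih => simp [detZ_mul, detZ_simpleReflection, ih, pow_succ]

theorem wordProd_reverse (X : CartanDatum l) (L : List (Fin l)) :
    wordProd X L.reverse = (wordProd X L)⁻¹ := by
  induction L with
  | nil => simp
  | cons i L ih => simp [ih, simpleReflection_inv]

theorem mem_parabolic_iff (X : CartanDatum l) (J : Finset (Fin l))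
    (w : RootLattice l ≃ₗ[ℤ] RootLattice l) :
    w ∈ parabolic X J ↔ ∃ L : List (Fin l), (∀ i ∈ L, i ∉ J) ∧ wordProd X L = w := by
  constructor
  · intro h
    induction h using Subgroup.closure_induction with
    | mem x hx =>
      obtain ⟨i, hi, rfl⟩ := hx
      exact ⟨[i], by simpa using hi, by simp⟩
    | one => exact ⟨[], by simp, rfl⟩
    | mul x y _ _ hx hy =>
      obtain ⟨L, hL, rfl⟩ := hx
      obtain ⟨M, hM, rfl⟩ := hy
      exact ⟨L ++ M, fun i hi => (List.mem_append.1 hi).elim (hL i) (hM i), by simp⟩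
    | inv x _ hx =>
      obtain ⟨L, hL, rfl⟩ := hx
      exact ⟨L.reverse, by simpa using hL, wordProd_reverse X L⟩
  · rintro ⟨L, hL, rfl⟩
    induction L with
    | nil => exact one_mem _
    | cons i L ih =>
      rw [wordProd_cons]
      exact mul_mem (Subgroup.subset_closure ⟨i, hL i (by simp), rfl⟩)
        (ih fun j hj => hL j (by simp [hj]))

theorem weylGroup_eq_parabolic (X : CartanDatum l) : weylGroup X = parabolic X ∅ := by
  rw [weylGroup, parabolic]
  congr 1
  ext s
  simp [eq_comm]

theorem mem_weylGroup_iff (X : CartanDatum l) (w : RootLattice l ≃ₗ[ℤ] RootLattice l) :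
    w ∈ weylGroup X ↔ ∃ L : List (Fin l), wordProd X L = w := by
  simp [weylGroup_eq_parabolic, mem_parabolic_iff]

theorem simpleReflection_mem_weylGroup (X : CartanDatum l) (i : Fin l) :
    simpleReflection X i ∈ weylGroup X := Subgroup.subset_closure ⟨i, rfl⟩

theorem wordProd_mem_weylGroup (X : CartanDatum l) (L : List (Fin l)) :
    wordProd X L ∈ weylGroup X := (mem_weylGroup_iff X _).2 ⟨L, rfl⟩

theorem parabolic_le_weylGroup (X : CartanDatum l) (J : Finset (Fin l)) :
    parabolic X J ≤ weylGroup X := by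
  intro w hw
  obtain ⟨L, -, rfl⟩ := (mem_parabolic_iff X J w).1 hw
  exact wordProd_mem_weylGroup X L

theorem length_wordProd_le (X : CartanDatum l) (L : List (Fin l)) :
    length X (wordProd X L) ≤ L.length := Nat.sInf_le ⟨L, rfl, rfl⟩

theorem exists_reduced_word (X : CartanDatum l) {w : RootLattice l ≃ₗ[ℤ] RootLattice l}
    (hw : w ∈ weylGroup X) : ∃ L : List (Fin l), L.length = length X w ∧ wordProd X L = w := by
  obtain ⟨L, hL⟩ := (mem_weylGroup_iff X w).1 hw
  exact Nat.sInf_mem (s := {n | ∃ L : List (Fin l), L.length = n ∧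
    (L.map (simpleReflection X)).prod = w}) ⟨L.length, L, rfl, hL⟩

/-- Simple reflections have determinant `-1`. This replaces the length by a multiplicative sign,
which every bijection used later either keeps or reverses. -/
theorem neg_one_pow_length (X : CartanDatum l) {w : RootLattice l ≃ₗ[ℤ] RootLattice l}
    (hw : w ∈ weylGroup X) : (-1 : ℤ) ^ length X w = detZ w := by
  obtain ⟨L, hL, rfl⟩ := exists_reduced_word X hw
  rw [← hL, detZ_wordProd]

theorem wordProd_apply_of_mem (X : CartanDatum l) {J : Finset (Fin l)} (L : List (Fin l))
    (hL : ∀ i ∈ L, i ∉ J) (v : RootLattice l) {m : Fin l} (hm : m ∈ J) :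
    wordProd X L v m = v m := by
  induction L with
  | nil => rfl
  | cons i L ih =>
    have hi : m ≠ i := fun h => hL i (by simp) (h ▸ hm)
    rw [wordProd_cons, LinearEquiv.mul_apply, simpleReflection_apply]
    simp [simpleRoot_apply, hi, ih fun j hj => hL j (by simp [hj])]

/-- The defining properties of the set of positive roots. -/
structure IsPositiveSystem (X : CartanDatum l) (P : Set (RootLattice l)) : Prop where
  simple_mem : ∀ i, simpleRoot i ∈ P
  nonneg : ∀ v ∈ P, 0 ≤ v
  ne_zero : ∀ v ∈ P, v ≠ 0
  reflection_mem : ∀ v ∈ P, ∀ i, v ≠ simpleRoot i → simpleReflection X i v ∈ P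

namespace IsPositiveSystem

variable {X : CartanDatum l} {P : Set (RootLattice l)} (hP : IsPositiveSystem X P)
include hP

theorem neg_notMem {v : RootLattice l} (hv : v ∈ P) : -v ∉ P := fun h =>
  hP.ne_zero v hv (le_antisymm (neg_nonneg.1 (hP.nonneg _ h)) (hP.nonneg v hv))

theorem mem_or_neg_mem_of_wordProd (L : List (Fin l)) {v : RootLattice l} (hv : v ∈ P) :
    wordProd X L v ∈ P ∨ -wordProd X L v ∈ P := by
  have key : ∀ i, ∀ u ∈ P, simpleReflection X i u ∈ P ∨ -simpleReflection X i u ∈ P := by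
    intro i u hu
    by_cases h : u = simpleRoot i
    · right
      rw [h, simpleReflection_self, neg_neg]
      exact hP.simple_mem i
    · exact Or.inl (hP.reflection_mem u hu i h)
  induction L with
  | nil => exact Or.inl hv
  | cons i L ih =>
    rw [wordProd_cons, LinearEquiv.mul_apply]
    rcases ih with h | h
    · exact key i _ h
    · have := key i _ h
      rw [map_neg, neg_neg] at this
      exact this.symm

theorem mem_or_neg_mem {w : RootLattice l ≃ₗ[ℤ] RootLattice l} (hw : w ∈ weylGroup X)
    {v : RootLattice l} (hv : v ∈ P) : w v ∈ P ∨ -w v ∈ P := by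
  obtain ⟨L, rfl⟩ := (mem_weylGroup_iff X w).1 hw
  exact hP.mem_or_neg_mem_of_wordProd L hv

/-- The element `s_i (w s_j w⁻¹)` fixes `α_i` and moves every vector by a multiple of `α_i`. It and
its inverse send `α_m` to `α_m ± c α_i`, and both vectors must be roots of one sign, so `c = 0`. No
invariant form is needed. -/
theorem simpleReflection_conj {w : RootLattice l ≃ₗ[ℤ] RootLattice l} (hw : w ∈ weylGroup X)
    {i j : Fin l} (h : w (simpleRoot j) = simpleRoot i) :
    w * simpleReflection X j = simpleReflection X i * w := by
  set u := simpleReflection X i * (w * simpleReflection X j * w⁻¹) with hu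
  have huW : u ∈ weylGroup X :=
    mul_mem (simpleReflection_mem_weylGroup X i)
      (mul_mem (mul_mem hw (simpleReflection_mem_weylGroup X j)) (inv_mem hw))
  have hwinv : ∀ x, w (w⁻¹ x) = x := fun x => w.apply_symm_apply x
  have happ : ∀ x, u x = x + (coroot X j (w⁻¹ x) - coroot X i x) • simpleRoot i := by
    intro x
    simp only [hu, LinearEquiv.mul_apply, simpleReflection_apply X j, map_sub, map_smul, h,
      hwinv]
    rw [simpleReflection_apply X i x, simpleReflection_self]
    module
  have hwi : w⁻¹ (simpleRoot i) = simpleRoot j := by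
    rw [← h]; exact w.symm_apply_apply _
  have hi : u (simpleRoot i) = simpleRoot i := by
    rw [happ, hwi, coroot_simpleRoot, coroot_simpleRoot, X.diag, X.diag]; simp
  have hone : u = 1 := by
    apply equiv_ext_simpleRoot
    intro m
    by_cases hm : m = i
    · rw [hm, hi]; rfl
    set c := coroot X j (w⁻¹ (simpleRoot m)) - coroot X i (simpleRoot m) with hc
    have hum : u (simpleRoot m) = simpleRoot m + c • simpleRoot i := happ _
    have hum' : u⁻¹ (simpleRoot m) = simpleRoot m - c • simpleRoot i := by
      have h1 : u (simpleRoot m - c • simpleRoot i) = simpleRoot m := by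
        rw [map_sub, map_smul, hi, hum]; abel
      nth_rewrite 1 [← h1]
      exact u.symm_apply_apply _
    -- The coordinate at `m` is `1`, so the image of `α_m` cannot be negative; hence its coordinate
    -- at `i` is nonnegative.
    have aux : ∀ (v : RootLattice l ≃ₗ[ℤ] RootLattice l) (d : ℤ), v ∈ weylGroup X →
        v (simpleRoot m) = simpleRoot m + d • simpleRoot i → 0 ≤ d := by
      intro v d hv hvm
      rcases hP.mem_or_neg_mem hv (hP.simple_mem m) with h1 | h1
      · have := hP.nonneg _ h1 i
        rw [hvm] at this
        simpa [simpleRoot_apply, Ne.symm hm] using this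
      · have := hP.nonneg _ h1 m
        rw [hvm] at this
        simp [simpleRoot_apply, hm] at this
    have h1 := aux u c huW hum
    have h2 := aux u⁻¹ (-c) (inv_mem huW) (by rw [hum', neg_smul, sub_eq_add_neg])
    have hc0 : c = 0 := by omega
    rw [hum, hc0]; simp
  have h3 : w * simpleReflection X j * w⁻¹ = simpleReflection X i := by
    have := congrArg (fun t => simpleReflection X i * t) (hu.symm.trans hone)
    simpa [← mul_assoc, simpleReflection_mul_self] using this
  rw [← h3]; group

/-- Reading the word from the right, the image of `α_j` first becomes negative at some letter `i`,
where it equals `α_i`. There `s_i v s_j = v`, so the letter can be dropped. -/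
theorem exchange (L : List (Fin l)) (j : Fin l) (hneg : -wordProd X L (simpleRoot j) ∈ P) :
    ∃ M : List (Fin l), M ⊆ L ∧ M.length + 1 = L.length ∧
      wordProd X M = wordProd X L * simpleReflection X j := by
  induction L with
  | nil => exact absurd hneg (hP.neg_notMem (hP.simple_mem j))
  | cons i L ih =>
    rcases hP.mem_or_neg_mem_of_wordProd L (hP.simple_mem j) with h | h
    · have hvi : wordProd X L (simpleRoot j) = simpleRoot i := by
        by_contra hne
        exact hP.neg_notMem (hP.reflection_mem _ h i hne) hneg
      refine ⟨L, List.subset_cons_self i L, rfl, ?_⟩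
      rw [wordProd_cons, mul_assoc,
        hP.simpleReflection_conj (wordProd_mem_weylGroup X L) hvi, ← mul_assoc,
        simpleReflection_mul_self, one_mul]
    · obtain ⟨M, hML, hlen, hM⟩ := ih h
      refine ⟨i :: M, List.cons_subset_cons i hML, by simpa using hlen, ?_⟩
      rw [wordProd_cons, wordProd_cons, hM, mul_assoc]

theorem pos_of_mem_minCosetReps {J : Finset (Fin l)} {w : RootLattice l ≃ₗ[ℤ] RootLattice l}
    (hw : w ∈ minCosetReps X J) {j : Fin l} (hj : j ∉ J) : w (simpleRoot j) ∈ P := by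
  rcases hP.mem_or_neg_mem hw.1 (hP.simple_mem j) with h | h
  · exact h
  · obtain ⟨L, hL, rfl⟩ := exists_reduced_word X hw.1
    obtain ⟨M, -, hlen, hM⟩ := hP.exchange L j h
    have h1 := hw.2 (simpleReflection X j) (Subgroup.subset_closure ⟨j, hj, rfl⟩)
    have h2 := length_wordProd_le X M
    rw [hM] at h2
    omega

/-- If a shortest word in the letters outside `J` ended in `j`, the word before `j` would send `α_j`
to a negative root, and the exchange would give a shorter word for the same element. -/
theorem eq_one_of_parabolic {J : Finset (Fin l)} {v : RootLattice l ≃ₗ[ℤ] RootLattice l}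
    (hv : v ∈ parabolic X J) (hpos : ∀ j, j ∉ J → v (simpleRoot j) ∈ P) : v = 1 := by
  classical
  obtain ⟨L, hL, hLv⟩ := (mem_parabolic_iff X J v).1 hv
  let Q : ℕ → Prop := fun n => ∃ L : List (Fin l), L.length = n ∧ (∀ i ∈ L, i ∉ J) ∧
    wordProd X L = v
  have hQ : ∃ n, Q n := ⟨L.length, L, rfl, hL, hLv⟩
  obtain ⟨K, hKlen, hKJ, hKv⟩ := Nat.find_spec hQ
  rcases List.eq_nil_or_concat K with h | ⟨K', j, h⟩
  · rw [← hKv, h]; rfl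
  · exfalso
    rw [List.concat_eq_append] at h
    subst h
    have hj : j ∉ J := hKJ j (by simp)
    have h1 : -wordProd X K' (simpleRoot j) ∈ P := by
      have := hpos j hj
      rwa [← hKv, wordProd_append, LinearEquiv.mul_apply, wordProd_cons, wordProd_nil, mul_one,
        simpleReflection_self, map_neg] at this
    obtain ⟨M, hMK, hMlen, hM⟩ := hP.exchange K' j h1
    have hlt : M.length < Nat.find hQ := by
      rw [← hKlen, List.length_append]; omega
    refine Nat.find_min hQ hlt ⟨M, rfl, fun i hi => hKJ i (by simp [hMK hi]), ?_⟩
    rw [hM, ← hKv, wordProd_append]; simp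

/-- The converse moves `w` by some `v₀` in the parabolic subgroup to a shortest element of the coset
and shows `v₀ = 1`. Otherwise `v₀` makes some `α_j` negative, and `w v₀ α_j` would be both positive
and nonpositive. -/
theorem mem_minCosetReps_iff {J : Finset (Fin l)} {w : RootLattice l ≃ₗ[ℤ] RootLattice l} :
    w ∈ minCosetReps X J ↔ w ∈ weylGroup X ∧ ∀ j, j ∉ J → w (simpleRoot j) ∈ P := by
  classical
  refine ⟨fun h => ⟨h.1, fun j hj => hP.pos_of_mem_minCosetReps h hj⟩, ?_⟩
  rintro ⟨hw, hpos⟩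
  obtain ⟨v₀, hv₀, hmin⟩ : ∃ v₀ ∈ parabolic X J, ∀ v ∈ parabolic X J,
      length X (w * v₀) ≤ length X (w * v) := by
    have hne : ({n | ∃ v ∈ parabolic X J, length X (w * v) = n} : Set ℕ).Nonempty :=
      ⟨_, 1, one_mem _, rfl⟩
    obtain ⟨v₀, hv₀, h⟩ : ∃ v ∈ parabolic X J, length X (w * v) = _ := Nat.sInf_mem hne
    exact ⟨v₀, hv₀, fun v hv => h.trans_le (Nat.sInf_le ⟨v, hv, rfl⟩)⟩
  have hm : w * v₀ ∈ minCosetReps X J :=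
    ⟨mul_mem hw (parabolic_le_weylGroup X J hv₀), fun v hv => by
      rw [mul_assoc]; exact hmin _ (mul_mem hv₀ hv)⟩
  have hone : v₀ = 1 := by
    refine hP.eq_one_of_parabolic hv₀ fun j hj => ?_
    rcases hP.mem_or_neg_mem (parabolic_le_weylGroup X J hv₀) (hP.simple_mem j) with h | h
    · exact h
    exfalso
    have h1 : w (v₀ (simpleRoot j)) ∈ P := hP.pos_of_mem_minCosetReps hm hj
    obtain ⟨L, hL, hLv⟩ := (mem_parabolic_iff X J v₀).1 hv₀
    -- Elements of the parabolic subgroup do not change coordinates in `J`, so `-v₀ α_j` is a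
    -- nonnegative combination of simple roots outside `J`, all of which `w` makes positive.
    have h2 : 0 ≤ -w (v₀ (simpleRoot j)) := by
      rw [← map_neg, eq_sum_simpleRoot (-v₀ (simpleRoot j)), map_sum]
      refine Finset.sum_nonneg fun i _ => ?_
      rw [map_smul]
      by_cases hi : i ∈ J
      · have : (-v₀ (simpleRoot j)) i = 0 := by
          rw [Pi.neg_apply, ← hLv, wordProd_apply_of_mem X L hL _ hi, simpleRoot_apply,
            if_neg (show ¬ i = j from fun h => hj (h ▸ hi)), neg_zero]
        rw [this, zero_smul]
      · exact smul_nonneg (hP.nonneg _ h i) (hP.nonneg _ (hpos i hi))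
    exact hP.ne_zero _ h1 (le_antisymm (neg_nonneg.1 h2) (hP.nonneg _ h1))
  rw [hone, mul_one] at hm
  exact hm

theorem eq_one_of_forall_pos {w : RootLattice l ≃ₗ[ℤ] RootLattice l} (hw : w ∈ weylGroup X)
    (hpos : ∀ j, w (simpleRoot j) ∈ P) : w = 1 :=
  hP.eq_one_of_parabolic (J := ∅) (by rwa [← weylGroup_eq_parabolic]) fun j _ => hpos j

end IsPositiveSystem

/-! ### Heights, signs and the sum of determinants -/

/-- The height of an element of the root lattice. -/
def height (v : RootLattice l) : ℤ := ∑ i, v i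

theorem height_simpleRoot (i : Fin l) : height (simpleRoot i) = 1 := by
  simp [height, simpleRoot_apply]

/-- As a character, the constant tuple `-1` takes the value `(-1) ^ height v` at `v`. -/
theorem signAction_inv_neg_one (w : RootLattice l ≃ₗ[ℤ] RootLattice l) (j : Fin l) :
    signAction w⁻¹ (fun _ => -1) j = (-1) ^ height (w (simpleRoot j)) := by
  have zpow_sum : ∀ (f : Fin l → ℤ) (s : Finset (Fin l)),
      (-1 : ℤˣ) ^ ∑ x ∈ s, f x = ∏ x ∈ s, (-1 : ℤˣ) ^ f x := by
    intro f s
    induction s using Finset.induction_on with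
    | empty => simp
    | insert x s hx ih => rw [Finset.sum_insert hx, Finset.prod_insert hx, zpow_add, ih]
  rw [signAction, inv_inv, height, zpow_sum]

theorem neg_one_zpow_eq_neg_one_iff (n : ℤ) : (((-1 : ℤˣ) ^ n : ℤˣ) : ℤ) = -1 ↔ Odd n := by
  rcases Int.even_or_odd n with h | h
  · rw [h.neg_one_zpow]; simpa using h
  · rw [h.neg_one_zpow]; simpa using h

/-- The elements of `W` that send every simple root except `α_k` to a positive root of odd
height. -/
def oddReps (X : CartanDatum l) (P : Set (RootLattice l)) (k : Fin l) :
    Set (RootLattice l ≃ₗ[ℤ] RootLattice l) :=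
  {w | w ∈ weylGroup X ∧ ∀ j, j ≠ k → w (simpleRoot j) ∈ P ∧ Odd (height (w (simpleRoot j)))}

theorem IsPositiveSystem.negCosetReps_eq {X : CartanDatum l} {P : Set (RootLattice l)}
    (hP : IsPositiveSystem X P) (k : Fin l) : negCosetReps X {k} = oddReps X P k := by
  ext w
  simp only [negCosetReps, oddReps, Set.mem_ofPred_eq, hP.mem_minCosetReps_iff,
    Finset.mem_singleton, and_assoc, ← forall_and]
  refine and_congr_right fun _ => forall_congr' fun j => ?_
  have hs : ∀ hj : j ≠ k, sigma {k} (signAction w⁻¹ fun _ => -1) j = -1 ↔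
      Odd (height (w (simpleRoot j))) := fun hj => by
    rw [sigma, if_neg (by simpa using hj), signAction_inv_neg_one, neg_one_zpow_eq_neg_one_iff]
  exact forall_congr' fun hj => and_congr_right fun _ => hs hj

/-- The signed count of a set of automorphisms of the root lattice. -/
noncomputable def detSum (S : Set (RootLattice l ≃ₗ[ℤ] RootLattice l)) : ℤ :=
  ∑ᶠ w ∈ S, detZ w

theorem IsPositiveSystem.incidence_eq {X : CartanDatum l} {P : Set (RootLattice l)}
    (hP : IsPositiveSystem X P) (k : Fin l) :
    incidence X k = (-1) ^ k.val * |detSum (oddReps X P k)| := by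
  rw [incidence, hP.negCosetReps_eq, detSum]
  congr 2
  exact finsum_mem_congr rfl fun w hw => neg_one_pow_length X hw.1

theorem orientable_of_not_topEdge {X : CartanDatum l} (h : ∀ k, ¬ TopEdge X k) :
    Orientable X := by
  have h0 : incidence X = 0 := funext fun k => not_not.1 (h k)
  have htop : topHomology X = ⊤ := by
    rw [topHomology, LinearMap.ker_eq_top, topBoundary, h0, LinearMap.toSpanSingleton_zero]
  exact ⟨(LinearEquiv.ofEq _ _ htop).trans Submodule.topEquiv⟩

theorem nonorientable_of_topEdge {X : CartanDatum l} {k : Fin l} (h : TopEdge X k) :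
    Nonorientable X := by
  rw [Nonorientable, topHomology, eq_bot_iff]
  intro n hn
  have hn' : n • incidence X = 0 := by simpa [topBoundary] using hn
  have := congrFun hn' k
  rw [Pi.smul_apply, Pi.zero_apply, smul_eq_mul] at this
  exact (mul_eq_zero.1 this).resolve_right h

end NilpotentToda

namespace NilpotentToda

variable {l : ℕ}

/-! ### Packed natural numbers -/

/-- Evaluates `n` before it is handed to `f`. -/
def force {α : Type} (n : ℕ) (f : ℕ → α) : α := match n with
  | 0 => f 0
  | Nat.succ m => f (Nat.succ m)

@[simp] theorem force_eq {α : Type} (n : ℕ) (f : ℕ → α) : force n f = f n := by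
  cases n <;> rfl

/-- The digit with the number `j` of `v` in base `2 ^ b`. -/
def digit (b v j : ℕ) : ℕ := Nat.mod (Nat.shiftRight v (Nat.mul b j)) (Nat.pow 2 b)

theorem digit_eq (b v j : ℕ) : digit b v j = v / 2 ^ (b * j) % 2 ^ b := by
  change v >>> (b * j) % 2 ^ b = _
  rw [Nat.shiftRight_eq_div_pow]

theorem digit_lt (b v j : ℕ) : digit b v j < 2 ^ b := by
  rw [digit_eq]; exact Nat.mod_lt _ (by positivity)

theorem sum_lt_two_pow (b n : ℕ) (f : ℕ → ℕ) (hf : ∀ i < n, f i < 2 ^ b) :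
    ∑ i ∈ Finset.range n, f i * 2 ^ (b * i) < 2 ^ (b * n) := by
  induction n with
  | zero => simp
  | succ n ih =>
    rw [Finset.sum_range_succ]
    have h1 := ih fun i hi => hf i (by omega)
    have h2 : (f n + 1) * 2 ^ (b * n) ≤ 2 ^ b * 2 ^ (b * n) :=
      Nat.mul_le_mul_right _ (hf n (by omega))
    rw [Nat.mul_succ, pow_add, mul_comm (2 ^ (b * n))]
    linarith

theorem digit_sum (b n : ℕ) (f : ℕ → ℕ) (hf : ∀ i < n, f i < 2 ^ b) {j : ℕ} (hj : j < n) :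
    digit b (∑ i ∈ Finset.range n, f i * 2 ^ (b * i)) j = f j := by
  induction n with
  | zero => omega
  | succ n ih =>
    rw [Finset.sum_range_succ, digit_eq]
    rcases Nat.lt_succ_iff_lt_or_eq.mp hj with h | rfl
    · have h2 : 2 ^ (b * n) = 2 ^ (b * j) * (2 ^ b * 2 ^ (b * (n - j - 1))) := by
        rw [← pow_add, ← pow_add]
        congr 1
        obtain ⟨t, rfl⟩ := Nat.exists_eq_add_of_lt h
        rw [show j + t + 1 - j - 1 = t by omega]; ring
      rw [h2, show ∀ x y z w : ℕ, x * (y * (z * w)) = y * (z * (w * x)) by intros; ring,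
        Nat.add_mul_div_left _ _ (by positivity), Nat.add_mul_mod_self_left, ← digit_eq]
      exact ih (fun i hi => hf i (by omega)) h
    · rw [Nat.add_mul_div_right _ _ (by positivity),
        Nat.div_eq_of_lt (sum_lt_two_pow b j f fun i hi => hf i (by omega)), zero_add]
      exact Nat.mod_eq_of_lt (hf j (by omega))

/-- The list `L` of digits, packed in base `2 ^ b`. -/
def packList (b : ℕ) (L : List ℕ) : ℕ :=
  L.foldr (fun c a => Nat.add c (Nat.shiftLeft a b)) 0

theorem digit_packList (b : ℕ) (L : List ℕ) (hL : ∀ c ∈ L, c < 2 ^ b) (r : ℕ) :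
    digit b (packList b L) r = L.getD r 0 := by
  induction L generalizing r with
  | nil => simp [digit_eq, packList]
  | cons c L ih =>
    have hc := hL c (by simp)
    have h : packList b (c :: L) = c + packList b L * 2 ^ b := by
      change c + packList b L <<< b = _
      rw [Nat.shiftLeft_eq]
    rw [digit_eq, h]
    cases r with
    | zero => simp [Nat.mod_eq_of_lt hc]
    | succ r =>
      rw [Nat.mul_succ, add_comm (b * r), pow_add, ← Nat.div_div_eq_div_mul,
        Nat.add_mul_div_right _ _ (by positivity), Nat.div_eq_of_lt hc, zero_add, ← digit_eq,
        ih fun c hc => hL c (by simp [hc])]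
      simp

/-- The sum of the digits of `c` in base `16`. -/
def digitSum : ℕ → ℕ → ℕ
  | 0, _ => 0
  | Nat.succ n, c => Nat.add (digitSum n c) (digit 4 c n)

theorem digitSum_eq (n c : ℕ) : digitSum n c = ∑ i ∈ Finset.range n, digit 4 c i := by
  induction n with
  | zero => rfl
  | succ n ih => rw [Finset.sum_range_succ, ← ih]; rfl

/-- The inner product of the digits of `a` and `c` in base `16`. -/
def digitDot : ℕ → ℕ → ℕ → ℕ
  | 0, _, _ => 0
  | Nat.succ n, a, c => Nat.add (digitDot n a c) (Nat.mul (digit 4 a n) (digit 4 c n))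

theorem digitDot_eq (n a c : ℕ) :
    digitDot n a c = ∑ i ∈ Finset.range n, digit 4 a i * digit 4 c i := by
  induction n with
  | zero => rfl
  | succ n ih => rw [Finset.sum_range_succ, ← ih]; rfl

/-- The entry `(i, j)` of a packed matrix. -/
def entry (m i j : ℕ) : ℕ := digit 4 (digit 32 m i) j

/-! ### Roots as numbers -/

/-- The vector whose coordinates are the digits of `c` in base `16`. -/
def rootVec (l c : ℕ) : RootLattice l := fun i => (digit 4 c i : ℤ)

/-- The value at `16` of the polynomial with the coefficients `v`. -/
def codeZ (v : RootLattice l) : ℤ := ∑ i, v i * 16 ^ (i : ℕ)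

theorem codeZ_neg (v : RootLattice l) : codeZ (-v) = -codeZ v := by
  simp [codeZ]

theorem codeZ_add (u v : RootLattice l) : codeZ (u + v) = codeZ u + codeZ v := by
  simp [codeZ, add_mul, Finset.sum_add_distrib]

theorem codeZ_smul (a : ℤ) (v : RootLattice l) : codeZ (a • v) = a * codeZ v := by
  simp [codeZ, Finset.mul_sum, mul_assoc]

theorem codeZ_sub (u v : RootLattice l) : codeZ (u - v) = codeZ u - codeZ v := by
  rw [sub_eq_add_neg, codeZ_add, codeZ_neg, sub_eq_add_neg]

theorem codeZ_simpleRoot (i : Fin l) : codeZ (simpleRoot i) = 16 ^ (i : ℕ) := by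
  simp [codeZ, simpleRoot_apply]

/-- Uniqueness of the expansion in base 16. It recognises a reflected root by its code alone, once
the coordinates are known to lie between 0 and 15. -/
theorem rootVec_eq_of_codeZ {v : RootLattice l} {c : ℕ} (hv : ∀ j, 0 ≤ v j ∧ v j < 16)
    (hc : (c : ℤ) = codeZ v) : rootVec l c = v := by
  set f : ℕ → ℕ := fun i => if h : i < l then (v ⟨i, h⟩).toNat else 0 with hf
  have hfv : ∀ j : Fin l, (f j : ℤ) = v j := fun j => by
    simp only [hf, j.isLt, dif_pos, Fin.eta]
    exact Int.toNat_of_nonneg (hv j).1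
  have hc' : c = ∑ i ∈ Finset.range l, f i * 2 ^ (4 * i) := by
    zify
    rw [hc, codeZ, Finset.sum_range]
    refine Finset.sum_congr rfl fun i _ => ?_
    rw [hfv, pow_mul]; norm_num
  have hlt : ∀ i < l, f i < 2 ^ 4 := fun i hi => by
    have h1 := hfv ⟨i, hi⟩
    have h2 := (hv ⟨i, hi⟩).2
    zify
    rw [show ((f i : ℕ) : ℤ) = _ from h1]
    exact h2.trans_le (by norm_num)
  funext j
  rw [rootVec, hc', digit_sum 4 l f hlt j.isLt, hfv]

theorem codeZ_rootVec {c : ℕ} (hc : c < 16 ^ l) : codeZ (rootVec l c) = c := by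
  have key : ∀ n, ∑ i ∈ Finset.range n, digit 4 c i * 16 ^ i = c % 16 ^ n := fun n => by
    induction n with
    | zero => simp [Nat.mod_one]
    | succ n ih =>
      rw [Finset.sum_range_succ, ih, Nat.mod_pow_succ, digit_eq, pow_mul, mul_comm]
      norm_num
  have h := key l
  rw [Nat.mod_eq_of_lt hc] at h
  rw [codeZ]
  conv_rhs => rw [← h]
  rw [Finset.sum_range]
  push_cast
  rfl

theorem rootVec_sixteen_pow (i : Fin l) : rootVec l (16 ^ (i : ℕ)) = simpleRoot i := by
  apply rootVec_eq_of_codeZ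
  · intro j; rw [simpleRoot_apply]; split_ifs <;> norm_num
  · rw [codeZ_simpleRoot]; push_cast; rfl

theorem height_rootVec (c : ℕ) : height (rootVec l c) = digitSum l c := by
  rw [height, digitSum_eq, Finset.sum_range]; push_cast; rfl

/-- The data for a search in the Weyl group: the codes of the positive roots of odd and of even
height, the packed Cartan matrix and the packed matrix of an invariant form, both shifted by `4`,
the packed changes of a frame under the simple reflections, and the packed image of the simple
roots under a diagram automorphism. -/
structure SearchData where
  odd : List ℕ
  even : List ℕ
  cartan : ℕ
  form : ℕ
  change : ℕ
  auto : ℕ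

namespace SearchData

variable (D : SearchData)

def codes : List ℕ := D.odd ++ D.even

/-- Whether the reflection of the root with the code `c` in the simple root `α_i` is in the
table. -/
def reflectionMem (l c i : ℕ) : Bool :=
  -- The packed Cartan matrix is shifted by 4, so `n` is the value of the coroot plus `h`, with `h`
  -- four times the height. Comparing `n` with `h` avoids negative numbers.
  force (digitDot l (digit 32 D.cartan i) c) fun n => force (Nat.mul 4 (digitSum l c)) fun h =>
    Nat.beq n h || Nat.beq c (Nat.pow 16 i) ||
    -- The new coordinate at `i` stays between 0 and 15, so that nothing is carried between digits.
    (Nat.ble n (Nat.add h (digit 4 c i)) && Nat.ble (Nat.add h (digit 4 c i)) (Nat.add n 15) &&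
      D.codes.any fun c' =>
        Nat.beq (Nat.add c' (Nat.mul n (Nat.pow 16 i))) (Nat.add c (Nat.mul h (Nat.pow 16 i))))

/-- The table describes a positive system of roots. -/
structure IsRootTable (X : CartanDatum l) : Prop where
  -- Codes then fit into 32 bits.
  rank_le : l ≤ 8
  -- A block of 128 bits holds a set of positive roots.
  length_le : D.codes.length ≤ 128
  nodup : D.codes.Nodup
  ne_zero : ∀ c ∈ D.codes, c ≠ 0
  lt : ∀ c ∈ D.codes, c < 16 ^ l
  odd : ∀ c ∈ D.odd, digitSum l c % 2 = 1
  even : ∀ c ∈ D.even, digitSum l c % 2 = 0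
  simple : ∀ i : Fin l, 16 ^ (i : ℕ) ∈ D.odd
  cartan : ∀ i j : Fin l, (entry D.cartan i j : ℤ) = X.mat j i + 4
  reflection : ∀ c ∈ D.codes, ∀ i < l, D.reflectionMem l c i = true

/-- The set of positive roots. -/
def posRoots (l : ℕ) : Set (RootLattice l) := {v | ∃ c ∈ D.codes, rootVec l c = v}

/-- The root with the number `r`. -/
def root (l r : ℕ) : RootLattice l := rootVec l (D.codes.getD r 0)

/-- The number of a positive root in the table. -/
def index (v : RootLattice l) : ℕ := D.codes.idxOf (codeZ v).toNat

variable {D} {X : CartanDatum l}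

namespace IsRootTable

theorem root_mem {r : ℕ} (hr : r < D.codes.length) : D.root l r ∈ D.posRoots l :=
  ⟨_, by rw [List.getD_eq_getElem _ _ hr]; exact List.getElem_mem hr, rfl⟩

variable (hD : D.IsRootTable X)
include hD

theorem codeZ_of_mem {c : ℕ} (hc : c ∈ D.codes) : codeZ (rootVec l c) = c :=
  codeZ_rootVec (hD.lt c hc)

theorem index_rootVec {c : ℕ} (hc : c ∈ D.codes) : D.index (rootVec l c) = D.codes.idxOf c := by
  rw [index, hD.codeZ_of_mem hc, Int.toNat_natCast]

theorem index_lt {v : RootLattice l} (hv : v ∈ D.posRoots l) : D.index v < D.codes.length := by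
  obtain ⟨c, hc, rfl⟩ := hv
  rw [hD.index_rootVec hc]
  exact List.idxOf_lt_length_of_mem hc

theorem root_index {v : RootLattice l} (hv : v ∈ D.posRoots l) : D.root l (D.index v) = v := by
  have h := hD.index_lt hv
  obtain ⟨c, hc, rfl⟩ := hv
  rw [hD.index_rootVec hc] at h ⊢
  rw [root, List.getD_eq_getElem _ _ h, List.getElem_idxOf]

theorem index_root {r : ℕ} (hr : r < D.codes.length) : D.index (D.root l r) = r := by
  rw [root, List.getD_eq_getElem _ _ hr, hD.index_rootVec (List.getElem_mem hr)]
  exact hD.nodup.idxOf_getElem r hr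

theorem index_lt_of_odd {v : RootLattice l} (hv : v ∈ D.posRoots l) (ho : Odd (height v)) :
    D.index v < D.odd.length := by
  obtain ⟨c, hc, rfl⟩ := hv
  rw [hD.index_rootVec hc]
  rw [codes, List.mem_append] at hc
  rcases hc with hc | hc
  · rw [codes, List.idxOf_append_of_mem hc]
    exact List.idxOf_lt_length_of_mem hc
  · have h := hD.even c hc
    rw [height_rootVec] at ho
    have := Nat.odd_iff.mp (by exact_mod_cast ho)
    omega

theorem odd_height_root {r : ℕ} (hr : r < D.odd.length) : Odd (height (D.root l r)) := by
  have hr' : r < D.codes.length := by rw [codes, List.length_append]; omega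
  rw [root, List.getD_eq_getElem _ _ hr', height_rootVec]
  have hmem : D.codes[r] ∈ D.odd := by
    simp only [codes, List.getElem_append_left hr, List.getElem_mem hr]
  exact_mod_cast Nat.odd_iff.mpr (hD.odd _ hmem)

theorem codeZ_pos {v : RootLattice l} (hv : v ∈ D.posRoots l) : 0 < codeZ v := by
  obtain ⟨c, hc, rfl⟩ := hv
  rw [hD.codeZ_of_mem hc]
  have := hD.ne_zero c hc
  omega

theorem codeZ_lt {v : RootLattice l} (hv : v ∈ D.posRoots l) : codeZ v < 2 ^ 32 := by
  obtain ⟨c, hc, rfl⟩ := hv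
  rw [hD.codeZ_of_mem hc]
  have h1 := hD.lt c hc
  have h2 : 16 ^ l ≤ 16 ^ 8 := Nat.pow_le_pow_right (by norm_num) hD.rank_le
  norm_num at h2 ⊢
  omega

theorem isPositiveSystem : IsPositiveSystem X (D.posRoots l) where
  simple_mem i := ⟨_, List.mem_append_left _ (hD.simple i), rootVec_sixteen_pow i⟩
  nonneg := by
    rintro v ⟨c, hc, rfl⟩ j
    exact Int.natCast_nonneg _
  ne_zero := by
    rintro v hv rfl
    have := hD.codeZ_pos hv
    simp [codeZ] at this
  reflection_mem := by
    rintro v ⟨c, hc, rfl⟩ i hi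
    have h := hD.reflection c hc i i.isLt
    have hn : ((digitDot l (digit 32 D.cartan i) c : ℕ) : ℤ) =
        coroot X i (rootVec l c) + 4 * digitSum l c := by
      rw [digitDot_eq, digitSum_eq, coroot_apply, Finset.sum_range, Finset.sum_range]
      push_cast
      rw [Finset.mul_sum, ← Finset.sum_add_distrib]
      refine Finset.sum_congr rfl fun j _ => ?_
      have := hD.cartan i j
      rw [entry] at this
      rw [this, rootVec]; ring
    simp only [reflectionMem, force_eq, Bool.or_eq_true, Bool.and_eq_true, Nat.beq_eq,
      Nat.ble_eq, List.any_eq_true] at h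
    set n := digitDot l (digit 32 D.cartan i) c
    rw [simpleReflection_apply]
    rcases h with (h | h) | ⟨⟨h1, h2⟩, c', hc', h3⟩
    · refine ⟨c, hc, ?_⟩
      have : coroot X i (rootVec l c) = 0 := by
        have h' : (n : ℤ) = 4 * digitSum l c := by rw [h]; rfl
        linarith
      rw [this, zero_smul, sub_zero]
    · exact absurd (by rw [h, Nat.pow_eq]; exact rootVec_sixteen_pow i) hi
    · refine ⟨c', hc', ?_⟩
      apply rootVec_eq_of_codeZ
      · intro j
        have hj : (0 : ℤ) ≤ rootVec l c j ∧ rootVec l c j < 16 :=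
          ⟨Int.natCast_nonneg _, by have := digit_lt 4 c j; rw [rootVec]; exact_mod_cast this⟩
        rw [Pi.sub_apply, Pi.smul_apply, simpleRoot_apply, smul_eq_mul]
        split_ifs with hij
        · subst hij
          have e : rootVec l c j = digit 4 c j := rfl
          simp only [Nat.add_eq, Nat.mul_eq] at h1 h2
          zify at h1 h2
          rw [e]
          constructor <;> linarith
        · simpa using hj
      · rw [codeZ_sub, codeZ_smul, codeZ_simpleRoot, hD.codeZ_of_mem hc]
        simp only [Nat.add_eq, Nat.mul_eq, Nat.pow_eq] at h3
        zify at h3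
        rw [hn] at h3
        linarith

/-- Positive roots have positive codes and their negatives negative ones, so the code also
determines a root of unknown sign. -/
theorem codeZ_injOn {u v : RootLattice l} (hu : u ∈ D.posRoots l ∨ -u ∈ D.posRoots l)
    (hv : v ∈ D.posRoots l ∨ -v ∈ D.posRoots l) (h : codeZ u = codeZ v) : u = v := by
  have key : ∀ {u v : RootLattice l}, u ∈ D.posRoots l → v ∈ D.posRoots l →
      codeZ u = codeZ v → u = v := by
    rintro _ _ ⟨c, hc, rfl⟩ ⟨c', hc', rfl⟩ h
    rw [hD.codeZ_of_mem hc, hD.codeZ_of_mem hc'] at h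
    rw [Nat.cast_injective h]
  rcases hu with hu | hu <;> rcases hv with hv | hv
  · exact key hu hv h
  · have h1 := hD.codeZ_pos hu
    have h2 := hD.codeZ_pos hv
    rw [codeZ_neg] at h2; omega
  · have h1 := hD.codeZ_pos hu
    have h2 := hD.codeZ_pos hv
    rw [codeZ_neg] at h1; omega
  · exact neg_injective (key hu hv (by rw [codeZ_neg, codeZ_neg, h]))

theorem abs_codeZ_lt {w : RootLattice l ≃ₗ[ℤ] RootLattice l} (hw : w ∈ weylGroup X)
    (j : Fin l) : |codeZ (w (simpleRoot j))| < 2 ^ 32 := by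
  rcases hD.isPositiveSystem.mem_or_neg_mem hw (hD.isPositiveSystem.simple_mem j) with h | h
  · rw [abs_of_pos (hD.codeZ_pos h)]; exact hD.codeZ_lt h
  · rw [← abs_neg, ← codeZ_neg, abs_of_pos (hD.codeZ_pos h)]; exact hD.codeZ_lt h

end IsRootTable

end SearchData

end NilpotentToda

namespace NilpotentToda

variable {l : ℕ}

/-! ### Signed counting in continuation passing style -/

/-- A computation that adds to the pair `(p, q)` the numbers of certain elements of determinant
`1` and `-1`, and hands the result to its continuation. -/
abbrev Counter : Type := (ℕ → ℕ → Bool) → ℕ → ℕ → Bool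

/-- The computation `F` counts the elements of `A`. -/
def Counts (F : Counter) (A : Set (RootLattice l ≃ₗ[ℤ] RootLattice l)) : Prop :=
  ∀ κ p q, F κ p q = true → ∃ p' q' : ℕ, κ p' q' = true ∧ (p' : ℤ) - q' = p - q + detSum A

/-- The exponent of the least power of `2` in the binary expansion of `m`, read off from the
table `t`; the powers of `2` are distinct modulo `131`. -/
def lookup (t m : ℕ) : ℕ := digit 8 t (Nat.mod (Nat.gcd m (Nat.pow 2 400)) 131)

/-- The table that turns the powers of `2` modulo `131` into exponents. -/
def exponentTable : ℕ → ℕ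
  | 0 => 0
  | Nat.succ n => Nat.lor (exponentTable n)
      (Nat.shiftLeft n (Nat.mul 8 (Nat.mod (Nat.pow 2 n) 131)))

/-- Runs `f` at all binary places of `m`. -/
def overBits (t : ℕ) : ℕ → ℕ → (ℕ → Counter) → Counter
  | 0, _, _ => fun _ _ _ => false
  | Nat.succ n, m, f => fun κ p q => force m fun m => bif Nat.beq m 0 then κ p q else
      -- Soundness does not rest on the table `t`: if the place read off is not set in `m`, the
      -- whole computation is false.
      force (lookup t m) fun r => bif Nat.beq 1 (digit 1 m r) then
        f r (fun p q => overBits t n (Nat.xor m (Nat.pow 2 r)) f κ p q) p q else false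

theorem testBit_xor_two_pow {m r : ℕ} (h : m.testBit r = true) (s : ℕ) :
    (Nat.xor m (2 ^ r)).testBit s = (m.testBit s && !decide (s = r)) := by
  change (m ^^^ 2 ^ r).testBit s = _
  rw [Nat.testBit_xor, Nat.testBit_two_pow]
  by_cases hs : s = r
  · subst hs; simp [h]
  · simp [hs, Ne.symm hs]

theorem digit_one_eq (m r : ℕ) : Nat.beq 1 (digit 1 m r) = m.testBit r := by
  rw [digit_eq, Nat.testBit_eq_decide_div_mod_eq, one_mul, pow_one]
  rcases Nat.mod_two_eq_zero_or_one (m / 2 ^ r) with h | h <;> rw [h] <;> rfl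

theorem detSum_empty : detSum (∅ : Set (RootLattice l ≃ₗ[ℤ] RootLattice l)) = 0 := by
  simp [detSum]

theorem detSum_add_of_disjoint {A B C : Set (RootLattice l ≃ₗ[ℤ] RootLattice l)}
    (hA : A.Finite) (hBC : Disjoint B C) (h : B ∪ C = A) :
    detSum A = detSum B + detSum C := by
  subst h
  exact finsum_mem_union hBC (hA.subset Set.subset_union_left)
    (hA.subset Set.subset_union_right)

theorem detSum_split {A : Set (RootLattice l ≃ₗ[ℤ] RootLattice l)} (hA : A.Finite)
    (p : (RootLattice l ≃ₗ[ℤ] RootLattice l) → Prop) :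
    detSum A = detSum {w ∈ A | p w} + detSum {w ∈ A | ¬ p w} := by
  refine detSum_add_of_disjoint hA ?_ ?_
  · rw [Set.disjoint_left]; rintro w ⟨_, h1⟩ ⟨_, h2⟩; exact h2 h1
  · ext w
    simp only [Set.mem_union, Set.mem_ofPred_eq]
    tauto

/-- The set `A` is partitioned by the value of `ρ`, and each part is counted at its own place. The
continuation of one part is the loop over the remaining places. Only soundness is claimed, so
running out of fuel may answer `false`. -/
theorem counts_overBits (t n m : ℕ) (f : ℕ → Counter)
    {A : Set (RootLattice l ≃ₗ[ℤ] RootLattice l)} (hA : A.Finite)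
    (ρ : (RootLattice l ≃ₗ[ℤ] RootLattice l) → ℕ) (hρ : ∀ w ∈ A, m.testBit (ρ w) = true)
    (hf : ∀ r, m.testBit r = true → Counts (f r) {w ∈ A | ρ w = r}) :
    Counts (overBits t n m f) A := by
  induction n generalizing m A with
  | zero => intro κ p q h; simp [overBits] at h
  | succ n ih =>
    intro κ p q h
    simp only [overBits, force_eq, Bool.cond_eq_ite, Nat.beq_eq, digit_one_eq] at h
    split_ifs at h with h0 h1
    · refine ⟨p, q, h, ?_⟩
      have : A = ∅ := by
        rw [Set.eq_empty_iff_forall_notMem]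
        intro w hw
        have := hρ w hw
        simp [h0] at this
      rw [this, detSum_empty, add_zero]
    · set r := lookup t m
      obtain ⟨p', q', h2, h3⟩ := hf r h1 _ _ _ h
      have hA' : {w ∈ A | ¬ ρ w = r}.Finite := hA.subset fun w hw => hw.1
      have hb := testBit_xor_two_pow h1
      obtain ⟨p'', q'', h4, h5⟩ := ih (Nat.xor m (2 ^ r)) hA'
        (fun w hw => by rw [hb, hρ w hw.1]; simpa using hw.2)
        (fun s hs => by
          rw [hb] at hs
          simp only [Bool.and_eq_true, Bool.not_eq_true', decide_eq_false_iff_not] at hs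
          have : {w ∈ {w ∈ A | ¬ ρ w = r} | ρ w = s} = {w ∈ A | ρ w = s} := by
            ext w
            simp only [Set.mem_ofPred_eq, and_assoc]
            refine and_congr_right fun _ => ⟨fun h => h.2, fun h => ⟨?_, h⟩⟩
            rw [h]; exact hs.2
          rw [this]
          exact hf s hs.1) κ p' q' h2
      refine ⟨p'', q'', h4, ?_⟩
      rw [h5, h3, detSum_split hA fun w => ρ w = r]
      ring

theorem detSum_singleton (w : RootLattice l ≃ₗ[ℤ] RootLattice l) : detSum {w} = detZ w := by
  simp [detSum]

/-! ### Frames -/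

/-- The numbers `f 0, …, f (n - 1)`, packed in base `2 ^ 40`. -/
def packFn (f : ℕ → ℕ) : ℕ → ℕ
  | 0 => 0
  | Nat.succ n => Nat.add (packFn f n) (Nat.shiftLeft (f n) (Nat.mul 40 n))

theorem packFn_eq (f : ℕ → ℕ) (n : ℕ) :
    packFn f n = ∑ i ∈ Finset.range n, f i * 2 ^ (40 * i) := by
  induction n with
  | zero => rfl
  | succ n ih =>
    rw [Finset.sum_range_succ, ← ih]
    change packFn f n + f n <<< (40 * n) = _
    rw [Nat.shiftLeft_eq]

/-- The codes of the images of the simple roots, shifted by `2 ^ 36` and packed in base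
`2 ^ 40`. -/
def frame (w : RootLattice l ≃ₗ[ℤ] RootLattice l) : ℤ :=
  ∑ j : Fin l, (2 ^ 36 + codeZ (w (simpleRoot j))) * 2 ^ (40 * (j : ℕ))

theorem simpleReflection_inv_apply_simpleRoot (X : CartanDatum l)
    (w : RootLattice l ≃ₗ[ℤ] RootLattice l) (i j : Fin l) :
    (w * simpleReflection X j) (simpleRoot i) =
      w (simpleRoot i) - X.mat i j • w (simpleRoot j) := by
  rw [LinearEquiv.mul_apply, simpleReflection_simpleRoot, map_sub, map_smul]

namespace SearchData

variable (D : SearchData)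

/-- The frame of `w s_j` from the frame `v` of `w`, where `x` is minus the code of `w α_j`. -/
def step (v j x : ℕ) : ℕ :=
  Nat.sub (Nat.add v (Nat.shiftLeft (Nat.mul 2 x) (Nat.mul 40 j)))
    (Nat.mul x (digit 320 D.change j))

/-- Counts the elements of the Weyl group with the frame `v`, by reduction to the identity. -/
def countFrame (l t target signs : ℕ) : ℕ → Bool → ℕ → Counter
  | 0, _, _ => fun _ _ _ => false
  | Nat.succ n, e, v => fun κ p q =>
    -- A digit is `2 ^ 36` plus a code of absolute value below `2 ^ 32`, so its bit 36 is clear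
    -- exactly when the code is negative. Thus `m` marks the simple roots with negative images.
    force (Nat.sub signs (Nat.land v signs)) fun m => bif Nat.beq m 0 then
      bif Nat.beq v target then bif e then κ (Nat.succ p) q else κ p (Nat.succ q)
      -- The inner products cannot exclude an isometry outside the Weyl group. Such a frame may
      -- reduce to a diagram automorphism and then contributes nothing.
      else bif Nat.beq v D.auto then κ p q else false
    else force (lookup t m) fun j => bif Nat.ble l j then false else
      force (Nat.sub (Nat.pow 2 36) (digit 40 v j)) fun x => force (D.step v j x) fun v =>
        -- Confirms that the step turned the code `-x` at `j` into `x`. With this the step is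
        -- invertible even when `v` is not known to be a frame.
        bif Nat.beq (digit 40 v j) (Nat.add (Nat.pow 2 36) x) then
          countFrame l t target signs n (!e) v κ p q
        else false

/-- The frame of the identity. -/
def identityFrame (l : ℕ) : ℕ := packFn (fun j => Nat.add (Nat.pow 2 36) (Nat.pow 16 j)) l

variable {D} {X : CartanDatum l}

namespace IsRootTable

variable (hD : D.IsRootTable X)
include hD

/-- An element is determined by the images of the simple roots, which lie in the finite set of
roots. -/
theorem finite_weylGroup : {w | w ∈ weylGroup X}.Finite := by
  have hfin : (D.posRoots l).Finite := by
    have : D.posRoots l = rootVec l '' {c | c ∈ D.codes} := rfl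
    rw [this]
    exact (List.finite_toSet D.codes).image _
  have hfin' : {v : RootLattice l | v ∈ D.posRoots l ∨ -v ∈ D.posRoots l}.Finite :=
    hfin.union (Set.Finite.preimage (s := D.posRoots l) neg_injective.injOn hfin)
  have hP := hD.isPositiveSystem
  refine ((Set.Finite.pi' fun _ : Fin l => hfin').preimage
    (f := fun w : RootLattice l ≃ₗ[ℤ] RootLattice l => fun j => w (simpleRoot j)) ?_).subset ?_
  · exact fun u _ w _ h => equiv_ext_simpleRoot fun j => congrFun h j
  · exact fun w hw j => hP.mem_or_neg_mem hw (hP.simple_mem j)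

/-- The shift `2 ^ 36` exceeds every absolute value of a code, and the sums stay below `2 ^ 40`. So
the frame is a natural number whose digits are the shifted codes. -/
theorem exists_frame_eq {w : RootLattice l ≃ₗ[ℤ] RootLattice l} (hw : w ∈ weylGroup X) :
    ∃ v : ℕ, (v : ℤ) = frame w ∧
      ∀ j : Fin l, (digit 40 v j : ℤ) = 2 ^ 36 + codeZ (w (simpleRoot j)) := by
  set f : ℕ → ℕ := fun i =>
    if h : i < l then (2 ^ 36 + codeZ (w (simpleRoot ⟨i, h⟩))).toNat else 0 with hf
  have hb := fun j => abs_lt.mp (hD.abs_codeZ_lt hw j)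
  have hfv : ∀ j : Fin l, (f j : ℤ) = 2 ^ 36 + codeZ (w (simpleRoot j)) := fun j => by
    simp only [hf, j.isLt, dif_pos, Fin.eta]
    refine Int.toNat_of_nonneg ?_
    have := (hb j).1
    norm_num at this ⊢
    linarith
  refine ⟨∑ i ∈ Finset.range l, f i * 2 ^ (40 * i), ?_, fun j => ?_⟩
  · push_cast
    rw [frame, Finset.sum_range]
    exact Finset.sum_congr rfl fun i _ => by rw [hfv]
  · rw [digit_sum 40 l f ?_ j.isLt, hfv]
    intro i hi
    have h1 := hfv ⟨i, hi⟩
    have h2 := (hb ⟨i, hi⟩).2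
    zify
    rw [show ((f i : ℕ) : ℤ) = _ from h1]
    norm_num at h2 ⊢
    linarith

theorem digit_of_eq_frame {w : RootLattice l ≃ₗ[ℤ] RootLattice l} (hw : w ∈ weylGroup X)
    {v : ℕ} (hv : (v : ℤ) = frame w) (j : Fin l) :
    (digit 40 v j : ℤ) = 2 ^ 36 + codeZ (w (simpleRoot j)) := by
  obtain ⟨v', h1, h2⟩ := hD.exists_frame_eq hw
  rw [← hv] at h1
  rw [← h2, Nat.cast_injective h1]

theorem frame_injOn {u w : RootLattice l ≃ₗ[ℤ] RootLattice l} (hu : u ∈ weylGroup X)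
    (hw : w ∈ weylGroup X) (h : frame u = frame w) : u = w := by
  obtain ⟨v, h1, h2⟩ := hD.exists_frame_eq hu
  refine equiv_ext_simpleRoot fun j => ?_
  have h3 := hD.digit_of_eq_frame hw (h1.trans h) j
  rw [h2] at h3
  have hP := hD.isPositiveSystem
  exact hD.codeZ_injOn (hP.mem_or_neg_mem hu (hP.simple_mem j))
    (hP.mem_or_neg_mem hw (hP.simple_mem j)) (by linarith)

end IsRootTable

theorem identityFrame_eq : (identityFrame l : ℤ) =
    frame (1 : RootLattice l ≃ₗ[ℤ] RootLattice l) := by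
  rw [identityFrame, packFn_eq, frame, Finset.sum_range]
  push_cast
  refine Finset.sum_congr rfl fun j _ => ?_
  rw [show (1 : RootLattice l ≃ₗ[ℤ] RootLattice l) (simpleRoot j) = simpleRoot j from rfl,
    codeZ_simpleRoot, Nat.add_eq, Nat.pow_eq, Nat.pow_eq]
  push_cast
  rfl

/-- The table of changes of frames belongs to the Cartan matrix, and no element of the Weyl group
has the frame `D.auto`. -/
structure HasChange (D : SearchData) (X : CartanDatum l) : Prop where
  change : ∀ j : Fin l, (digit 320 D.change j : ℤ) =
    2 * 2 ^ (40 * (j : ℕ)) - ∑ i : Fin l, X.mat i j * 2 ^ (40 * (i : ℕ))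
  auto : ∀ w ∈ weylGroup X, frame w ≠ D.auto

theorem frame_mul_simpleReflection (hX : D.HasChange X)
    (w : RootLattice l ≃ₗ[ℤ] RootLattice l) (j : Fin l) :
    frame (w * simpleReflection X j) = frame w - codeZ (w (simpleRoot j)) *
      (2 * 2 ^ (40 * (j : ℕ)) - digit 320 D.change j) := by
  rw [hX.change, sub_sub_cancel, Finset.mul_sum, frame, frame, ← Finset.sum_sub_distrib]
  refine Finset.sum_congr rfl fun i _ => ?_
  rw [simpleReflection_inv_apply_simpleRoot, codeZ_sub, codeZ_smul]
  ring

theorem detZ_mul_simpleReflection (X : CartanDatum l)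
    (w : RootLattice l ≃ₗ[ℤ] RootLattice l) (j : Fin l) :
    detZ (w * simpleReflection X j) = -detZ w := by
  rw [detZ_mul, detZ_simpleReflection]; ring

theorem step_eq (v j x : ℕ) :
    D.step v j x = v + 2 * x * 2 ^ (40 * j) - x * digit 320 D.change j := by
  change v + (2 * x) <<< (40 * j) - x * _ = _
  rw [Nat.shiftLeft_eq]

/-- Right multiplication by `s_j` matches the elements having the two frames and reverses
determinants. Both sets may be empty: `v` is an arbitrary number, and the digit test `hd` replaces
any assumption on it. -/
theorem IsRootTable.detSum_step (hD : D.IsRootTable X) (hX : D.HasChange X) {v x : ℕ}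
    (j : Fin l) (hx : x = 2 ^ 36 - digit 40 v j)
    (hd : digit 40 (D.step v j x) j = 2 ^ 36 + x) :
    detSum {w | w ∈ weylGroup X ∧ frame w = D.step v j x} =
      -detSum {w | w ∈ weylGroup X ∧ frame w = v} := by
  set s := simpleReflection X j
  have hs : s ∈ weylGroup X := simpleReflection_mem_weylGroup X j
  have hss : s * s = 1 := simpleReflection_mul_self X j
  have hneg : ∀ w : RootLattice l ≃ₗ[ℤ] RootLattice l,
      (w * s) (simpleRoot j) = -w (simpleRoot j) := fun w => by
    rw [LinearEquiv.mul_apply, simpleReflection_self, map_neg]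
  have key : ∀ w, w ∈ weylGroup X → frame w = D.step v j x → frame (w * s) = v := by
    intro w hw h
    have h1 := hD.digit_of_eq_frame hw h.symm j
    rw [hd] at h1
    push_cast at h1
    have h2 : codeZ (w (simpleRoot j)) = x := by linarith
    obtain ⟨v', h3, -⟩ := hD.exists_frame_eq (mul_mem hw hs)
    rw [frame_mul_simpleReflection hX, h2, h]
    -- A truncated subtraction would give zero and contradict `hd`, so the subtraction in the step
    -- is exact.
    have h5 : D.step v j x ≠ 0 := by
      intro h0
      rw [h0, digit_eq, Nat.zero_div, Nat.zero_mod] at hd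
      omega
    rw [step_eq] at h5 ⊢
    rw [Nat.cast_sub (by omega)]
    push_cast
    ring
  have key' : ∀ w, w ∈ weylGroup X → frame w = v → frame (w * s) = D.step v j x := by
    intro w hw h
    have h1 := hD.digit_of_eq_frame hw h.symm j
    have hb := abs_lt.mp (hD.abs_codeZ_lt hw j)
    -- Otherwise truncation makes `x = 0`, the step changes nothing, and `hd` would force the digit
    -- to be exactly `2 ^ 36`.
    have h6 : digit 40 v j ≤ 2 ^ 36 := by
      by_contra h7
      have : x = 0 := by omega
      have h8 : D.step v j x = v := by rw [step_eq, this]; simp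
      rw [h8, this] at hd
      omega
    have h2 : codeZ (w (simpleRoot j)) = -x := by
      rw [hx, Nat.cast_sub h6, h1]; push_cast; ring
    obtain ⟨v', h3, -⟩ := hD.exists_frame_eq (mul_mem hw hs)
    have h4 := frame_mul_simpleReflection hX w j
    rw [h2, h] at h4
    have h5 : x * digit 320 D.change j ≤ v + 2 * x * 2 ^ (40 * (j : ℕ)) := by
      zify
      have : (0 : ℤ) ≤ frame (w * s) := h3 ▸ Int.natCast_nonneg _
      rw [h4] at this
      linarith
    rw [h4, step_eq, Nat.cast_sub h5]
    push_cast
    ring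
  rw [detSum, detSum, ← finsum_mem_neg_distrib _ (hD.finite_weylGroup.subset fun w hw => hw.1)]
  refine finsum_mem_eq_of_bijOn (fun w => w * s) ⟨?_, ?_, ?_⟩ ?_
  · exact fun w hw => ⟨mul_mem hw.1 hs, key w hw.1 hw.2⟩
  · exact fun w _ w' _ h => mul_right_cancel h
  · intro w hw
    exact ⟨w * s, ⟨mul_mem hw.1 hs, key' w hw.1 hw.2⟩, by simp [mul_assoc, hss]⟩
  · intro w _
    rw [detZ_mul_simpleReflection]; ring

/-- Each step multiplies by one simple reflection, and `e` records whether the number of steps so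
far is even. At the identity it therefore tells the determinant of the element at the start. -/
theorem IsRootTable.countFrame_spec (hD : D.IsRootTable X) (hX : D.HasChange X)
    (t signs n : ℕ) (e : Bool) (v : ℕ) (κ : ℕ → ℕ → Bool) (p q : ℕ)
    (h : D.countFrame l t (identityFrame l) signs n e v κ p q = true) :
    ∃ p' q' : ℕ, κ p' q' = true ∧ (p' : ℤ) - q' =
      p - q + (bif e then 1 else -1) * detSum {w | w ∈ weylGroup X ∧ frame w = v} := by
  induction n generalizing e v with
  | zero => simp [countFrame] at h
  | succ n ih =>
    simp only [countFrame, force_eq, Bool.cond_eq_ite, Nat.beq_eq, Nat.ble_eq] at h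
    split_ifs at h with h0 h1 he h2 h3 h4
    · refine ⟨p + 1, q, h, ?_⟩
      have : {w | w ∈ weylGroup X ∧ frame w = v} = {1} := by
        ext w
        simp only [Set.mem_ofPred_eq, Set.mem_singleton_iff]
        rw [h1, identityFrame_eq]
        exact ⟨fun hw => hD.frame_injOn hw.1 (one_mem _) hw.2,
          fun hw => by rw [hw]; exact ⟨one_mem _, rfl⟩⟩
      rw [this, detSum_singleton, detZ_one, he]
      push_cast; simp; ring
    · refine ⟨p, q + 1, h, ?_⟩
      have : {w | w ∈ weylGroup X ∧ frame w = v} = {1} := by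
        ext w
        simp only [Set.mem_ofPred_eq, Set.mem_singleton_iff]
        rw [h1, identityFrame_eq]
        exact ⟨fun hw => hD.frame_injOn hw.1 (one_mem _) hw.2,
          fun hw => by rw [hw]; exact ⟨one_mem _, rfl⟩⟩
      rw [this, detSum_singleton, detZ_one, Bool.not_eq_true _ |>.mp he]
      push_cast; simp; ring
    · refine ⟨p, q, h, ?_⟩
      have : {w | w ∈ weylGroup X ∧ frame w = v} = ∅ := by
        rw [Set.eq_empty_iff_forall_notMem]
        rintro w ⟨hw, hw'⟩
        exact hX.auto w hw (by rw [hw', h2])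
      rw [this, detSum_empty]; ring
    · set j := lookup t (signs.sub (v.land signs))
      obtain ⟨p', q', h5, h6⟩ := ih _ _ h
      refine ⟨p', q', h5, ?_⟩
      have h7 : detSum {w | w ∈ weylGroup X ∧
          frame w = D.step v j ((Nat.pow 2 36).sub (digit 40 v j))} = _ :=
        hD.detSum_step hX (v := v) ⟨j, by omega⟩ rfl h4
      rw [h6, h7]
      cases e <;> simp

end SearchData

end NilpotentToda

namespace NilpotentToda

variable {l : ℕ}

/-! ### The invariant form -/

/-- The bilinear form with the Gram matrix `C i j * d j` on the simple roots. -/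
def bilin (X : CartanDatum l) (d : Fin l → ℤ) (u v : RootLattice l) : ℤ :=
  ∑ j, coroot X j u * (d j * v j)

section bilin

variable (X : CartanDatum l) (d : Fin l → ℤ)

theorem bilin_sub_smul_right (u v v' : RootLattice l) (a : ℤ) :
    bilin X d u (v - a • v') = bilin X d u v - a * bilin X d u v' := by
  simp only [bilin, Finset.mul_sum, ← Finset.sum_sub_distrib, Pi.sub_apply, Pi.smul_apply,
    smul_eq_mul]
  exact Finset.sum_congr rfl fun _ _ => by ring

theorem bilin_sub_smul_left (u u' v : RootLattice l) (a : ℤ) :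
    bilin X d (u - a • u') v = bilin X d u v - a * bilin X d u' v := by
  simp only [bilin, Finset.mul_sum, ← Finset.sum_sub_distrib, map_sub, map_smul, smul_eq_mul]
  exact Finset.sum_congr rfl fun _ _ => by ring

theorem bilin_neg_left (u v : RootLattice l) : bilin X d (-u) v = -bilin X d u v := by
  simp [bilin]

theorem bilin_simpleRoot_right (u : RootLattice l) (j : Fin l) :
    bilin X d u (simpleRoot j) = coroot X j u * d j := by
  simp [bilin, simpleRoot_apply]

theorem bilin_eq_sum (u v : RootLattice l) :
    bilin X d u v = ∑ i, u i * ∑ j, X.mat i j * d j * v j := by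
  simp only [bilin, coroot_apply, Finset.sum_mul, Finset.mul_sum]
  rw [Finset.sum_comm]
  exact Finset.sum_congr rfl fun i _ => Finset.sum_congr rfl fun j _ => by ring

variable {X d}

theorem bilin_comm (hd : ∀ i j, X.mat i j * d j = X.mat j i * d i) (u v : RootLattice l) :
    bilin X d u v = bilin X d v u := by
  simp only [bilin_eq_sum, Finset.mul_sum]
  rw [Finset.sum_comm]
  exact Finset.sum_congr rfl fun i _ => Finset.sum_congr rfl fun j _ => by rw [hd]; ring

theorem bilin_apply_weylGroup (hd : ∀ i j, X.mat i j * d j = X.mat j i * d i)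
    {w : RootLattice l ≃ₗ[ℤ] RootLattice l} (hw : w ∈ weylGroup X) (u v : RootLattice l) :
    bilin X d (w u) (w v) = bilin X d u v := by
  obtain ⟨L, rfl⟩ := (mem_weylGroup_iff X w).mp hw
  induction L with
  | nil => simp
  | cons i L ih =>
    rw [wordProd_cons, LinearEquiv.mul_apply, LinearEquiv.mul_apply]
    rw [← ih (wordProd_mem_weylGroup X L)]
    generalize wordProd X L u = u
    generalize wordProd X L v = v
    have h1 : bilin X d (simpleRoot i) v = coroot X i v * d i := by
      rw [bilin_comm hd, bilin_simpleRoot_right]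
    rw [simpleReflection_apply, simpleReflection_apply, bilin_sub_smul_right,
      bilin_sub_smul_left, bilin_sub_smul_left, bilin_simpleRoot_right, bilin_simpleRoot_right, h1,
      coroot_simpleRoot, X.diag]
    ring

end bilin

/-! ### The search -/

/-- The inner products of the roots with the codes `c` and `c'`, shifted. -/
def formSum (l m c : ℕ) : ℕ → ℕ → ℕ
  | 0, _ => 0
  | Nat.succ n, c' =>
    Nat.add (formSum l m c n c') (Nat.mul (digitDot l (digit 32 m n) c) (digit 4 c' n))

theorem formSum_eq (l m c n c' : ℕ) : formSum l m c n c' =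
    ∑ i ∈ Finset.range n, digitDot l (digit 32 m i) c * digit 4 c' i := by
  induction n with
  | zero => rfl
  | succ n ih => rw [Finset.sum_range_succ, ← ih]; rfl

/-- The inner product of the roots with the codes `c` and `c'`, plus `4`. -/
def formIndex (l m c c' : ℕ) : ℕ :=
  -- Each entry of the packed form is shifted by 4, which adds four times the product of the two
  -- heights; this excess is removed.
  Nat.sub (Nat.add 4 (formSum l m c l c')) (Nat.mul 4 (Nat.mul (digitSum l c) (digitSum l c')))

/-- The bits `s + 128 * e` for which the inner product of the root with the code `c` and the
root with the number `s` is `e - 4`. -/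
def formRow (l m c : ℕ) : List ℕ → ℕ → ℕ → ℕ
  | [], _, R => R
  | c' :: L, s, R =>
    force (Nat.lor R (Nat.shiftLeft 1 (Nat.add s (Nat.mul 128 (formIndex l m c c'))))) fun R =>
      formRow l m c L (Nat.succ s) R

/-- The packed table of inner products. -/
def formTable (l m : ℕ) (codes : List ℕ) : List ℕ → ℕ → ℕ → ℕ
  | [], _, T => T
  | c :: L, r, T =>
    force (Nat.lor T (Nat.shiftLeft (formRow l m c codes 0 0) (Nat.mul 2048 r))) fun T =>
      formTable l m codes L (Nat.succ r) T

theorem testBit_lor_left {a b i : ℕ} (h : a.testBit i = true) :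
    (Nat.lor a b).testBit i = true := by
  change (a ||| b).testBit i = true
  simp [h]

theorem testBit_lor_right {a b i : ℕ} (h : b.testBit i = true) :
    (Nat.lor a b).testBit i = true := by
  change (a ||| b).testBit i = true
  simp [h]

theorem testBit_formRow (l m c : ℕ) (L : List ℕ) (s R : ℕ) :
    (∀ b, R.testBit b = true → (formRow l m c L s R).testBit b = true) ∧
    ∀ i < L.length, (formRow l m c L s R).testBit
      (s + i + 128 * formIndex l m c (L.getD i 0)) = true := by
  induction L generalizing s R with
  | nil => simp [formRow]
  | cons c' L ih =>
    rw [formRow, force_eq]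
    obtain ⟨h1, h2⟩ := ih (Nat.succ s)
      (Nat.lor R (Nat.shiftLeft 1 (Nat.add s (Nat.mul 128 (formIndex l m c c')))))
    refine ⟨fun b hb => h1 b (testBit_lor_left hb), ?_⟩
    rintro (_ | i) hi
    · refine h1 _ (testBit_lor_right ?_)
      change (1 <<< (s + 128 * formIndex l m c c')).testBit _ = true
      simp
    · have := h2 i (by simpa using hi)
      rw [List.getD_cons_succ, show s + (i + 1) = s.succ + i by omega]
      exact this

theorem testBit_formTable (l m : ℕ) (codes L : List ℕ) (r T : ℕ) :
    (∀ b, T.testBit b = true → (formTable l m codes L r T).testBit b = true) ∧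
    ∀ i < L.length, ∀ b, (formRow l m (L.getD i 0) codes 0 0).testBit b = true →
      (formTable l m codes L r T).testBit (2048 * (r + i) + b) = true := by
  induction L generalizing r T with
  | nil => simp [formTable]
  | cons c L ih =>
    rw [formTable, force_eq]
    obtain ⟨h1, h2⟩ := ih (Nat.succ r)
      (Nat.lor T (Nat.shiftLeft (formRow l m c codes 0 0) (Nat.mul 2048 r)))
    refine ⟨fun b hb => h1 b (testBit_lor_left hb), ?_⟩
    rintro (_ | i) hi b hb
    · refine h1 _ (testBit_lor_right ?_)
      change (formRow l m c codes 0 0 <<< (2048 * r)).testBit _ = true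
      rw [Nat.testBit_shiftLeft]
      simpa using hb
    · have := h2 i (by simpa using hi) b (by simpa using hb)
      rw [show r + (i + 1) = r.succ + i by omega]
      exact this

/-- Whether `m` has a common binary place with each element of a list. -/
def meetsAll (m : ℕ) : List ℕ → Bool
  | [] => true
  | x :: L => bif Nat.beq (Nat.land m x) 0 then false else meetsAll m L

/-- The union of the sets of binary places in a list of candidates. -/
def unionMask : List (ℕ × ℕ) → ℕ → ℕ
  | [], m => m
  | (_, m') :: L, m => unionMask L (Nat.lor m m')

theorem testBit_unionMask (L : List (ℕ × ℕ)) (m b : ℕ) :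
    (unionMask L m).testBit b = true ↔
      m.testBit b = true ∨ ∃ x ∈ L, x.2.testBit b = true := by
  induction L generalizing m with
  | nil => simp [unionMask]
  | cons x L ih =>
    obtain ⟨i, m'⟩ := x
    rw [unionMask, ih]
    change (m ||| m').testBit b = true ∨ _ ↔ _
    simp only [Nat.testBit_or, Bool.or_eq_true, List.exists_mem_cons_iff]
    tauto

theorem meetsAll_iff (m : ℕ) (L : List ℕ) :
    meetsAll m L = true ↔ ∀ x ∈ L, ∃ b, m.testBit b = true ∧ x.testBit b = true := by
  induction L with
  | nil => simp [meetsAll]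
  | cons x L ih =>
    rw [meetsAll, Bool.cond_eq_ite, List.forall_mem_cons, ← ih]
    simp only [Nat.beq_eq]
    have : Nat.land m x = 0 ↔ ¬ ∃ b, m.testBit b = true ∧ x.testBit b = true := by
      change m &&& x = 0 ↔ _
      rw [← not_iff_not, not_not]
      constructor
      · intro h
        obtain ⟨b, hb⟩ := Nat.exists_testBit_of_ne_zero h
        rw [Nat.testBit_and, Bool.and_eq_true] at hb
        exact ⟨b, hb⟩
      · rintro ⟨b, hb⟩ h
        have := congrArg (fun n => n.testBit b) h
        simp [hb.1, hb.2] at this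
    split_ifs with h
    · simp only [false_iff]
      exact fun h' => this.mp h h'.1
    · exact ⟨fun h' => ⟨by_contra fun h'' => h (this.mpr h''), h'⟩, fun h' => h'.2⟩

namespace SearchData

variable (D : SearchData)

/-- The candidates that have the right inner products with a root with the row `R` of inner
products, if this root is the image of the simple root `α_j`. -/
def restrict (R j : ℕ) : List (ℕ × ℕ) → List (ℕ × ℕ)
  | [] => []
  | (i, m) :: L => force (Nat.land m (Nat.shiftRight R (Nat.mul 128 (entry D.form i j)))) fun m =>
      (i, m) :: restrict R j L

/-- Hands the result of `restrict` and the union of its sets and `u` to `κ`, unless there is a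
simple root without candidates. -/
def restrictThen (R j : ℕ) : List (ℕ × ℕ) → ℕ → Bool → (List (ℕ × ℕ) → ℕ → Bool) → Bool
  | [], u, _, κ => κ [] u
  | (i, m) :: L, u, b, κ =>
    force (Nat.land m (Nat.shiftRight R (Nat.mul 128 (entry D.form i j)))) fun m =>
      bif Nat.beq m 0 then b else force (Nat.lor u m) fun u =>
        restrictThen R j L u b fun L u => κ ((i, m) :: L) u

/-- Counts the elements of the Weyl group, except for the identity, that map the simple roots,
except for `α_k`, to positive roots of odd height, and that meet all sets in `needs`.  The list
`cands` holds the simple roots whose image is still open, with the possible images, `neg` holds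
the possible values of minus the image of `α_k`, `am` holds the images found, `acc` is their
frame, and `u` is the union of `am` and all possible images. -/
def search (l t t' T C target signs : ℕ) (needs : List ℕ) (k : ℕ) :
    ℕ → List (ℕ × ℕ) → ℕ → ℕ → ℕ → ℕ → Counter
  | 0, _, _, _, _, _ => fun _ _ _ => false
  | Nat.succ n, cands, u, neg, am, acc => fun κ p q =>
    -- If a required set misses both the images found and all images still possible, the branch is
    -- empty and the count passes through unchanged.
    bif meetsAll u needs then
      match cands with
      -- Only the image of `α_k` is open. Each surviving candidate completes a frame, which
      -- `countFrame` accepts or rejects.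
      | [] => overBits t 128 neg (fun r =>
          force (Nat.add acc (Nat.shiftLeft (Nat.sub (Nat.pow 2 36) (digit 32 C r))
            (Nat.mul 40 k))) fun v => D.countFrame l t' target signs 256 true v) κ p q
      | (j, m) :: rest => overBits t 128 m (fun r κ p q =>
          force (digit 2048 T r) fun R =>
          -- The set `neg` holds minus the image of `α_k`, so its inner products are negated, and
          -- under the shift by 4 an index `e` becomes `8 - e`.
          force (Nat.land neg (Nat.shiftRight R
            (Nat.mul 128 (Nat.sub 8 (entry D.form k j))))) fun neg =>
          force (Nat.lor am (Nat.pow 2 r)) fun am =>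
          D.restrictThen R j rest am (κ p q) fun rest u =>
          force (Nat.add acc (Nat.shiftLeft (Nat.add (Nat.pow 2 36) (digit 32 C r))
            (Nat.mul 40 j))) fun acc =>
          search l t t' T C target signs needs k n rest u neg am acc κ p q) κ p q
    else κ p q

variable {D}

theorem mem_restrict {R j : ℕ} {L : List (ℕ × ℕ)} {y : ℕ × ℕ} (hy : y ∈ D.restrict R j L) :
    ∃ x ∈ L, y.1 = x.1 ∧ ∀ b, y.2.testBit b =
      (x.2.testBit b && R.testBit (128 * entry D.form x.1 j + b)) := by
  induction L with
  | nil => simp [restrict] at hy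
  | cons x L ih =>
    obtain ⟨i, m⟩ := x
    rw [restrict, force_eq, List.mem_cons] at hy
    rcases hy with rfl | hy
    · refine ⟨(i, m), by simp, rfl, fun b => ?_⟩
      change (m &&& (R >>> (128 * entry D.form i j))).testBit b = _
      rw [Nat.testBit_and, Nat.testBit_shiftRight]
    · obtain ⟨x', h1, h2⟩ := ih hy
      exact ⟨x', by simp [h1], h2⟩

theorem map_fst_restrict (R j : ℕ) (L : List (ℕ × ℕ)) :
    (D.restrict R j L).map Prod.fst = L.map Prod.fst := by
  induction L with
  | nil => rfl
  | cons x L ih =>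
    obtain ⟨i, m⟩ := x
    rw [restrict, force_eq, List.map_cons, List.map_cons, ih]

theorem restrictThen_eq_true {R j : ℕ} {L : List (ℕ × ℕ)} {u : ℕ} {b : Bool}
    {κ : List (ℕ × ℕ) → ℕ → Bool} (h : D.restrictThen R j L u b κ = true) :
    (b = true ∧ ∃ x ∈ D.restrict R j L, x.2 = 0) ∨
      κ (D.restrict R j L) (unionMask (D.restrict R j L) u) = true := by
  induction L generalizing u κ with
  | nil => exact Or.inr h
  | cons x L ih =>
    obtain ⟨i, m⟩ := x
    simp only [restrictThen, force_eq, Bool.cond_eq_ite, Nat.beq_eq] at h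
    simp only [restrict, force_eq]
    split_ifs at h with h0
    · exact Or.inl ⟨h, _, List.mem_cons_self, h0⟩
    · rcases ih h with ⟨hb, x, hx, hx0⟩ | h1
      · exact Or.inl ⟨hb, x, List.mem_cons_of_mem _ hx, hx0⟩
      · exact Or.inr h1

/-- The packed matrix `D.form` belongs to the invariant form. -/
structure HasForm (D : SearchData) (X : CartanDatum l) (d : Fin l → ℤ) : Prop where
  symm : ∀ i j, X.mat i j * d j = X.mat j i * d i
  form : ∀ i j : Fin l, (entry D.form i j : ℤ) = X.mat i j * d j + 4
  le : ∀ i j : Fin l, entry D.form i j ≤ 8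

theorem HasForm.formIndex_eq {X : CartanDatum l} {d : Fin l → ℤ} (hF : D.HasForm X d)
    {c c' e : ℕ} (h : bilin X d (rootVec l c') (rootVec l c) + 4 = e) :
    formIndex l D.form c c' = e := by
  have h1 : (formSum l D.form c l c' : ℤ) =
      bilin X d (rootVec l c') (rootVec l c) + 4 * (digitSum l c * digitSum l c') := by
    rw [formSum_eq, bilin_eq_sum, digitSum_eq l c', Finset.sum_range, Finset.sum_range]
    push_cast
    rw [Finset.mul_sum, Finset.mul_sum, ← Finset.sum_add_distrib]
    refine Finset.sum_congr rfl fun i _ => ?_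
    rw [digitDot_eq, digitSum_eq, Finset.sum_range, Finset.sum_range]
    push_cast
    rw [Finset.sum_mul, Finset.sum_mul, Finset.mul_sum, Finset.mul_sum, ← Finset.sum_add_distrib]
    refine Finset.sum_congr rfl fun j _ => ?_
    have := hF.form i j
    rw [entry] at this
    rw [this, rootVec, rootVec]
    ring
  change 4 + formSum l D.form c l c' - 4 * (digitSum l c * digitSum l c') = e
  zify at *
  omega

end SearchData

end NilpotentToda

/-! ### Correctness of the search -/

namespace NilpotentToda

variable {l : ℕ}

namespace SearchData

variable {D : SearchData} {X : CartanDatum l} {d : Fin l → ℤ}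

/-- The elements of `oddReps`, except for the identity, for which the images of the simple roots
except for `α_k` meet all sets in `needs`. -/
def reducedReps (D : SearchData) (X : CartanDatum l) (k : Fin l) (needs : List ℕ) :
    Set (RootLattice l ≃ₗ[ℤ] RootLattice l) :=
  {w | (w ∈ oddReps X (D.posRoots l) k ∧ w ≠ 1) ∧
    ∀ m ∈ needs, ∃ j, j ≠ k ∧ m.testBit (D.index (w (simpleRoot j))) = true}

theorem IsRootTable.testBit_formTable (hD : D.IsRootTable X) (hF : D.HasForm X d) {r s e : ℕ}
    (hr : r < D.odd.length) (hs : s < D.codes.length) (he : e < 16)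
    (h : bilin X d (D.root l s) (D.root l r) + 4 = e) :
    (digit 2048 (formTable l D.form D.codes D.odd 0 0) r).testBit (128 * e + s) = true := by
  rw [digit_eq, Nat.testBit_mod_two_pow, Nat.testBit_div_two_pow]
  have hs' := hs.trans_le hD.length_le
  have h1 := (NilpotentToda.testBit_formTable l D.form D.codes D.odd 0 0).2 r hr (s + 128 * e) ?_
  · rw [zero_add] at h1
    rw [show 128 * e + s + 2048 * r = 2048 * r + (s + 128 * e) by ring, h1]
    simp only [Bool.and_true, decide_eq_true_eq]
    omega
  · have h2 := (testBit_formRow l D.form (D.odd.getD r 0) D.codes 0 0).2 s hs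
    rw [hF.formIndex_eq (e := e), zero_add] at h2
    · exact h2
    · rw [← h, root, root, codes, List.getD_append _ _ _ _ hr]

variable (t t' signs : ℕ) (needs : List ℕ)

/-- Invariant of the search: `A` consists of the elements with the prescribed images `a j` of the
simple roots already treated. The candidate sets only need to contain all true images, since
invariance of the form makes the restrictions necessary; that a complete frame belongs to an element
of `A` is decided at the leaves. -/
theorem IsRootTable.counts_search (hD : D.IsRootTable X) (hX : D.HasChange X)
    (hF : D.HasForm X d) (k : Fin l) (n : ℕ) (cands : List (ℕ × ℕ)) (neg am acc : ℕ)
    (a : Fin l → RootLattice l) (A : Set (RootLattice l ≃ₗ[ℤ] RootLattice l))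
    (hA : A = {w | w ∈ D.reducedReps X k needs ∧
      ∀ j, j ≠ k ∧ (j : ℕ) ∉ cands.map Prod.fst → w (simpleRoot j) = a j})
    (hnodup : (cands.map Prod.fst).Nodup)
    (hcands : ∀ x ∈ cands, ∃ i : Fin l, (i : ℕ) = x.1 ∧ i ≠ k ∧
      (∀ r, x.2.testBit r = true → r < D.odd.length) ∧
      ∀ w ∈ A, x.2.testBit (D.index (w (simpleRoot i))) = true)
    (hneg : ∀ r, neg.testBit r = true → r < D.codes.length)
    (hneg' : ∀ w ∈ A, neg.testBit (D.index (-w (simpleRoot k))) = true)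
    (ham : ∀ r, am.testBit r = true ↔
      ∃ j, (j ≠ k ∧ (j : ℕ) ∉ cands.map Prod.fst) ∧ D.index (a j) = r)
    (hacc : (acc : ℤ) = ∑ j : Fin l, if j ≠ k ∧ (j : ℕ) ∉ cands.map Prod.fst then
      (2 ^ 36 + codeZ (a j)) * 2 ^ (40 * (j : ℕ)) else 0)
    (ha : ∀ j, j ≠ k ∧ (j : ℕ) ∉ cands.map Prod.fst →
      a j ∈ D.posRoots l ∧ Odd (height (a j))) :
    Counts (D.search l t t' (formTable l D.form D.codes D.odd 0 0) (packList 32 D.codes)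
      (identityFrame l) signs needs k n cands (unionMask cands am) neg am acc) A := by
  have hP := hD.isPositiveSystem
  have hC : ∀ r, digit 32 (packList 32 D.codes) r = D.codes.getD r 0 := fun r =>
    digit_packList 32 D.codes (fun c hc => (hD.lt c hc).trans_le (by
      calc 16 ^ l ≤ 16 ^ 8 := Nat.pow_le_pow_right (by norm_num) hD.rank_le
        _ = 2 ^ 32 := by norm_num)) r
  have hcode : ∀ r, r < D.codes.length → (D.codes.getD r 0 : ℤ) = codeZ (D.root l r) :=
    fun r hr => by
      rw [root, List.getD_eq_getElem _ _ hr, hD.codeZ_of_mem (List.getElem_mem hr)]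
  have hodd : D.odd.length ≤ D.codes.length := by rw [codes, List.length_append]; omega
  induction n generalizing cands neg am acc a A with
  | zero => intro κ p q h; simp [search] at h
  | succ n ih =>
    have hAW : ∀ w ∈ A, w ∈ weylGroup X := fun w hw => by
      rw [hA] at hw; exact hw.1.1.1.1
    have hAP : ∀ w ∈ A, ∀ j ≠ k, w (simpleRoot j) ∈ D.posRoots l := fun w hw j hj => by
      rw [hA] at hw; exact (hw.1.1.1.2 j hj).1
    -- If `w α_k` were positive too, all simple roots would have positive images and `w` would be
    -- the identity, which is excluded.
    have hAneg : ∀ w ∈ A, -w (simpleRoot k) ∈ D.posRoots l := fun w hw => by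
      refine (hP.mem_or_neg_mem (hAW w hw) (hP.simple_mem k)).resolve_left fun h => ?_
      have hw' := hw
      rw [hA] at hw'
      refine hw'.1.1.2 (hP.eq_one_of_forall_pos (hAW w hw) fun j => ?_)
      by_cases hj : j = k
      · rw [hj]; exact h
      · exact hAP w hw j hj
    have hAfin : A.Finite := hD.finite_weylGroup.subset hAW
    intro κ p q h
    rw [search] at h
    beta_reduce at h
    rw [Bool.cond_eq_ite] at h
    split_ifs at h with hm
    swap
    · refine ⟨p, q, h, ?_⟩
      have : A = ∅ := by
        rw [Set.eq_empty_iff_forall_notMem]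
        intro w hw
        apply hm
        rw [meetsAll_iff]
        intro x hx
        have hw' := hw
        rw [hA] at hw'
        obtain ⟨j, hj, hb⟩ := hw'.1.2 x hx
        refine ⟨_, ?_, hb⟩
        rw [testBit_unionMask]
        by_cases hjc : (j : ℕ) ∈ cands.map Prod.fst
        · right
          obtain ⟨y, hy, hyj⟩ := List.mem_map.mp hjc
          obtain ⟨i, hi, -, -, h4⟩ := hcands y hy
          have : i = j := Fin.ext (hi.trans hyj)
          exact ⟨y, hy, this ▸ h4 w hw⟩
        · left
          rw [ham]
          exact ⟨j, ⟨hj, hjc⟩, by rw [hw'.2 j ⟨hj, hjc⟩]⟩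
      rw [this, detSum_empty, add_zero]
    · rw [meetsAll_iff] at hm
      cases cands with
      | nil =>
        refine counts_overBits t 128 neg _ hAfin (fun w => D.index (-w (simpleRoot k))) hneg' ?_
          κ p q h
        intro r hr κ p q h
        rw [force_eq] at h
        have hr' := hneg r hr
        set v := Nat.add acc (Nat.shiftLeft (Nat.sub (Nat.pow 2 36)
          (digit 32 (packList 32 D.codes) r)) (Nat.mul 40 k))
        have hv : (v : ℤ) = acc + (2 ^ 36 - codeZ (D.root l r)) * 2 ^ (40 * (k : ℕ)) := by
          have h1 : v = acc + (2 ^ 36 - D.codes.getD r 0) * 2 ^ (40 * (k : ℕ)) := by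
            rw [← hC, ← Nat.shiftLeft_eq]; rfl
          have h2 := hD.codeZ_lt (root_mem hr')
          rw [← hcode r hr'] at h2
          have h3 : D.codes.getD r 0 ≤ 2 ^ 36 := by
            zify; norm_num at h2 ⊢; linarith
          rw [h1, ← hcode r hr', Nat.cast_add, Nat.cast_mul, Nat.cast_sub h3]
          push_cast
          ring
        -- Elements of the Weyl group with the frame `v` automatically have all prescribed images,
        -- so the leaf counts exactly one fibre of `A`.
        have hset : {w ∈ A | D.index (-w (simpleRoot k)) = r} =
            {w | w ∈ weylGroup X ∧ frame w = v} := by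
          ext w
          simp only [Set.mem_ofPred_eq]
          constructor
          · rintro ⟨hw, hwr⟩
            refine ⟨hAW w hw, ?_⟩
            have hk : w (simpleRoot k) = -D.root l r := by
              rw [← hwr, hD.root_index (hAneg w hw), neg_neg]
            rw [hv, hacc, frame, ← Finset.add_sum_erase _ _ (Finset.mem_univ k),
              ← Finset.add_sum_erase (a := k) _ (fun j => ite _ _ _) (Finset.mem_univ k), hk,
              codeZ_neg, if_neg (by simp), zero_add, add_comm]
            congr 1
            refine Finset.sum_congr rfl fun j hj => ?_
            have hj' := Finset.ne_of_mem_erase hj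
            have hw' := hw
            rw [hA] at hw'
            rw [if_pos ⟨hj', by simp⟩, hw'.2 j ⟨hj', by simp⟩]
          · rintro ⟨hw, hwv⟩
            set f : ℕ → ℕ := fun i => if hi : i < l then
              (if (⟨i, hi⟩ : Fin l) = k then 2 ^ 36 - codeZ (D.root l r)
                else 2 ^ 36 + codeZ (a ⟨i, hi⟩)).toNat else 0 with hf
            have hdig : ∀ j : Fin l, 2 ^ 36 + codeZ (w (simpleRoot j)) =
                if j = k then 2 ^ 36 - codeZ (D.root l r) else 2 ^ 36 + codeZ (a j) := by
              have hfv : ∀ j : Fin l, 0 ≤ (if j = k then 2 ^ 36 - codeZ (D.root l r)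
                  else 2 ^ 36 + codeZ (a j)) ∧ (if j = k then 2 ^ 36 - codeZ (D.root l r)
                  else 2 ^ 36 + codeZ (a j)) < 2 ^ 40 := by
                intro j
                split_ifs with hj
                · have h1 := hD.codeZ_lt (root_mem (l := l) hr')
                  have h2 := hD.codeZ_pos (root_mem hr')
                  norm_num at h1 ⊢
                  constructor <;> linarith
                · have h1 := hD.codeZ_lt (ha j ⟨hj, by simp⟩).1
                  have h2 := hD.codeZ_pos (ha j ⟨hj, by simp⟩).1
                  norm_num at h1 ⊢
                  constructor <;> linarith
              have hfv' : ∀ j : Fin l, (f j : ℤ) = if j = k then 2 ^ 36 - codeZ (D.root l r)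
                  else 2 ^ 36 + codeZ (a j) := by
                intro j
                simp only [hf, j.isLt, dif_pos, Fin.eta]
                exact Int.toNat_of_nonneg (hfv j).1
              have hvf : v = ∑ i ∈ Finset.range l, f i * 2 ^ (40 * i) := by
                zify
                rw [hv, hacc, Finset.sum_range]
                rw [← Finset.add_sum_erase _ _ (Finset.mem_univ k),
                  ← Finset.add_sum_erase (a := k) _ (fun j : Fin l => (f j : ℤ) * _)
                    (Finset.mem_univ k), hfv' k, if_pos rfl, if_neg (by simp), zero_add, add_comm]
                congr 1
                refine Finset.sum_congr rfl fun j hj => ?_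
                have hj' := Finset.ne_of_mem_erase hj
                rw [if_pos ⟨hj', by simp⟩, hfv', if_neg hj']
              intro j
              rw [← hD.digit_of_eq_frame hw hwv.symm j, hvf, digit_sum 40 l f ?_ j.isLt, hfv']
              intro i hi
              have h1 := hfv' ⟨i, hi⟩
              have h2 := (hfv ⟨i, hi⟩).2
              zify
              rw [show ((f i : ℕ) : ℤ) = _ from h1]
              exact h2
            have hwP := fun j => hP.mem_or_neg_mem hw (hP.simple_mem j)
            have hwa : ∀ j, j ≠ k → w (simpleRoot j) = a j := fun j hj => by
              have h1 := hdig j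
              rw [if_neg hj] at h1
              exact hD.codeZ_injOn (hwP j) (Or.inl (ha j ⟨hj, by simp⟩).1) (by linarith)
            have hwk : w (simpleRoot k) = -D.root l r := by
              have h1 := hdig k
              rw [if_pos rfl] at h1
              refine hD.codeZ_injOn (hwP k) (Or.inr ?_) ?_
              · rw [neg_neg]; exact root_mem hr'
              · rw [codeZ_neg]; linarith
            refine ⟨?_, by rw [hwk, neg_neg, hD.index_root hr']⟩
            rw [hA]
            refine ⟨⟨⟨⟨hw, fun j hj => ?_⟩, ?_⟩, fun m hm' => ?_⟩, fun j hj => hwa j hj.1⟩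
            · rw [hwa j hj]; exact ha j ⟨hj, by simp⟩
            · rintro rfl
              have h1 : simpleRoot k = -D.root l r := hwk
              refine hP.neg_notMem (root_mem (l := l) hr') ?_
              rw [← h1]
              exact hP.simple_mem k
            · obtain ⟨b, h1, h2⟩ := hm m hm'
              rw [unionMask, ham] at h1
              obtain ⟨j, hj, rfl⟩ := h1
              exact ⟨j, hj.1, by rw [hwa j hj.1]; exact h2⟩
        rw [hset]
        obtain ⟨p', q', h1, h2⟩ := hD.countFrame_spec hX t' signs 256 true v κ p q h
        exact ⟨p', q', h1, by rw [h2]; simp⟩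
      | cons x rest =>
        obtain ⟨i, hi, hik, hxo, hxA⟩ := hcands x (by simp)
        refine counts_overBits t 128 x.2 _ hAfin (fun w => D.index (w (simpleRoot i))) hxA ?_
          κ p q h
        intro r hr κ p q h
        simp only [force_eq] at h
        have h := restrictThen_eq_true h
        have hro := hxo r hr
        have hr' := hro.trans_le hodd
        set R := digit 2048 (formTable l D.form D.codes D.odd 0 0) r
        rw [List.map_cons, List.nodup_cons] at hnodup
        have hclosed : ∀ j : Fin l, j ≠ k ∧ (j : ℕ) ∉ (D.restrict R x.1 rest).map Prod.fst ↔
            j = i ∨ (j ≠ k ∧ (j : ℕ) ∉ (x :: rest).map Prod.fst) := by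
          intro j
          rw [map_fst_restrict, List.map_cons, List.mem_cons, not_or]
          by_cases hji : j = i
          · subst hji
            simp only [true_or, iff_true]
            exact ⟨hik, by rw [hi]; exact hnodup.1⟩
          · have : (j : ℕ) ≠ x.1 := fun h => hji (Fin.ext (h.trans hi.symm))
            simp [hji, this]
        have hnew : ¬ (i ≠ k ∧ (i : ℕ) ∉ (x :: rest).map Prod.fst) := by
          rw [List.map_cons, hi]; simp
        have hgram : ∀ w ∈ A, D.index (w (simpleRoot i)) = r → ∀ u : RootLattice l,
            bilin X d (w u) (D.root l r) = coroot X i u * d i := by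
          intro w hw hwr u
          rw [← hwr, hD.root_index (hAP w hw i hik), bilin_apply_weylGroup hF.symm (hAW w hw),
            bilin_simpleRoot_right]
        have hrestrict : ∀ y ∈ D.restrict R x.1 rest, ∃ i' : Fin l, (i' : ℕ) = y.1 ∧ i' ≠ k ∧
            (∀ s, y.2.testBit s = true → s < D.odd.length) ∧
            ∀ w ∈ {w ∈ A | D.index (w (simpleRoot i)) = r},
              y.2.testBit (D.index (w (simpleRoot i'))) = true := by
          intro y hy
          obtain ⟨x', hx', hyx, hyb⟩ := mem_restrict hy
          obtain ⟨i', hi', hik', ho', hA'⟩ := hcands x' (by simp [hx'])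
          refine ⟨i', hi'.trans hyx.symm, hik', fun s hs => ?_, fun w hw => ?_⟩
          · rw [hyb, Bool.and_eq_true] at hs
            exact ho' s hs.1
          · rw [hyb, hA' w hw.1, Bool.true_and]
            have hpos := hAP w hw.1 i' hik'
            refine hD.testBit_formTable hF hro (hD.index_lt hpos) (digit_lt 4 _ _) ?_
            rw [hD.root_index hpos, hgram w hw.1 hw.2, coroot_simpleRoot, ← hi', ← hi, hF.form]
        rcases h with ⟨h, y, hy, hy0⟩ | h
        -- Some open simple root has lost its last candidate, so this fibre is empty.
        · refine ⟨p, q, h, ?_⟩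
          have : {w ∈ A | D.index (w (simpleRoot i)) = r} = ∅ := by
            rw [Set.eq_empty_iff_forall_notMem]
            intro w hw
            obtain ⟨i', -, -, -, h1⟩ := hrestrict y hy
            have := h1 w hw
            simp [hy0] at this
          rw [this, detSum_empty, add_zero]
        refine ih _ _ _ _ (Function.update a i (D.root l r)) _ ?_ ?_ ?_ ?_ ?_ ?_ ?_ ?_ κ p q h
        · ext w
          simp only [Set.mem_ofPred_eq, hclosed]
          rw [hA]
          simp only [Set.mem_ofPred_eq, and_assoc]
          refine and_congr_right fun hw => ?_
          have hiP : w (simpleRoot i) ∈ D.posRoots l := (hw.1.1.2 i hik).1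
          constructor
          · rintro ⟨h1, h2⟩ j (rfl | hj)
            · rw [Function.update_self, ← h2, hD.root_index hiP]
            · rw [Function.update_of_ne (by rintro rfl; exact hnew hj), h1 j hj]
          · intro h1
            refine ⟨fun j hj => ?_, ?_⟩
            · have := h1 j (Or.inr hj)
              rwa [Function.update_of_ne (by rintro rfl; exact hnew hj)] at this
            · have := h1 i (Or.inl rfl)
              rw [this, Function.update_self, hD.index_root hr']
        · rw [map_fst_restrict]; exact hnodup.2
        · exact hrestrict
        · intro s hs
          change (neg &&& _).testBit s = true at hs
          rw [Nat.testBit_and, Bool.and_eq_true] at hs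
          exact hneg s hs.1
        · intro w hw
          change (neg &&& (R >>> (128 * (8 - entry D.form k x.1)))).testBit _ = true
          rw [Nat.testBit_and, hneg' w hw.1, Bool.true_and, Nat.testBit_shiftRight]
          have hpos := hAneg w hw.1
          refine hD.testBit_formTable hF hro (hD.index_lt hpos) (by omega) ?_
          rw [hD.root_index hpos, bilin_neg_left, hgram w hw.1 hw.2, coroot_simpleRoot, ← hi]
          rw [Nat.cast_sub (hF.le k i), hF.form]
          push_cast
          ring
        · intro s
          change (am ||| 2 ^ r).testBit s = true ↔ _
          rw [Nat.testBit_or, Nat.testBit_two_pow, Bool.or_eq_true, ham, decide_eq_true_eq]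
          simp only [hclosed]
          constructor
          · rintro (⟨j, hj, h1⟩ | h1)
            · exact ⟨j, Or.inr hj, by
                rw [Function.update_of_ne (by rintro rfl; exact hnew hj), h1]⟩
            · exact ⟨i, Or.inl rfl, by rw [Function.update_self, hD.index_root hr', h1]⟩
          · rintro ⟨j, rfl | hj, h1⟩
            · rw [Function.update_self, hD.index_root hr'] at h1
              exact Or.inr h1
            · rw [Function.update_of_ne (by rintro rfl; exact hnew hj)] at h1
              exact Or.inl ⟨j, hj, h1⟩
        · have h1 : Nat.add acc (Nat.shiftLeft (Nat.add (Nat.pow 2 36)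
              (digit 32 (packList 32 D.codes) r)) (Nat.mul 40 x.1)) =
              acc + (2 ^ 36 + D.codes.getD r 0) * 2 ^ (40 * (i : ℕ)) := by
            rw [← hC, ← Nat.shiftLeft_eq, hi]; rfl
          rw [h1]
          push_cast
          rw [hcode r hr', hacc, ← Finset.add_sum_erase _ _ (Finset.mem_univ i),
            ← Finset.add_sum_erase (a := i) _ (fun j => ite (j ≠ k ∧ (j : ℕ) ∉ List.map Prod.fst
              (D.restrict R x.1 rest)) _ _) (Finset.mem_univ i), if_neg hnew,
            if_pos ((hclosed i).mpr (Or.inl rfl)), Function.update_self, zero_add, add_comm]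
          congr 1
          refine Finset.sum_congr rfl fun j hj => ?_
          have hj' := Finset.ne_of_mem_erase hj
          rw [Function.update_of_ne hj']
          have := hclosed j
          simp only [hj', false_or] at this
          exact if_congr this.symm rfl rfl
        · intro j hj
          rw [hclosed] at hj
          rcases hj with rfl | hj
          · rw [Function.update_self]
            exact ⟨root_mem hr', hD.odd_height_root hro⟩
          · rw [Function.update_of_ne (by rintro rfl; exact hnew hj)]
            exact ha j hj

end SearchData

end NilpotentToda

namespace NilpotentToda

variable {l : ℕ}

/-! ### Sign reversing symmetries of `oddReps` -/

section symmetries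

variable {X : CartanDatum l} {P : Set (RootLattice l)} {k : Fin l}

theorem detSum_eq_zero_of_bijOn {A : Set (RootLattice l ≃ₗ[ℤ] RootLattice l)} (hA : A.Finite)
    (φ : (RootLattice l ≃ₗ[ℤ] RootLattice l) → RootLattice l ≃ₗ[ℤ] RootLattice l)
    (hmaps : Set.MapsTo φ A A) (hinj : Function.Injective φ)
    (hdet : ∀ w, detZ (φ w) = -detZ w) : detSum A = 0 := by
  have h : detSum A = -detSum A := by
    conv_rhs => rw [detSum, ← finsum_mem_neg_distrib _ hA]
    have hb := (hA.injOn_iff_bijOn_of_mapsTo hmaps).mp hinj.injOn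
    exact (finsum_mem_eq_of_bijOn φ hb fun w _ => (hdet w).symm).symm
  omega

/-- Membership in `oddReps` depends only on the set of images of the simple roots other than `α_k`,
and `u` permutes these roots. If `w₀ = -1`, the element `w₀ w_J` is of this kind. -/
theorem detSum_oddReps_eq_zero_of_mul_right (hfin : {w | w ∈ weylGroup X}.Finite)
    {u : RootLattice l ≃ₗ[ℤ] RootLattice l} (hu : u ∈ weylGroup X) (hdet : detZ u = -1)
    (h : ∀ j, j ≠ k → ∃ i, i ≠ k ∧ u (simpleRoot j) = simpleRoot i) :
    detSum (oddReps X P k) = 0 := by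
  refine detSum_eq_zero_of_bijOn (hfin.subset fun w hw => hw.1) (fun w => w * u) ?_
    (mul_left_injective u) fun w => by rw [detZ_mul, hdet]; ring
  intro w hw
  refine ⟨mul_mem hw.1 hu, fun j hj => ?_⟩
  obtain ⟨i, hi, h1⟩ := h j hj
  rw [LinearEquiv.mul_apply, h1]
  exact hw.2 i hi

/-- The image of a simple root other than `α_k` is `α_a` or `α_b`. -/
def MeetsEdge (k a b : Fin l) (w : RootLattice l ≃ₗ[ℤ] RootLattice l) : Prop :=
  ∃ j, j ≠ k ∧ (w (simpleRoot j) = simpleRoot a ∨ w (simpleRoot j) = simpleRoot b)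

/-- The reflection in `α_a + α_b`, for neighbours `a` and `b`. -/
def edgeReflection (X : CartanDatum l) (a b : Fin l) : RootLattice l ≃ₗ[ℤ] RootLattice l :=
  simpleReflection X a * simpleReflection X b * simpleReflection X a

theorem edgeReflection_apply {a b : Fin l} (hab : X.mat a b = -1) (hba : X.mat b a = -1)
    (v : RootLattice l) : edgeReflection X a b v =
      v - (coroot X a v + coroot X b v) • (simpleRoot a + simpleRoot b) := by
  simp only [edgeReflection, LinearEquiv.mul_apply, simpleReflection_apply, map_sub, map_smul,
    coroot_simpleRoot, hab, hba, X.diag]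
  module

/-- Left multiplication by the reflection in `α_a + α_b` changes heights by even numbers. The
positive roots it makes negative are `α_a`, `α_b` and `α_a + α_b`: the first two are excluded by
hypothesis, the last by its even height. -/
theorem IsPositiveSystem.detSum_not_meetsEdge (hP : IsPositiveSystem X P)
    (hfin : {w | w ∈ weylGroup X}.Finite) {a b : Fin l} (hab : X.mat a b = -1)
    (hba : X.mat b a = -1) (Q : (RootLattice l ≃ₗ[ℤ] RootLattice l) → Prop)
    (hQ : ∀ w, Q w → Q (edgeReflection X a b * w)) :
    detSum {w | (w ∈ oddReps X P k ∧ Q w) ∧ ¬ MeetsEdge k a b w} = 0 := by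
  set t := edgeReflection X a b
  have ht : t ∈ weylGroup X := mul_mem (mul_mem (simpleReflection_mem_weylGroup X a)
    (simpleReflection_mem_weylGroup X b)) (simpleReflection_mem_weylGroup X a)
  have hta : t (simpleRoot a) = -simpleRoot b := by
    rw [edgeReflection_apply hab hba, coroot_simpleRoot, coroot_simpleRoot, X.diag, hab]
    module
  have htb : t (simpleRoot b) = -simpleRoot a := by
    rw [edgeReflection_apply hab hba, coroot_simpleRoot, coroot_simpleRoot, X.diag, hba]
    module
  have htt : ∀ v, t (t v) = v := fun v => by
    change (t * t) v = v
    have : t * t = 1 := by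
      have h1 := simpleReflection_mul_self X a
      have h2 := simpleReflection_mul_self X b
      calc t * t = simpleReflection X a * simpleReflection X b *
            (simpleReflection X a * simpleReflection X a) * simpleReflection X b *
              simpleReflection X a := by simp only [t, edgeReflection, mul_assoc]
        _ = 1 := by rw [h1, mul_one, mul_assoc (simpleReflection X a), h2, mul_one, h1]
    rw [this]; rfl
  refine detSum_eq_zero_of_bijOn (hfin.subset fun w hw => hw.1.1.1) (fun w => t * w) ?_
    (mul_right_injective t) fun w => ?_
  · rintro w ⟨⟨hw, hwQ⟩, hm⟩
    have hpos : ∀ j, j ≠ k → t (w (simpleRoot j)) ∈ P := fun j hj => by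
      have h1 := hw.2 j hj
      have hna : w (simpleRoot j) ≠ simpleRoot a := fun h => hm ⟨j, hj, Or.inl h⟩
      have hnb : w (simpleRoot j) ≠ simpleRoot b := fun h => hm ⟨j, hj, Or.inr h⟩
      refine hP.reflection_mem _ (hP.reflection_mem _ (hP.reflection_mem _ h1.1 a hna) b ?_) a ?_
      -- Here the image of `α_j` would be `α_a + α_b`, of height 2.
      · intro h
        have h2 := congrArg (simpleReflection X a) h
        have h3 : simpleReflection X a (simpleReflection X a (w (simpleRoot j))) =
          w (simpleRoot j) := congrArg (fun f => f (w (simpleRoot j)))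
            (simpleReflection_mul_self X a)
        rw [h3, simpleReflection_simpleRoot, hba] at h2
        rw [h2] at h1
        have h4 : height (simpleRoot b - (-1 : ℤ) • simpleRoot a) = 2 := by
          rw [neg_smul, one_smul, sub_neg_eq_add, height]
          simp only [Pi.add_apply, Finset.sum_add_distrib]
          have ha := height_simpleRoot a
          have hb := height_simpleRoot b
          rw [height] at ha hb
          rw [ha, hb]; norm_num
        rw [h4] at h1
        exact absurd h1.2 (by decide)
      · intro h
        apply hnb
        have h2 : t (w (simpleRoot j)) = -simpleRoot a := by
          have : t (w (simpleRoot j)) = simpleReflection X a (simpleRoot a) := by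
            rw [← h]; rfl
          rw [this, simpleReflection_self]
        rw [← htt (w (simpleRoot j)), h2, map_neg, hta, neg_neg]
    refine ⟨⟨⟨mul_mem ht hw.1, fun j hj => ⟨hpos j hj, ?_⟩⟩, hQ w hwQ⟩, ?_⟩
    · have h1 := (hw.2 j hj).2
      rw [LinearEquiv.mul_apply, edgeReflection_apply hab hba]
      set v := w (simpleRoot j)
      have h2 : height (v - (coroot X a v + coroot X b v) • (simpleRoot a + simpleRoot b)) =
          height v - (coroot X a v + coroot X b v) * 2 := by
        have ha := height_simpleRoot a
        have hb := height_simpleRoot b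
        rw [height] at ha hb ⊢
        simp only [Pi.sub_apply, Pi.smul_apply, Pi.add_apply, smul_eq_mul,
          Finset.sum_sub_distrib, ← Finset.mul_sum, Finset.sum_add_distrib, ha, hb]
        rw [height]; norm_num
      rw [h2]
      exact h1.sub_even ⟨_, mul_two _⟩
    · rintro ⟨j, hj, h | h⟩
      · have h1 : w (simpleRoot j) = -simpleRoot b := by
          rw [← hta, ← h, LinearEquiv.mul_apply, htt]
        exact hP.neg_notMem (hP.simple_mem b) (h1 ▸ (hw.2 j hj).1)
      · have h1 : w (simpleRoot j) = -simpleRoot a := by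
          rw [← htb, ← h, LinearEquiv.mul_apply, htt]
        exact hP.neg_notMem (hP.simple_mem a) (h1 ▸ (hw.2 j hj).1)
  · rw [detZ_mul]
    simp only [t, edgeReflection, detZ_mul, detZ_simpleReflection]
    ring

/-- The cancellation is applied to the two edges in turn. The second reflection fixes `α_a` and
`α_b` by orthogonality, so it respects the condition obtained from the first. -/
theorem IsPositiveSystem.detSum_meetsEdge (hP : IsPositiveSystem X P)
    (hfin : {w | w ∈ weylGroup X}.Finite) {a b a' b' : Fin l} (hab : X.mat a b = -1)
    (hba : X.mat b a = -1) (hab' : X.mat a' b' = -1) (hba' : X.mat b' a' = -1)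
    (horth : X.mat a a' = 0 ∧ X.mat a b' = 0 ∧ X.mat b a' = 0 ∧ X.mat b b' = 0) :
    detSum {w | (w ∈ oddReps X P k ∧ MeetsEdge k a b w) ∧ MeetsEdge k a' b' w} =
      detSum (oddReps X P k) := by
  have hf : ∀ A : Set (RootLattice l ≃ₗ[ℤ] RootLattice l), (∀ w ∈ A, w ∈ weylGroup X) →
      A.Finite := fun A hA => hfin.subset hA
  have h1 := detSum_split (hf (oddReps X P k) fun w hw => hw.1) (MeetsEdge k a b)
  have h2 := detSum_split (hf {w | w ∈ oddReps X P k ∧ MeetsEdge k a b w} fun w hw => hw.1.1)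
    (MeetsEdge k a' b')
  have h3 := hP.detSum_not_meetsEdge (k := k) hfin hab hba (fun _ => True) (fun _ _ => trivial)
  have h4 := hP.detSum_not_meetsEdge (k := k) hfin hab' hba' (MeetsEdge k a b) (by
    rintro w ⟨j, hj, h⟩
    refine ⟨j, hj, ?_⟩
    rw [LinearEquiv.mul_apply]
    rcases h with h | h <;> rw [h, edgeReflection_apply hab' hba', coroot_simpleRoot,
      coroot_simpleRoot]
    · left; rw [horth.1, horth.2.1]; simp
    · right; rw [horth.2.2.1, horth.2.2.2]; simp)
  simp only [and_true] at h3
  rw [h3, add_zero] at h1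
  simp only [Set.mem_ofPred_eq] at h2
  rw [h4, add_zero] at h2
  rw [h1, h2]

end symmetries

/-! ### Certificates -/

/-- The table that turns the places of the signs in a packed frame, modulo `131`, into the
numbers of the simple roots. -/
def signTable : ℕ → ℕ
  | 0 => 0
  | Nat.succ n => Nat.lor (signTable n)
      (Nat.shiftLeft n (Nat.mul 8 (Nat.mod (Nat.pow 2 (Nat.add (Nat.mul 40 n) 36)) 131)))

/-- The column `j` of the Cartan matrix, as a change of frames under `s_j`. -/
def changeColumn (l cartan j : ℕ) : ℕ :=
  packFn (fun i => bif Nat.beq i j then 0 else Nat.sub 4 (entry cartan j i)) l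

/-- The packed changes of frames under the simple reflections. -/
def changeTable (l cartan : ℕ) : ℕ → ℕ
  | 0 => 0
  | Nat.succ j =>
    Nat.add (changeTable l cartan j) (Nat.shiftLeft (changeColumn l cartan j) (Nat.mul 320 j))

namespace SearchData

variable (D : SearchData) {X : CartanDatum l} {d : Fin l → ℤ}

/-- All finite checks for the tables of `D`. -/
def tablesOk (l : ℕ) : Bool :=
  (D.codes.all fun c => !Nat.beq c 0 && Nat.ble (Nat.succ c) (Nat.pow 16 l)) &&
  (D.odd.all fun c => Nat.beq (Nat.mod (digitSum l c) 2) 1) &&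
  (D.even.all fun c => Nat.beq (Nat.mod (digitSum l c) 2) 0) &&
  (D.codes.all fun c => (List.range l).all fun i => D.reflectionMem l c i)

variable {D}

theorem isRootTable_of_tablesOk (h : D.tablesOk l = true) (hl : l ≤ 8)
    (hlen : D.codes.length ≤ 128) (hnodup : D.codes.Nodup)
    (hsimple : ∀ i : Fin l, 16 ^ (i : ℕ) ∈ D.odd)
    (hcartan : ∀ i j : Fin l, (entry D.cartan i j : ℤ) = X.mat j i + 4) : D.IsRootTable X := by
  simp only [tablesOk, Bool.and_eq_true, List.all_eq_true, Bool.not_eq_true', Nat.beq_eq,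
    Nat.ble_eq, List.mem_range] at h
  obtain ⟨⟨⟨h1, h2⟩, h3⟩, h4⟩ := h
  refine ⟨hl, hlen, hnodup, fun c hc h0 => ?_, fun c hc => (h1 c hc).2, h2, h3, hsimple, hcartan,
    h4⟩
  have := (h1 c hc).1
  rw [h0] at this
  exact absurd this (by decide)

/-- The diagonal of the Cartan matrix is absorbed by the summand 2, so the remaining change has
nonnegative digits. For `auto`: zero is no frame because all digits of a frame are positive, and an
element of the Weyl group that maps simple roots to simple roots is the identity. -/
theorem IsRootTable.hasChange (hD : D.IsRootTable X) (hl : 0 < l)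
    (hchange : ∀ j : Fin l, digit 320 D.change j = changeColumn l D.cartan j)
    (hcol : ∀ i j : Fin l, i ≠ j → entry D.cartan j i ≤ 4)
    (hauto : D.auto = 0 ∨ (∀ j : Fin l, ∃ i : Fin l, digit 40 D.auto j = 2 ^ 36 + 16 ^ (i : ℕ)) ∧
      ∃ j : Fin l, digit 40 D.auto j ≠ 2 ^ 36 + 16 ^ (j : ℕ)) : D.HasChange X where
  change j := by
    rw [hchange, changeColumn, packFn_eq, Finset.sum_range]
    push_cast
    rw [eq_sub_iff_add_eq, ← Finset.sum_add_distrib, Finset.sum_eq_single j]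
    · rw [X.diag]; simp
    · intro i _ hij
      have hij' : ¬ (i : ℕ) = j := fun h => hij (Fin.ext h)
      have h1 : Nat.beq (i : ℕ) j = false := by
        rw [← Bool.not_eq_true, Nat.beq_eq]; exact hij'
      rw [h1, cond_false, Nat.sub_eq, Nat.cast_sub (hcol i j hij), hD.cartan]
      push_cast
      ring
    · simp
  auto w hw h := by
    have hdig := hD.digit_of_eq_frame hw h.symm
    have hP := hD.isPositiveSystem
    rcases hauto with h0 | ⟨h1, j, h2⟩
    · rw [h0] at h
      have h3 := hdig ⟨0, hl⟩
      have h4 := (abs_lt.mp (hD.abs_codeZ_lt hw ⟨0, hl⟩)).1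
      rw [h0, digit_eq, Nat.zero_div, Nat.zero_mod] at h3
      norm_num at h3 h4
      linarith
    · have h3 : ∀ j : Fin l, ∃ i : Fin l, digit 40 D.auto j = 2 ^ 36 + 16 ^ (i : ℕ) ∧
          w (simpleRoot j) = simpleRoot i := fun j => by
        obtain ⟨i, hi⟩ := h1 j
        refine ⟨i, hi, ?_⟩
        refine hD.codeZ_injOn (hP.mem_or_neg_mem hw (hP.simple_mem j)) (Or.inl (hP.simple_mem i)) ?_
        have h4 := hdig j
        rw [hi] at h4
        push_cast at h4
        rw [codeZ_simpleRoot]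
        linarith
      have h5 := hP.eq_one_of_forall_pos hw fun j => by
        obtain ⟨i, -, hi⟩ := h3 j
        rw [hi]; exact hP.simple_mem i
      obtain ⟨i, hi, hi'⟩ := h3 j
      rw [h5] at hi'
      have h6 : codeZ (simpleRoot j : RootLattice l) = codeZ (simpleRoot i) :=
        congrArg codeZ hi'
      rw [codeZ_simpleRoot, codeZ_simpleRoot] at h6
      apply h2
      rw [hi]
      congr 1
      exact_mod_cast h6.symm

variable (D)

/-- Whether `v` is the frame of an element of the Weyl group of determinant `-1` that permutes
the simple roots other than `α_k`. -/
def mirrorOk (l k v : ℕ) : Bool :=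
  D.countFrame l (signTable 8) (identityFrame l) (packFn (fun _ => Nat.pow 2 36) l) 256 true v
    (fun p q => Nat.beq p 0 && Nat.beq q 1) 0 0 &&
  (List.range l).all fun j => Nat.beq j k || (List.range l).any fun i =>
    !Nat.beq i k && Nat.beq (digit 40 v j) (Nat.add (Nat.pow 2 36) (Nat.pow 16 i))

/-- A search over all frames without the image of `α_k`: the simple roots are taken in the order
of the list `x.2.1`, and the absolute value of the sum of the determinants has to be `x.2.2`. -/
def searchOk (l : ℕ) (needs : List ℕ) (L : List (ℕ × List ℕ × ℕ)) : Bool :=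
  force (exponentTable 130) fun t => force (signTable 8) fun t' =>
  force (formTable l D.form D.codes D.odd 0 0) fun T => force (packList 32 D.codes) fun C =>
  force (identityFrame l) fun target => force (packFn (fun _ => Nat.pow 2 36) l) fun signs =>
    L.all fun x => D.search l t t' T C target signs needs x.1 10
      (x.2.1.map fun j => (j, Nat.sub (Nat.pow 2 D.odd.length) 1))
      (unionMask (x.2.1.map fun j => (j, Nat.sub (Nat.pow 2 D.odd.length) 1)) 0)
      (Nat.sub (Nat.pow 2 D.codes.length) 1) 0 0
      -- The successor accounts for the identity, which has determinant 1 and is left out of the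
      -- search.
      (fun p q => Nat.beq (Nat.succ p) (Nat.add q x.2.2) || Nat.beq q (Nat.add (Nat.succ p) x.2.2))
      0 0

variable {D}

/-- The count `(0, 1)` shows that the frame belongs to an element of the Weyl group, unique by
injectivity of frames, and that its determinant is `-1`. -/
theorem IsRootTable.detSum_eq_zero_of_mirrorOk (hD : D.IsRootTable X) (hX : D.HasChange X)
    {k : Fin l} {v : ℕ} (h : D.mirrorOk l k v = true) :
    detSum (oddReps X (D.posRoots l) k) = 0 := by
  simp only [mirrorOk, Bool.and_eq_true, List.all_eq_true, List.mem_range, Bool.or_eq_true,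
    List.any_eq_true, Bool.not_eq_true', Nat.beq_eq] at h
  obtain ⟨h1, h2⟩ := h
  obtain ⟨p, q, h3, h4⟩ := hD.countFrame_spec hX _ _ _ _ _ _ _ _ h1
  simp only [Bool.and_eq_true, Nat.beq_eq] at h3
  rw [h3.1, h3.2] at h4
  have h5 : detSum {w | w ∈ weylGroup X ∧ frame w = v} = -1 := by
    simp at h4; linarith
  have hne : {w | w ∈ weylGroup X ∧ frame w = v}.Nonempty := by
    rw [Set.nonempty_iff_ne_empty]
    intro h6
    rw [h6, detSum_empty] at h5
    norm_num at h5
  obtain ⟨u, hu, huv⟩ := hne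
  have hsing : {w | w ∈ weylGroup X ∧ frame w = v} = {u} := by
    ext w
    simp only [Set.mem_ofPred_eq, Set.mem_singleton_iff]
    exact ⟨fun hw => hD.frame_injOn hw.1 hu (hw.2.trans huv.symm), fun hw => hw ▸ ⟨hu, huv⟩⟩
  rw [hsing, detSum_singleton] at h5
  have hP := hD.isPositiveSystem
  refine detSum_oddReps_eq_zero_of_mul_right hD.finite_weylGroup hu h5 fun j hj => ?_
  rcases h2 j j.isLt with h6 | ⟨i, hi, h7, h8⟩
  · exact absurd (Fin.ext h6) hj
  · refine ⟨⟨i, hi⟩, ?_, ?_⟩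
    · rintro rfl
      rw [← Bool.not_eq_true, Nat.beq_eq] at h7
      exact h7 rfl
    · refine hD.codeZ_injOn (hP.mem_or_neg_mem hu (hP.simple_mem j))
        (Or.inl (hP.simple_mem ⟨i, hi⟩)) ?_
      have h9 := hD.digit_of_eq_frame hu huv.symm j
      rw [h8, Nat.add_eq, Nat.pow_eq, Nat.pow_eq] at h9
      push_cast at h9
      rw [codeZ_simpleRoot]
      linarith

theorem one_mem_oddReps {P : Set (RootLattice l)} (hP : IsPositiveSystem X P) (k : Fin l) :
    1 ∈ oddReps X P k :=
  ⟨one_mem _, fun j _ => ⟨hP.simple_mem j, by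
    change Odd (height (simpleRoot j)); rw [height_simpleRoot]; decide⟩⟩

/-- Initially nothing is fixed: every root of odd height is a candidate for each image other than
that of `α_k`, and every positive root for minus the image of `α_k`. The identity is then added by
hand, and `hneeds` says that it meets the required sets. -/
theorem IsRootTable.abs_detSum_of_searchOk (hD : D.IsRootTable X) (hX : D.HasChange X)
    (hF : D.HasForm X d) {needs : List ℕ} {L : List (ℕ × List ℕ × ℕ)}
    (h : D.searchOk l needs L = true) {k : Fin l} {o : List ℕ} {z : ℕ} (hk : (↑k, o, z) ∈ L)
    (ho : o.Nodup) (hok : ∀ j ∈ o, j < l ∧ j ≠ k) (hko : ∀ j : Fin l, j ≠ k → ↑j ∈ o)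
    (hneeds : ∀ m ∈ needs, ∃ j, j ≠ k ∧ m.testBit (D.index (simpleRoot j : RootLattice l)) = true) :
    |detSum {w | w ∈ oddReps X (D.posRoots l) k ∧
      ∀ m ∈ needs, ∃ j, j ≠ k ∧ m.testBit (D.index (w (simpleRoot j))) = true}| = z := by
  have hP := hD.isPositiveSystem
  simp only [searchOk, force_eq, List.all_eq_true] at h
  have h1 := h _ hk
  have hmask : ∀ n r : ℕ, (Nat.sub (Nat.pow 2 n) 1).testBit r = true ↔ r < n := fun n r => by
    change (2 ^ n - 1).testBit r = true ↔ _
    rw [Nat.testBit_two_pow_sub_one, decide_eq_true_eq]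
  have hmap : (o.map fun j => (j, Nat.sub (Nat.pow 2 D.odd.length) 1)).map Prod.fst = o := by
    rw [List.map_map]; exact List.map_id o
  have hvoid : ∀ j : Fin l, ¬ (j ≠ k ∧ (j : ℕ) ∉ o) := fun j hj => hj.2 (hko j hj.1)
  have hRP : ∀ w ∈ D.reducedReps X k needs, ∀ j ≠ k,
      w (simpleRoot j) ∈ D.posRoots l ∧ Odd (height (w (simpleRoot j))) :=
    fun w hw j hj => hw.1.1.2 j hj
  obtain ⟨p, q, h2, h3⟩ := hD.counts_search (exponentTable 130) (signTable 8)
    (packFn (fun _ => Nat.pow 2 36) l) needs hX hF k 10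
    (o.map fun j => (j, Nat.sub (Nat.pow 2 D.odd.length) 1))
    (Nat.sub (Nat.pow 2 D.codes.length) 1) 0 0 0 (D.reducedReps X k needs)
    (by
      rw [hmap]
      ext w
      simp only [Set.mem_ofPred_eq]
      exact ⟨fun hw => ⟨hw, fun j hj => absurd hj (hvoid j)⟩, fun hw => hw.1⟩)
    (by rw [hmap]; exact ho)
    (by
      intro x hx
      obtain ⟨j, hj, rfl⟩ := List.mem_map.mp hx
      refine ⟨⟨j, (hok j hj).1⟩, rfl, fun h => (hok j hj).2 (congrArg Fin.val h),
        fun r => (hmask _ _).mp, fun w hw => (hmask _ _).mpr ?_⟩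
      have h4 := hRP w hw ⟨j, (hok j hj).1⟩ fun h => (hok j hj).2 (congrArg Fin.val h)
      exact hD.index_lt_of_odd h4.1 h4.2)
    (fun r => (hmask _ _).mp)
    (by
      intro w hw
      rw [hmask]
      refine hD.index_lt ((hP.mem_or_neg_mem hw.1.1.1 (hP.simple_mem k)).resolve_left fun h => ?_)
      refine hw.1.2 (hP.eq_one_of_forall_pos hw.1.1.1 fun j => ?_)
      by_cases hj : j = k
      · rw [hj]; exact h
      · exact (hRP w hw j hj).1)
    (by
      intro r
      simp only [Nat.zero_testBit, Bool.false_eq_true, false_iff, hmap]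
      rintro ⟨j, hj, -⟩
      exact hvoid j hj)
    (by
      rw [hmap, Finset.sum_eq_zero fun j _ => if_neg (hvoid j)]; rfl)
    (by
      rw [hmap]
      exact fun j hj => absurd hj (hvoid j))
    _ 0 0 h1
  have h4 : detSum {w | w ∈ oddReps X (D.posRoots l) k ∧
      ∀ m ∈ needs, ∃ j, j ≠ k ∧ m.testBit (D.index (w (simpleRoot j))) = true} =
      1 + detSum (D.reducedReps X k needs) := by
    rw [detSum_add_of_disjoint (B := {1}) (C := D.reducedReps X k needs)
      (hD.finite_weylGroup.subset fun w hw => hw.1.1), detSum_singleton, detZ_one]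
    · rw [Set.disjoint_singleton_left]
      exact fun h => h.1.2 rfl
    · ext w
      simp only [reducedReps, Set.mem_union, Set.mem_singleton_iff, Set.mem_ofPred_eq]
      constructor
      · rintro (rfl | hw)
        · exact ⟨one_mem_oddReps hP k, hneeds⟩
        · exact ⟨hw.1.1, hw.2⟩
      · intro hw
        by_cases h : w = 1
        · exact Or.inl h
        · exact Or.inr ⟨⟨hw.1, h⟩, hw.2⟩
  rw [h4]
  simp only [Bool.or_eq_true, Nat.beq_eq, Nat.succ_eq_add_one, Nat.add_eq] at h2
  push_cast at h3
  rcases h2 with h2 | h2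
  · rw [show 1 + detSum (D.reducedReps X k needs) = (z : ℤ) by zify at h2; linarith]
    exact abs_of_nonneg (Int.natCast_nonneg _)
  · rw [show 1 + detSum (D.reducedReps X k needs) = -(z : ℤ) by zify at h2; linarith, abs_neg]
    exact abs_of_nonneg (Int.natCast_nonneg _)

end SearchData

end NilpotentToda

namespace NilpotentToda

/-! ### The exceptional types -/

/-- The search data with the given tables. -/
def searchData (l : ℕ) (odd even : List ℕ) (cartan form auto : ℕ) : SearchData :=
  ⟨odd, even, cartan, form, changeTable l cartan l, auto⟩

/-- The tables for the type `E_6`. -/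
def dataE₆ : SearchData := searchData 6
  [0x100000, 0x10000, 0x1000, 0x100, 0x10, 0x1, 0x101100, 0x11100, 0x100110, 0x1110, 0x111,
   0x111110, 0x101210, 0x101111, 0x11111, 0x112210, 0x111211, 0x101221, 0x112221, 0x212321]
  [0x11000, 0x100100, 0x1100, 0x110, 0x11, 0x111100, 0x101110, 0x11110, 0x100111, 0x1111,
   0x111210, 0x111111, 0x101211, 0x112211, 0x111221, 0x112321]
  0x6443440046344400436344003436340044436300444436
  0x6443440046344400436344003436340044436300444436
  -- The frame of the diagram automorphism, which reverses the chain `α_1, …, α_5` and fixes `α_6`.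
  0x100010000010000000011000000010100000010010000010001000010000

theorem isRootTableE₆ : dataE₆.IsRootTable typeE₆ :=
  SearchData.isRootTable_of_tablesOk (by decide +kernel) (by decide) (by decide) (by decide +kernel)
    (by decide +kernel) (by decide +kernel)

theorem hasChangeE₆ : dataE₆.HasChange typeE₆ :=
  isRootTableE₆.hasChange (by decide) (by decide +kernel) (by decide +kernel)
    (Or.inr (by decide +kernel))

theorem hasFormE₆ : dataE₆.HasForm typeE₆ ![1, 1, 1, 1, 1, 1] :=
  ⟨by decide +kernel, by decide +kernel, by decide +kernel⟩

/-- Since `-1` is not in the Weyl group of `E_6`, the argument with `w₀ w_J` is not available, and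
all six places are searched. The two sums of absolute value 6 arise here. -/
theorem searchOkE₆ : dataE₆.searchOk 6 []
    [(0, [5, 2, 3, 1, 4], 6), (1, [5, 2, 3, 4, 0], 0), (2, [4, 3, 1, 0, 5], 0),
     (3, [5, 2, 1, 0, 4], 0), (4, [5, 2, 3, 1, 0], 6), (5, [4, 3, 2, 1, 0], 0)] = true := by
  decide +kernel

/-- The tables for the type `E_7`. -/
def dataE₇ : SearchData := searchData 7
  [0x1000000, 0x100000, 0x10000, 0x1000, 0x100, 0x10, 0x1, 0x1011000, 0x111000, 0x1001100,
   0x11100, 0x1110, 0x111, 0x1111100, 0x1012100, 0x1011110, 0x111110, 0x1001111, 0x11111,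
   0x1122100, 0x1112110, 0x1012210, 0x1111111, 0x1012111, 0x1122210, 0x1122111, 0x1112211,
   0x1012221, 0x2123210, 0x1123211, 0x1122221, 0x2123221, 0x1123321, 0x2124321, 0x2234321]
  [0x110000, 0x1001000, 0x11000, 0x1100, 0x110, 0x11, 0x1111000, 0x1011100, 0x111100, 0x1001110,
   0x11110, 0x1111, 0x1112100, 0x1111110, 0x1012110, 0x1011111, 0x111111, 0x1122110, 0x1112210,
   0x1112111, 0x1012211, 0x1123210, 0x1122211, 0x1112221, 0x2123211, 0x1123221, 0x2123321,
   0x2134321]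
  0x6443444046344440436344403436344044436340444436304444436
  0x6443444046344440436344403436344044436340444436304444436
  0

theorem isRootTableE₇ : dataE₇.IsRootTable typeE₇ :=
  SearchData.isRootTable_of_tablesOk (by decide +kernel) (by decide) (by decide) (by decide +kernel)
    (by decide +kernel) (by decide +kernel)

theorem hasChangeE₇ : dataE₇.HasChange typeE₇ :=
  isRootTableE₇.hasChange (by decide) (by decide +kernel) (by decide +kernel) (Or.inl rfl)

theorem hasFormE₇ : dataE₇.HasForm typeE₇ ![1, 1, 1, 1, 1, 1, 1] :=
  ⟨by decide +kernel, by decide +kernel, by decide +kernel⟩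

/-- The frame of `w₀ w_J` with `w₀ = -1`: it realises the opposition involution on the diagram
without `α_k`. It is odd because the number of positive roots outside the parabolic subsystem is,
here `63 - 36`. The other certificates of this kind have the same source. -/
theorem mirrorOkE₇_0 : dataE₇.mirrorOk 7 0
    0x1001000000100000001010000001001000001000100001000010001000000ffddcbcdf = true := by
  decide +kernel

theorem mirrorOkE₇_3 : dataE₇.mirrorOk 7 3
    0x1001000000100001000010001000000ffeeeeeef100000000110000000101000000100 = true := by
  decide +kernel

theorem mirrorOkE₇_4 : dataE₇.mirrorOk 7 4
    0x100000000110001000000ffeeedddf1000000010100000010010000010001001000000 = true := by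
  decide +kernel

theorem mirrorOkE₇_5 : dataE₇.mirrorOk 7 5
    0x10010000000ffdecbcdf10000100001000001000100000010010000000101000000001 = true := by
  decide +kernel

theorem searchOkE₇ : dataE₇.searchOk 7 []
    [(1, [6, 3, 4, 2, 5, 0], 0), (2, [6, 3, 4, 5, 1, 0], 0), (6, [5, 4, 3, 2, 1, 0], 0)] =
      true := by
  decide +kernel

/-- The tables for the type `E_8`. -/
def dataE₈ : SearchData := searchData 8
  [0x10000000, 0x1000000, 0x100000, 0x10000, 0x1000, 0x100, 0x10, 0x1, 0x10110000, 0x1110000,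
   0x10011000, 0x111000, 0x11100, 0x1110, 0x111, 0x11111000, 0x10121000, 0x10111100, 0x1111100,
   0x10011110, 0x111110, 0x11111, 0x11221000, 0x11121100, 0x10122100, 0x11111110, 0x10121110,
   0x10111111, 0x1111111, 0x11222100, 0x11221110, 0x11122110, 0x10122210, 0x11121111, 0x10122111,
   0x21232100, 0x11232110, 0x11222210, 0x11222111, 0x11122211, 0x10122221, 0x21232210,
   0x11233210, 0x21232111, 0x11232211, 0x11222221, 0x21243210, 0x21233211, 0x21232221,
   0x11233221, 0x22343210, 0x21343211, 0x21243221, 0x21233321, 0x22343221, 0x21343321,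
   0x21244321, 0x22344321, 0x21354321, 0x32354321, 0x22454321, 0x32464321, 0x32465421,
   0x32465432]
  [0x1100000, 0x10010000, 0x110000, 0x11000, 0x1100, 0x110, 0x11, 0x11110000, 0x10111000,
   0x1111000, 0x10011100, 0x111100, 0x11110, 0x1111, 0x11121000, 0x11111100, 0x10121100,
   0x10111110, 0x1111110, 0x10011111, 0x111111, 0x11221100, 0x11122100, 0x11121110, 0x10122110,
   0x11111111, 0x10121111, 0x11232100, 0x11222110, 0x11122210, 0x11221111, 0x11122111,
   0x10122211, 0x21232110, 0x11232210, 0x11232111, 0x11222211, 0x11122221, 0x21233210,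
   0x21232211, 0x11233211, 0x11232221, 0x21343210, 0x21243211, 0x21233221, 0x11233321,
   0x22343211, 0x21343221, 0x21243321, 0x22343321, 0x21344321, 0x31354321, 0x22354321,
   0x32454321, 0x32465321, 0x32465431]
  0x6443444446344444436344443436344444436344444436344444436344444436
  0x6443444446344444436344443436344444436344444436344444436344444436
  0

theorem isRootTableE₈ : dataE₈.IsRootTable typeE₈ :=
  SearchData.isRootTable_of_tablesOk (by decide +kernel) (by decide) (by decide) (by decide +kernel)
    (by decide +kernel) (by decide +kernel)

theorem hasChangeE₈ : dataE₈.HasChange typeE₈ :=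
  isRootTableE₈.hasChange (by decide) (by decide +kernel) (by decide +kernel) (Or.inl rfl)

theorem hasFormE₈ : dataE₈.HasForm typeE₈ ![1, 1, 1, 1, 1, 1, 1, 1] :=
  ⟨by decide +kernel, by decide +kernel, by decide +kernel⟩

theorem mirrorOkE₈_0 : dataE₈.mirrorOk 8 0
    0x10100000001001000000100010000010000100001000001000100000010010000000100fcdb9abcf = true := by
  decide +kernel

theorem mirrorOkE₈_1 : dataE₈.mirrorOk 8 1
    0x1010000000100000010010000010001000010000100010000010010000000fddcbcdef1000000001 = true := by
  decide +kernel

theorem mirrorOkE₈_2 : dataE₈.mirrorOk 8 2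
    0x100000100010010000001000100000100001000010100000000fdedcdeef10000000011000000010 = true := by
  decide +kernel

/-- The two masks mark the numbers of `α_1`, `α_2` (places 7 and 6) and of `α_4`, `α_5` (places 4
and 3) in the table of odd roots. They confine the search to elements meeting both of these
orthogonal edges. -/
theorem searchOkE₈_3 :
    dataE₈.searchOk 8 [0xc0, 0x18] [(3, [7, 4, 5, 6, 2, 1, 0], 0)] = true := by
  decide +kernel

theorem searchOkE₈_4 :
    dataE₈.searchOk 8 [0xc0, 0x18] [(4, [3, 2, 1, 0, 6, 5, 7], 0)] = true := by
  decide +kernel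

theorem searchOkE₈_5 :
    dataE₈.searchOk 8 [0xc0, 0x18] [(5, [7, 4, 3, 2, 1, 0, 6], 0)] = true := by
  decide +kernel

theorem searchOkE₈_6 :
    dataE₈.searchOk 8 [0xc0, 0x18] [(6, [7, 4, 5, 3, 2, 1, 0], 0)] = true := by
  decide +kernel

theorem searchOkE₈_7 :
    dataE₈.searchOk 8 [0xc0, 0x18] [(7, [6, 5, 4, 3, 2, 1, 0], 0)] = true := by
  decide +kernel

/-- The tables for the type `F_4`. -/
def dataF₄ : SearchData := searchData 4
  [0x1000, 0x100, 0x10, 0x1, 0x1110, 0x210, 0x111, 0x2210, 0x1211, 0x221, 0x2221, 0x1321, 0x2421,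
   0x2432]
  [0x1100, 0x110, 0x11, 0x1210, 0x1111, 0x211, 0x2211, 0x1221, 0x2321, 0x2431]
  0x6344000036240000436300004436
  0x6344000036240000428200004428
  0

theorem isRootTableF₄ : dataF₄.IsRootTable typeF₄ :=
  SearchData.isRootTable_of_tablesOk (by decide +kernel) (by decide) (by decide) (by decide +kernel)
    (by decide +kernel) (by decide +kernel)

theorem hasChangeF₄ : dataF₄.HasChange typeF₄ :=
  isRootTableF₄.hasChange (by decide) (by decide +kernel) (by decide +kernel) (Or.inl rfl)

theorem hasFormF₄ : dataF₄.HasForm typeF₄ ![2, 2, 1, 1] :=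
  ⟨by decide +kernel, by decide +kernel, by decide +kernel⟩

theorem mirrorOkF₄_0 : dataF₄.mirrorOk 4 0
    0x1000001000100000010010000000100fffffdbcf = true := by
  decide +kernel

theorem mirrorOkF₄_3 : dataF₄.mirrorOk 4 3
    0xfffffecdf100000010010000000101000000001 = true := by
  decide +kernel

theorem searchOkF₄ : dataF₄.searchOk 4 []
    [(1, [0, 2, 3], 0), (2, [3, 1, 0], 0)] = true := by
  decide +kernel

/-- The tables for the type `G_2`. -/
def dataG₂ : SearchData := searchData 2
  [0x10, 0x1, 0x21, 0x32]
  [0x11, 0x31]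
  0x6100000036
  -- Both places of `G_2` are settled by odd elements `w₀ w_J`; no search is made and no form is
  -- needed.
  0x0
  0

theorem isRootTableG₂ : dataG₂.IsRootTable typeG₂ :=
  SearchData.isRootTable_of_tablesOk (by decide +kernel) (by decide) (by decide) (by decide +kernel)
    (by decide +kernel) (by decide +kernel)

theorem hasChangeG₂ : dataG₂.HasChange typeG₂ :=
  isRootTableG₂.hasChange (by decide) (by decide +kernel) (by decide +kernel) (Or.inl rfl)

theorem mirrorOkG₂_0 : dataG₂.mirrorOk 2 0
    0x10000000100fffffffcf = true := by
  decide +kernel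

theorem mirrorOkG₂_1 : dataG₂.mirrorOk 2 1
    0xfffffffef1000000001 = true := by
  decide +kernel

end NilpotentToda

/-! ### Conclusions for the exceptional types -/

namespace NilpotentToda

variable {l : ℕ}

namespace SearchData

variable {D : SearchData} {X : CartanDatum l} {d : Fin l → ℤ}

theorem IsRootTable.abs_detSum_oddReps (hD : D.IsRootTable X) (hX : D.HasChange X)
    (hF : D.HasForm X d) {L : List (ℕ × List ℕ × ℕ)} (h : D.searchOk l [] L = true) {k : Fin l}
    {o : List ℕ} {z : ℕ} (hk : (↑k, o, z) ∈ L) (ho : o.Nodup) (hok : ∀ j ∈ o, j < l ∧ j ≠ k)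
    (hko : ∀ j : Fin l, j ≠ k → ↑j ∈ o) : |detSum (oddReps X (D.posRoots l) k)| = z := by
  have := hD.abs_detSum_of_searchOk hX hF h hk ho hok hko (by simp)
  simpa using this

theorem IsRootTable.index_simpleRoot (hD : D.IsRootTable X) (i : Fin l) :
    D.index (simpleRoot i : RootLattice l) = D.codes.idxOf (16 ^ (i : ℕ)) := by
  rw [← rootVec_sixteen_pow, hD.index_rootVec (List.mem_append_left _ (hD.simple i))]

/-- A positive root is determined by its number, so meeting the mask of an edge is the same as
`MeetsEdge`. By the cancellation for two orthogonal edges the restricted sum equals the full one. -/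
theorem IsRootTable.abs_detSum_oddReps_of_edges (hD : D.IsRootTable X) (hX : D.HasChange X)
    (hF : D.HasForm X d) {a b a' b' : Fin l} (hab : X.mat a b = -1)
    (hba : X.mat b a = -1) (hab' : X.mat a' b' = -1) (hba' : X.mat b' a' = -1)
    (horth : X.mat a a' = 0 ∧ X.mat a b' = 0 ∧ X.mat b a' = 0 ∧ X.mat b b' = 0) {m m' : ℕ}
    (hm : ∀ r, m.testBit r = true ↔
      r = D.codes.idxOf (16 ^ (a : ℕ)) ∨ r = D.codes.idxOf (16 ^ (b : ℕ)))
    (hm' : ∀ r, m'.testBit r = true ↔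
      r = D.codes.idxOf (16 ^ (a' : ℕ)) ∨ r = D.codes.idxOf (16 ^ (b' : ℕ)))
    {L : List (ℕ × List ℕ × ℕ)} (h : D.searchOk l [m, m'] L = true) {k : Fin l}
    {o : List ℕ} {z : ℕ} (hk : (↑k, o, z) ∈ L) (ho : o.Nodup) (hok : ∀ j ∈ o, j < l ∧ j ≠ k)
    (hko : ∀ j : Fin l, j ≠ k → ↑j ∈ o) : |detSum (oddReps X (D.posRoots l) k)| = z := by
  have hP := hD.isPositiveSystem
  have key : ∀ {m : ℕ} {a b : Fin l}, (∀ r, m.testBit r = true ↔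
      r = D.codes.idxOf (16 ^ (a : ℕ)) ∨ r = D.codes.idxOf (16 ^ (b : ℕ))) →
      ∀ w ∈ oddReps X (D.posRoots l) k,
      ((∃ j, j ≠ k ∧ m.testBit (D.index (w (simpleRoot j))) = true) ↔ MeetsEdge k a b w) := by
    intro m a b hm w hw
    refine exists_congr fun j => and_congr_right fun hj => ?_
    rw [hm, ← hD.index_simpleRoot, ← hD.index_simpleRoot]
    have hinj : ∀ i, D.index (w (simpleRoot j)) = D.index (simpleRoot i : RootLattice l) ↔
        w (simpleRoot j) = simpleRoot i := fun i => by
      refine ⟨fun h => ?_, fun h => by rw [h]⟩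
      rw [← hD.root_index (hw.2 j hj).1, h, hD.root_index (hP.simple_mem i)]
    rw [hinj, hinj]
  have hneeds : ∀ {m : ℕ} {a b : Fin l}, a ≠ b → (∀ r, m.testBit r = true ↔
      r = D.codes.idxOf (16 ^ (a : ℕ)) ∨ r = D.codes.idxOf (16 ^ (b : ℕ))) →
      ∃ j, j ≠ k ∧ m.testBit (D.index (simpleRoot j : RootLattice l)) = true := by
    intro m a b hne hm
    by_cases hak : a = k
    · refine ⟨b, fun h => hne (hak.trans h.symm), ?_⟩
      rw [hm, hD.index_simpleRoot]; exact Or.inr rfl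
    · refine ⟨a, hak, ?_⟩
      rw [hm, hD.index_simpleRoot]; exact Or.inl rfl
  have hne : ∀ {a b : Fin l}, X.mat a b = -1 → a ≠ b := by
    rintro a _ h rfl
    rw [X.diag] at h
    norm_num at h
  have h1 := hD.abs_detSum_of_searchOk hX hF h hk ho hok hko (by
    intro x hx
    simp only [List.mem_cons, List.not_mem_nil, or_false] at hx
    rcases hx with rfl | rfl
    · exact hneeds (hne hab) hm
    · exact hneeds (hne hab') hm')
  have h2 := hP.detSum_meetsEdge (k := k) hD.finite_weylGroup hab hba hab' hba' horth
  rw [← h1, ← h2]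
  congr 2
  ext w
  simp only [Set.mem_ofPred_eq, List.mem_cons, List.not_mem_nil, or_false, forall_eq_or_imp,
    forall_eq, and_assoc]
  refine and_congr_right fun hw => ?_
  rw [key hm w hw, key hm' w hw]

end SearchData

/-- The type has no edges from the top cell and is orientable. -/
theorem not_topEdge_and_orientable {X : CartanDatum l} {P : Set (RootLattice l)}
    (hP : IsPositiveSystem X P) (h : ∀ k, detSum (oddReps X P k) = 0) :
    (∀ k, ¬ TopEdge X k) ∧ Orientable X := by
  have h1 : ∀ k, ¬ TopEdge X k := fun k => by
    rw [TopEdge, hP.incidence_eq, h]; simp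
  exact ⟨h1, orientable_of_not_topEdge h1⟩

theorem eq_zero_of_abs_eq_natCast_zero {n : ℤ} (h : |n| = (0 : ℕ)) : n = 0 := by
  simpa using h

theorem typeE₇_top : (∀ k, ¬ TopEdge typeE₇ k) ∧ Orientable typeE₇ := by
  refine not_topEdge_and_orientable isRootTableE₇.isPositiveSystem fun k => ?_
  have hm := fun (k : Fin 7) {v : ℕ} (h : dataE₇.mirrorOk 7 k v = true) =>
    isRootTableE₇.detSum_eq_zero_of_mirrorOk hasChangeE₇ h
  have hs := fun (k : Fin 7) {o : List ℕ} hk ho hok hko => eq_zero_of_abs_eq_natCast_zero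
    (isRootTableE₇.abs_detSum_oddReps hasChangeE₇ hasFormE₇ searchOkE₇ (k := k) (o := o) hk ho hok
      hko)
  match k with
  | 0 => exact hm 0 mirrorOkE₇_0
  | 1 => exact hs 1 List.mem_cons_self (by decide) (by decide) (by decide)
  | 2 => exact hs 2 (List.mem_cons_of_mem _ List.mem_cons_self) (by decide) (by decide) (by decide)
  | 3 => exact hm 3 mirrorOkE₇_3
  | 4 => exact hm 4 mirrorOkE₇_4
  | 5 => exact hm 5 mirrorOkE₇_5
  | 6 =>
    exact hs 6 (List.mem_cons_of_mem _ (List.mem_cons_of_mem _ List.mem_cons_self)) (by decide)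
      (by decide) (by decide)

theorem typeE₈_top : (∀ k, ¬ TopEdge typeE₈ k) ∧ Orientable typeE₈ := by
  refine not_topEdge_and_orientable isRootTableE₈.isPositiveSystem fun k => ?_
  have hm := fun (k : Fin 8) {v : ℕ} (h : dataE₈.mirrorOk 8 k v = true) =>
    isRootTableE₈.detSum_eq_zero_of_mirrorOk hasChangeE₈ h
  have hbits : ∀ a b r : ℕ, (2 ^ a ||| 2 ^ b).testBit r = true ↔ r = a ∨ r = b := by
    intro a b r
    rw [Nat.testBit_or, Nat.testBit_two_pow, Nat.testBit_two_pow, Bool.or_eq_true,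
      decide_eq_true_eq, decide_eq_true_eq]
    omega
  -- Written as unions of powers of 2 the masks show their elements; they evaluate to the numbers
  -- `0xc0` and `0x18` of the certificates.
  have hs := fun (k : Fin 8) {o : List ℕ}
      (h : dataE₈.searchOk 8 [2 ^ 7 ||| 2 ^ 6, 2 ^ 4 ||| 2 ^ 3] [(k.val, o, 0)] = true)
      ho hok hko => eq_zero_of_abs_eq_natCast_zero
    (isRootTableE₈.abs_detSum_oddReps_of_edges hasChangeE₈ hasFormE₈
      (a := 0) (b := 1) (a' := 3) (b' := 4) (by decide) (by decide) (by decide) (by decide)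
      (by decide) (hbits 7 6) (hbits 4 3) h List.mem_cons_self ho hok hko)
  match k with
  | 0 => exact hm 0 mirrorOkE₈_0
  | 1 => exact hm 1 mirrorOkE₈_1
  | 2 => exact hm 2 mirrorOkE₈_2
  | 3 => exact hs 3 searchOkE₈_3 (by decide) (by decide) (by decide)
  | 4 => exact hs 4 searchOkE₈_4 (by decide) (by decide) (by decide)
  | 5 => exact hs 5 searchOkE₈_5 (by decide) (by decide) (by decide)
  | 6 => exact hs 6 searchOkE₈_6 (by decide) (by decide) (by decide)
  | 7 => exact hs 7 searchOkE₈_7 (by decide) (by decide) (by decide)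

theorem typeF₄_top : (∀ k, ¬ TopEdge typeF₄ k) ∧ Orientable typeF₄ := by
  refine not_topEdge_and_orientable isRootTableF₄.isPositiveSystem fun k => ?_
  have hm := fun (k : Fin 4) {v : ℕ} (h : dataF₄.mirrorOk 4 k v = true) =>
    isRootTableF₄.detSum_eq_zero_of_mirrorOk hasChangeF₄ h
  have hs := fun (k : Fin 4) {o : List ℕ} hk ho hok hko => eq_zero_of_abs_eq_natCast_zero
    (isRootTableF₄.abs_detSum_oddReps hasChangeF₄ hasFormF₄ searchOkF₄ (k := k) (o := o) hk ho hok
      hko)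
  match k with
  | 0 => exact hm 0 mirrorOkF₄_0
  | 1 => exact hs 1 List.mem_cons_self (by decide) (by decide) (by decide)
  | 2 => exact hs 2 (List.mem_cons_of_mem _ List.mem_cons_self) (by decide) (by decide) (by decide)
  | 3 => exact hm 3 mirrorOkF₄_3

theorem typeG₂_top : (∀ k, ¬ TopEdge typeG₂ k) ∧ Orientable typeG₂ := by
  refine not_topEdge_and_orientable isRootTableG₂.isPositiveSystem fun k => ?_
  have hm := fun (k : Fin 2) {v : ℕ} (h : dataG₂.mirrorOk 2 k v = true) =>
    isRootTableG₂.detSum_eq_zero_of_mirrorOk hasChangeG₂ h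
  match k with
  | 0 => exact hm 0 mirrorOkG₂_0
  | 1 => exact hm 1 mirrorOkG₂_1

theorem typeE₆_top : (∀ k : Fin 6, TopEdge typeE₆ k ↔ (k.val = 0 ∨ k.val = 4)) ∧
    (∀ k : Fin 6, (k.val = 0 ∨ k.val = 4) → incidence typeE₆ k = 6) ∧ Nonorientable typeE₆ := by
  have h : ∀ k : Fin 6, incidence typeE₆ k = if k.val = 0 ∨ k.val = 4 then 6 else 0 := by
    intro k
    have hs := fun (k : Fin 6) (o : List ℕ) (z : ℕ) hk
        (h : o.Nodup ∧ (∀ j ∈ o, j < 6 ∧ j ≠ k) ∧ ∀ j : Fin 6, j ≠ k → ↑j ∈ o) =>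
      isRootTableE₆.abs_detSum_oddReps hasChangeE₆ hasFormE₆ searchOkE₆ (z := z) hk h.1 h.2.1 h.2.2
    rw [isRootTableE₆.isPositiveSystem.incidence_eq]
    match k with
    | 0 => rw [hs 0 [5, 2, 3, 1, 4] 6 (by decide) (by decide)]; rfl
    | 1 => rw [hs 1 [5, 2, 3, 4, 0] 0 (by decide) (by decide)]; rfl
    | 2 => rw [hs 2 [4, 3, 1, 0, 5] 0 (by decide) (by decide)]; rfl
    | 3 => rw [hs 3 [5, 2, 1, 0, 4] 0 (by decide) (by decide)]; rfl
    | 4 => rw [hs 4 [5, 2, 3, 1, 0] 6 (by decide) (by decide)]; rfl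
    | 5 => rw [hs 5 [4, 3, 2, 1, 0] 0 (by decide) (by decide)]; rfl
  have h1 : ∀ k : Fin 6, TopEdge typeE₆ k ↔ (k.val = 0 ∨ k.val = 4) := fun k => by
    rw [TopEdge, h]
    split_ifs with h0
    · exact iff_of_true (by norm_num) h0
    · exact iff_of_false (by norm_num) h0
  exact ⟨h1, fun k hk => by rw [h, if_pos hk], nonorientable_of_topEdge ((h1 0).mpr (Or.inl rfl))⟩

end NilpotentToda

namespace NilpotentToda

variable {l n : ℕ}

/-! ### Signed permutations -/

/-- A signed permutation of `n` coordinates: `(f, η)` maps the unit vector `e_i` to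
`η (f i) e_{f i}`. -/
abbrev SignedPerm (n : ℕ) : Type := Equiv.Perm (Fin n) × (Fin n → ℤˣ)

namespace SignedPerm

/-- The action on vectors. -/
def act (p : SignedPerm n) (x : Fin n → ℤ) : Fin n → ℤ := fun a => p.2 a * x (p.1.symm a)

/-- The composition of signed permutations. -/
def comp (p q : SignedPerm n) : SignedPerm n := (p.1 * q.1, fun a => p.2 a * q.2 (p.1.symm a))

/-- The determinant. -/
def chi (p : SignedPerm n) : ℤ := ((Equiv.Perm.sign p.1 * ∏ a, p.2 a : ℤˣ) : ℤ)

theorem act_comp (p q : SignedPerm n) (x : Fin n → ℤ) :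
    (p.comp q).act x = p.act (q.act x) := by
  funext a
  simp [act, comp, mul_assoc, Equiv.Perm.mul_def]

theorem act_one (x : Fin n → ℤ) : act ((1, 1) : SignedPerm n) x = x := by
  funext a
  change ((1 : ℤˣ) : ℤ) * x a = x a
  rw [Units.val_one, one_mul]

theorem chi_comp (p q : SignedPerm n) : (p.comp q).chi = p.chi * q.chi := by
  have h : ∏ a, q.2 (p.1.symm a) = ∏ a, q.2 a := Equiv.prod_comp p.1.symm q.2
  simp only [chi, comp, Equiv.Perm.sign_mul, Finset.prod_mul_distrib, h]
  push_cast
  ring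

theorem chi_one : chi ((1, 1) : SignedPerm n) = 1 := by simp [chi]

theorem sum_sq_act (p : SignedPerm n) (x : Fin n → ℤ) :
    ∑ a, (p.act x a) ^ 2 = ∑ a, x a ^ 2 := by
  rw [← Equiv.sum_comp p.1.symm fun a => x a ^ 2]
  refine Finset.sum_congr rfl fun a _ => ?_
  rw [act, mul_pow, ← Units.val_pow_eq_pow_val, Int.units_sq, Units.val_one, one_mul]

theorem act_single (p : SignedPerm n) (i : Fin n) (c : ℤ) :
    p.act (Pi.single i c) = Pi.single (p.1 i) (p.2 (p.1 i) * c) := by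
  funext a
  rw [act, Pi.single_apply, Pi.single_apply]
  by_cases h : a = p.1 i
  · subst h; simp
  · rw [if_neg h, if_neg fun h' => h (by rw [← h', Equiv.apply_symm_apply]), mul_zero]

theorem act_sub (p : SignedPerm n) (x y : Fin n → ℤ) : p.act (x - y) = p.act x - p.act y := by
  funext a; simp [act, mul_sub]

theorem act_add (p : SignedPerm n) (x y : Fin n → ℤ) : p.act (x + y) = p.act x + p.act y := by
  funext a; simp [act, mul_add]

end SignedPerm

/-- The first nonzero coordinate is positive. -/
def LexPos (x : Fin n → ℤ) : Prop := ∃ a, (∀ b < a, x b = 0) ∧ 0 < x a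

theorem lexPos_or_neg {x : Fin n → ℤ} (hx : x ≠ 0) : LexPos x ∨ LexPos (-x) := by
  have h : (Finset.univ.filter fun a => x a ≠ 0).Nonempty := by
    by_contra h
    rw [Finset.not_nonempty_iff_eq_empty, Finset.filter_eq_empty_iff] at h
    exact hx (funext fun a => not_not.mp (h (Finset.mem_univ a)))
  set a := (Finset.univ.filter fun a => x a ≠ 0).min' h
  have ha : x a ≠ 0 := (Finset.mem_filter.mp (Finset.min'_mem _ h)).2
  have hb : ∀ b < a, x b = 0 := fun b hb => by
    by_contra hxb
    exact absurd (Finset.min'_le _ b (by simpa using hxb)) (not_le.mpr hb)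
  rcases lt_or_gt_of_ne ha with h0 | h0
  · exact Or.inr ⟨a, fun b h => by simp [hb b h], by simpa using h0⟩
  · exact Or.inl ⟨a, hb, h0⟩

/-- A description of the simple roots by vectors in `ℤ ^ n`, such that the Weyl group becomes a
group `G` of signed permutations. -/
structure SignedModel (X : CartanDatum l) (n : ℕ) where
  /-- the simple roots -/
  root : Fin l → Fin n → ℤ
  /-- the simple reflections -/
  refl : Fin l → SignedPerm n
  /-- the Weyl group -/
  G : Set (SignedPerm n)
  /-- the roots -/
  roots : Set (Fin n → ℤ)
  /-- multiples of the fundamental coweights -/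
  coef : Fin l → Fin n → ℤ
  /-- the factors in these multiples -/
  mult : Fin l → ℤ
  mult_pos : ∀ t, 0 < mult t
  coef_root : ∀ t j, ∑ a, coef t a * root j a = if j = t then mult t else 0
  coef_nonneg : ∀ x ∈ roots, LexPos x → ∀ t, 0 ≤ ∑ a, coef t a * x a
  root_mem : ∀ i, root i ∈ roots
  root_pos : ∀ i, LexPos (root i)
  act_mem : ∀ p ∈ G, ∀ x ∈ roots, p.act x ∈ roots
  neg_mem : ∀ x ∈ roots, -x ∈ roots
  zero_notMem : (0 : Fin n → ℤ) ∉ roots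
  -- Ensures that `α_i` is the only positive root which `s_i` makes negative.
  multiple : ∀ i (m : ℤ), m • root i ∈ roots → m ≤ 1
  refl_mem : ∀ i, refl i ∈ G
  refl_chi : ∀ i, (refl i).chi = -1
  refl_act : ∀ i j, (refl i).act (root j) = root j - X.mat j i • root i
  comp_mem : ∀ p ∈ G, ∀ q ∈ G, p.comp q ∈ G
  one_mem : (1, 1) ∈ G
  -- Generation by the simple reflections, phrased as an induction principle because `SignedPerm`
  -- carries only `comp` and no group structure.
  generated : ∀ p ∈ G, ∀ R : Set (SignedPerm n), (1, 1) ∈ R →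
    (∀ q ∈ R, ∀ r ∈ R, q.comp r ∈ R) → (∀ i, refl i ∈ R) → p ∈ R
  faithful : ∀ p ∈ G, ∀ q ∈ G, (∀ j, p.act (root j) = q.act (root j)) → p = q

namespace SignedModel

variable {X : CartanDatum l} (M : SignedModel X n)

/-- The embedding of the root lattice. -/
def E : RootLattice l →ₗ[ℤ] (Fin n → ℤ) := Fintype.linearCombination ℤ M.root

theorem E_apply (v : RootLattice l) : M.E v = ∑ j, v j • M.root j :=
  Fintype.linearCombination_apply ℤ M.root v

theorem E_simpleRoot (i : Fin l) : M.E (simpleRoot i) = M.root i := by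
  simp [E_apply, simpleRoot_apply]

theorem sum_mul_E (c : Fin n → ℤ) (v : RootLattice l) :
    ∑ a, c a * M.E v a = ∑ j, v j * ∑ a, c a * M.root j a := by
  simp only [E_apply, Finset.sum_apply, Pi.smul_apply, smul_eq_mul, Finset.mul_sum]
  rw [Finset.sum_comm]
  exact Finset.sum_congr rfl fun j _ => Finset.sum_congr rfl fun a _ => by ring

theorem sum_coef_E (t : Fin l) (v : RootLattice l) :
    ∑ a, M.coef t a * M.E v a = v t * M.mult t := by
  rw [sum_mul_E]
  simp [M.coef_root]

theorem injective : Function.Injective M.E := fun v w h => by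
  funext t
  have := M.sum_coef_E t v
  rw [h, M.sum_coef_E] at this
  exact (mul_right_cancel₀ (M.mult_pos t).ne' this).symm

theorem nonneg (v : RootLattice l) (h : M.E v ∈ M.roots) (h' : LexPos (M.E v)) (j : Fin l) :
    0 ≤ v j := by
  have := M.coef_nonneg _ h h' j
  rw [sum_coef_E] at this
  exact nonneg_of_mul_nonneg_left this (M.mult_pos j)

theorem act_E (p : SignedPerm n) (v : RootLattice l) :
    p.act (M.E v) = ∑ j, v j • p.act (M.root j) := by
  funext a
  simp only [SignedPerm.act, E_apply, Finset.sum_apply, Pi.smul_apply, smul_eq_mul, Finset.mul_sum]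
  exact Finset.sum_congr rfl fun j _ => by ring

theorem E_simpleReflection (i : Fin l) (v : RootLattice l) :
    M.E (simpleReflection X i v) = (M.refl i).act (M.E v) := by
  rw [act_E]
  conv_lhs => rw [eq_sum_simpleRoot v]
  simp only [map_sum, map_smul, simpleReflection_simpleRoot, map_sub, E_simpleRoot, M.refl_act]

theorem exists_weyl {p : SignedPerm n} (hp : p ∈ M.G) :
    ∃ w ∈ weylGroup X, ∀ v, M.E (w v) = p.act (M.E v) := by
  refine M.generated p hp {p | ∃ w ∈ weylGroup X, ∀ v, M.E (w v) = p.act (M.E v)}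
    ⟨1, (weylGroup X).one_mem, fun v => by rw [SignedPerm.act_one]; rfl⟩ ?_
    fun i => ⟨_, simpleReflection_mem_weylGroup X i, M.E_simpleReflection i⟩
  rintro q ⟨w, hw, h⟩ r ⟨u, hu, h'⟩
  exact ⟨w * u, mul_mem hw hu, fun v => by
    rw [LinearEquiv.mul_apply, h, h', SignedPerm.act_comp]⟩

/-- The positive roots. -/
def posRoots : Set (RootLattice l) := {v | M.E v ∈ M.roots ∧ LexPos (M.E v)}

/-- If `s_i v` is not lexicographically positive, then `v` and `-s_i v` both have nonnegative
coordinates. Away from `i` these coordinates are opposite, so `v` is a multiple of `α_i`, hence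
`α_i` itself. -/
theorem isPositiveSystem : IsPositiveSystem X M.posRoots where
  simple_mem i := by
    rw [posRoots, Set.mem_ofPred_eq, E_simpleRoot]
    exact ⟨M.root_mem i, M.root_pos i⟩
  nonneg v hv := M.nonneg v hv.1 hv.2
  ne_zero v hv := by
    rintro rfl
    have := hv.1
    rw [map_zero] at this
    exact M.zero_notMem this
  reflection_mem := by
    intro v hv i hi
    have hmem : M.E (simpleReflection X i v) ∈ M.roots := by
      rw [E_simpleReflection]; exact M.act_mem _ (M.refl_mem i) _ hv.1
    refine ⟨hmem, (lexPos_or_neg fun h => M.zero_notMem (h ▸ hmem)).resolve_right fun h => hi ?_⟩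
    rw [← map_neg] at h
    have h1 := M.nonneg _ (by rw [map_neg]; exact M.neg_mem _ hmem) h
    have h2 := M.nonneg v hv.1 hv.2
    have h3 : ∀ j, j ≠ i → v j = 0 := fun j hj => by
      have := h1 j
      rw [simpleReflection_apply] at this
      simp only [Pi.neg_apply, Pi.sub_apply, Pi.smul_apply, simpleRoot_apply, if_neg hj,
        smul_zero, sub_zero] at this
      have := h2 j
      omega
    have h4 : v = v i • simpleRoot i := by
      funext j
      rw [Pi.smul_apply, simpleRoot_apply]
      by_cases hj : j = i
      · subst hj; simp
      · rw [if_neg hj, h3 j hj]; simp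
    have h5 := M.multiple i (v i) (by rw [← E_simpleRoot, ← map_smul, ← h4]; exact hv.1)
    have h6 : v i ≠ 0 := fun h0 => by
      rw [h0, zero_smul] at h4
      have := hv.1
      rw [h4, map_zero] at this
      exact M.zero_notMem this
    have h7 : v i = 1 := by have := h2 i; omega
    rw [h4, h7, one_smul]

theorem exists_signedPerm {w : RootLattice l ≃ₗ[ℤ] RootLattice l} (hw : w ∈ weylGroup X) :
    ∃ p ∈ M.G, p.chi = detZ w ∧ ∀ v, M.E (w v) = p.act (M.E v) := by
  obtain ⟨L, rfl⟩ := (mem_weylGroup_iff X w).mp hw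
  induction L with
  | nil => exact ⟨(1, 1), M.one_mem, by rw [SignedPerm.chi_one, wordProd_nil, detZ_one],
      fun v => by rw [SignedPerm.act_one]; rfl⟩
  | cons i L ih =>
    obtain ⟨q, hq, hqd, hqE⟩ := ih (wordProd_mem_weylGroup X L)
    refine ⟨(M.refl i).comp q, M.comp_mem _ (M.refl_mem i) q hq, ?_, fun v => ?_⟩
    · rw [SignedPerm.chi_comp, M.refl_chi, hqd, wordProd_cons, detZ_mul, detZ_simpleReflection]
    · rw [wordProd_cons, LinearEquiv.mul_apply, E_simpleReflection, hqE, SignedPerm.act_comp]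

open Classical in
/-- The signed permutations that map the simple roots, except for `α_k`, to positive roots of odd
height; the property `H` expresses that the height is odd. -/
noncomputable def oddPerms (H : (Fin n → ℤ) → Prop) (k : Fin l) : Finset (SignedPerm n) :=
  Finset.univ.filter fun p => p ∈ M.G ∧ ∀ j, j ≠ k →
    LexPos (p.act (M.root j)) ∧ H (p.act (M.root j))

/-- Transport along the bijection between the Weyl group and `G`: faithfulness makes it injective on
one side, injectivity of `E` on the other, and determinants correspond because they agree on simple
reflections. -/
theorem detSum_eq (H : (Fin n → ℤ) → Prop) (hH : ∀ v, Odd (height v) ↔ H (M.E v)) (k : Fin l) :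
    detSum (oddReps X M.posRoots k) = ∑ p ∈ M.oddPerms H k, p.chi := by
  classical
  have hex : ∀ w : RootLattice l ≃ₗ[ℤ] RootLattice l, ∃ p : SignedPerm n, w ∈ weylGroup X →
      p ∈ M.G ∧ p.chi = detZ w ∧ ∀ v, M.E (w v) = p.act (M.E v) := fun w => by
    by_cases hw : w ∈ weylGroup X
    · obtain ⟨p, h⟩ := M.exists_signedPerm hw
      exact ⟨p, fun _ => h⟩
    · exact ⟨(1, 1), fun h => absurd h hw⟩
  choose φ hφ using hex
  have hcond : ∀ w, w ∈ weylGroup X → ∀ p : SignedPerm n, (∀ v, M.E (w v) = p.act (M.E v)) →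
      p ∈ M.G → (w ∈ oddReps X M.posRoots k ↔ p ∈ M.oddPerms H k) := by
    intro w hw p hp hpG
    simp only [oddReps, oddPerms, Set.mem_ofPred_eq, Finset.mem_filter, Finset.mem_univ, true_and,
      hw, hpG]
    refine forall_congr' fun j => forall_congr' fun _ => ?_
    rw [hH, hp, E_simpleRoot]
    refine and_congr_left fun _ => ?_
    exact ⟨fun h => by rw [← E_simpleRoot, ← hp]; exact h.2, fun h =>
      ⟨by rw [hp, E_simpleRoot]; exact M.act_mem p hpG _ (M.root_mem j),
        by rwa [hp, E_simpleRoot]⟩⟩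
  rw [detSum, ← finsum_mem_coe_finset]
  refine finsum_mem_eq_of_bijOn φ ⟨?_, ?_, ?_⟩ fun w hw => (hφ w hw.1).2.1.symm
  · intro w hw
    obtain ⟨h1, -, h2⟩ := hφ w hw.1
    exact Finset.mem_coe.mpr ((hcond w hw.1 _ h2 h1).mp hw)
  · intro w hw w' hw' h
    obtain ⟨-, -, h2⟩ := hφ w hw.1
    obtain ⟨-, -, h2'⟩ := hφ w' hw'.1
    refine LinearEquiv.ext fun v => M.injective ?_
    rw [h2, h2', h]
  · intro p hp
    have hpG := (Finset.mem_filter.mp (Finset.mem_coe.mp hp)).2.1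
    obtain ⟨w, hw, hwE⟩ := M.exists_weyl hpG
    obtain ⟨h1, -, h2⟩ := hφ w hw
    refine ⟨w, (hcond w hw p hwE hpG).mpr (Finset.mem_coe.mp hp), ?_⟩
    exact M.faithful _ h1 _ hpG fun j => by rw [← E_simpleRoot, ← h2, ← hwE]

end SignedModel

end NilpotentToda

/-! ### Reflections and generation for signed permutations, and vectors with few entries -/

namespace NilpotentToda

open Equiv (swap)

variable {l n : ℕ}

/-- The sign tuple with `-1` at the places in `D`. -/
def signFlip (D : Finset (Fin n)) : Fin n → ℤˣ := fun a => if a ∈ D then -1 else 1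

theorem prod_signFlip (D : Finset (Fin n)) : ∏ a, signFlip D a = (-1) ^ D.card := by
  simp [signFlip]

namespace SignedPerm

theorem chi_swap {i j : Fin n} (h : i ≠ j) : chi ((swap i j, 1) : SignedPerm n) = -1 := by
  simp [chi, Equiv.Perm.sign_swap h]

theorem chi_signFlip (i : Fin n) : chi ((1, signFlip {i}) : SignedPerm n) = -1 := by
  simp [chi, prod_signFlip]

theorem chi_swap_signFlip {i j : Fin n} (h : i ≠ j) :
    chi ((swap i j, signFlip {i, j}) : SignedPerm n) = -1 := by
  simp [chi, prod_signFlip, Equiv.Perm.sign_swap h, Finset.card_pair h]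

theorem act_swap (i j : Fin n) (x : Fin n → ℤ) :
    act (swap i j, 1) x = x - (x i - x j) • (Pi.single i 1 - Pi.single j 1) := by
  funext a
  simp only [act, Equiv.symm_swap, Equiv.swap_apply_def, Pi.one_apply, Units.val_one, one_mul,
    Pi.sub_apply, Pi.smul_apply, Pi.single_apply, smul_eq_mul]
  split_ifs <;> simp_all

theorem act_signFlip (i : Fin n) (x : Fin n → ℤ) (c d : ℤ) (h : c * d = 2) :
    act (1, signFlip {i}) x = x - (c * x i) • (Pi.single i d : Fin n → ℤ) := by
  funext a
  change ((signFlip {i} a : ℤˣ) : ℤ) * x a = _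
  simp only [signFlip, Finset.mem_singleton, Pi.sub_apply, Pi.smul_apply, Pi.single_apply,
    smul_eq_mul]
  split_ifs with h'
  · subst h'
    push_cast
    linear_combination x a * h
  · simp

theorem act_swap_signFlip {i j : Fin n} (hij : i ≠ j) (x : Fin n → ℤ) :
    act (swap i j, signFlip {i, j}) x =
      x - (x i + x j) • (Pi.single i 1 + Pi.single j 1) := by
  funext a
  simp only [act, Equiv.symm_swap, Equiv.swap_apply_def, signFlip, Finset.mem_insert,
    Finset.mem_singleton, Pi.add_apply, Pi.sub_apply, Pi.smul_apply, Pi.single_apply, smul_eq_mul]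
  split_ifs <;> simp_all

end SignedPerm

section Generation

variable {R : Set (SignedPerm n)} (h1 : (1, 1) ∈ R) (hR : ∀ q ∈ R, ∀ r ∈ R, q.comp r ∈ R)
include h1 hR

theorem perm_mem_of_swap_mem (hs : ∀ i j : Fin n, j.val = i.val + 1 → (swap i j, 1) ∈ R)
    (f : Equiv.Perm (Fin n)) : (f, 1) ∈ R := by
  cases n with
  | zero => rwa [Subsingleton.elim f 1]
  | succ m =>
    have hf : f ∈ Submonoid.closure (Set.range fun i : Fin m => swap i.castSucc i.succ) := by
      rw [Equiv.Perm.mclosure_swap_castSucc_succ]; trivial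
    induction hf using Submonoid.closure_induction with
    | mem x hx =>
      obtain ⟨i, rfl⟩ := hx
      exact hs _ _ (by simp)
    | one => exact h1
    | mul x y _ _ hx hy => exact hR _ hx _ hy

theorem signs_mem_of_prod {ι : Type*} (s : Finset ι) (η : ι → Fin n → ℤˣ)
    (h : ∀ i ∈ s, (1, η i) ∈ R) : (1, ∏ i ∈ s, η i) ∈ R := by
  classical
  induction s using Finset.induction_on with
  | empty => exact h1
  | insert a s ha ih =>
    rw [Finset.prod_insert ha]
    exact hR _ (h a (Finset.mem_insert_self _ _)) _
      (ih fun i hi => h i (Finset.mem_insert_of_mem hi))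

omit h1 in
theorem conj_mem (hp : ∀ f : Equiv.Perm (Fin n), (f, 1) ∈ R) {D : Finset (Fin n)}
    (h : (1, signFlip D) ∈ R) (f : Equiv.Perm (Fin n)) :
    (1, signFlip (D.map f.toEmbedding)) ∈ R := by
  convert hR _ (hR _ (hp f) _ h) _ (hp f⁻¹) using 1
  refine Prod.ext (by simp [SignedPerm.comp]) (funext fun a => ?_)
  simp [SignedPerm.comp, signFlip, Finset.mem_map_equiv]

/-- A vector of signs is a product of changes of one sign, all conjugate under permutations. -/
theorem mem_of_signFlip_mem (hp : ∀ f : Equiv.Perm (Fin n), (f, 1) ∈ R) {a : Fin n}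
    (h : (1, signFlip {a}) ∈ R) (p : SignedPerm n) : p ∈ R := by
  have hη : p.2 = ∏ b with p.2 b = -1, signFlip {b} := by
    funext c
    rw [Finset.prod_apply]
    rcases Int.units_eq_one_or (p.2 c) with hc | hc
    · rw [hc, Finset.prod_eq_one]
      intro b hb
      rw [signFlip, if_neg]
      rintro h
      rw [Finset.mem_singleton] at h
      subst h
      rw [(Finset.mem_filter.mp hb).2] at hc
      exact absurd hc (by decide)
    · rw [hc, Finset.prod_eq_single c]
      · simp [signFlip]
      · intro b _ hb
        simp [signFlip, hb.symm]
      · intro h; simp [hc] at h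
  have key : (1, p.2) ∈ R := by
    rw [hη]
    refine signs_mem_of_prod h1 hR _ _ fun b _ => ?_
    simpa using conj_mem hR hp h (swap a b)
  convert hR _ key _ (hp p.1) using 1
  exact Prod.ext (by simp [SignedPerm.comp]) (by simp [SignedPerm.comp])

/-- With total sign 1, every place with a minus sign other than `z` is paired with `z`. The sign at
`z` then comes out right because both sides have the same product. -/
theorem mem_of_signFlip_pair_mem (hp : ∀ f : Equiv.Perm (Fin n), (f, 1) ∈ R) {a z : Fin n}
    (haz : a ≠ z) (h : (1, signFlip {a, z}) ∈ R) (p : SignedPerm n) (hpp : ∏ b, p.2 b = 1) :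
    p ∈ R := by
  have hη : p.2 = ∏ b with p.2 b = -1 ∧ b ≠ z, signFlip {b, z} := by
    have h0 : ∀ c, c ≠ z → p.2 c = (∏ b with p.2 b = -1 ∧ b ≠ z, signFlip {b, z}) c := by
      intro c hcz
      rw [Finset.prod_apply]
      rcases Int.units_eq_one_or (p.2 c) with hc | hc
      · rw [hc, Finset.prod_eq_one]
        intro b hb
        rw [signFlip, if_neg]
        rintro h
        rw [Finset.mem_insert, Finset.mem_singleton] at h
        rcases h with rfl | h
        · rw [(Finset.mem_filter.mp hb).2.1] at hc
          exact absurd hc (by decide)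
        · exact hcz h
      · rw [hc, Finset.prod_eq_single c]
        · simp [signFlip]
        · intro b _ hb
          simp [signFlip, hb.symm, hcz]
        · intro h; simp [hc, hcz] at h
    have h2 : ∏ c, (∏ b with p.2 b = -1 ∧ b ≠ z, signFlip {b, z}) c = 1 := by
      simp_rw [Finset.prod_apply]
      rw [Finset.prod_comm]
      refine Finset.prod_eq_one fun b hb => ?_
      rw [prod_signFlip, Finset.card_pair (Finset.mem_filter.mp hb).2.2]
      rfl
    funext c
    by_cases hc : c = z
    · subst hc
      rw [← Finset.mul_prod_erase _ _ (Finset.mem_univ c)] at hpp h2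
      rw [Finset.prod_congr rfl fun b hb => (h0 b (Finset.ne_of_mem_erase hb)).symm] at h2
      exact mul_right_cancel (hpp.trans h2.symm)
    · exact h0 c hc
  have key : (1, p.2) ∈ R := by
    rw [hη]
    refine signs_mem_of_prod h1 hR _ _ fun b hb => ?_
    have hbz := (Finset.mem_filter.mp hb).2.2
    have := conj_mem hR hp h (swap a b)
    rwa [Finset.map_insert, Finset.map_singleton, Equiv.coe_toEmbedding, Equiv.swap_apply_left,
      Equiv.swap_apply_of_ne_of_ne haz.symm hbz.symm] at this
  convert hR _ key _ (hp p.1) using 1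
  exact Prod.ext (by simp [SignedPerm.comp]) (by simp [SignedPerm.comp])

end Generation

/-- For integers `c x + x ^ 2 ≥ 0` when `|c| ≤ 1`, so the sum of these terms is at least its term at
`a₀`, which by hypothesis already reaches the squared norm. In the other case `c` vanishes where `x`
does not. It gives nonnegative coordinates of positive roots for all classical types at once. -/
theorem sum_mul_nonneg_of_lexPos {x : Fin n → ℤ} {a₀ : Fin n} (hz : ∀ b < a₀, x b = 0)
    (h : ∑ a, x a ^ 2 ≤ x a₀ + x a₀ ^ 2) {c : Fin n → ℤ} (hc : ∀ a, -1 ≤ c a ∧ c a ≤ 1)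
    (h0 : c a₀ = 1 ∨ ∀ a, a₀ ≤ a → c a = 0) : 0 ≤ ∑ a, c a * x a := by
  rcases h0 with h0 | h0
  · have hterm : ∀ a, 0 ≤ c a * x a + x a ^ 2 := fun a => by
      obtain ⟨h1, h2⟩ := hc a
      rcases lt_trichotomy (x a) 0 with hx | hx | hx
      · nlinarith
      · simp [hx]
      · nlinarith
    have := Finset.single_le_sum (f := fun a => c a * x a + x a ^ 2) (fun a _ => hterm a)
      (Finset.mem_univ a₀)
    rw [Finset.sum_add_distrib] at this
    simp only [h0, one_mul] at this
    linarith
  · refine (Finset.sum_eq_zero fun a _ => ?_).ge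
    rcases lt_or_ge a a₀ with ha | ha
    · rw [hz a ha, mul_zero]
    · rw [h0 a ha, zero_mul]

theorem sum_mul_single_sub_single (c : Fin n → ℤ) (i j : Fin n) (x y : ℤ) :
    ∑ a, c a * (Pi.single i x - Pi.single j y : Fin n → ℤ) a = c i * x - c j * y := by
  simp [Pi.single_apply, mul_sub, Finset.sum_sub_distrib]

theorem sum_mul_single_add_single (c : Fin n → ℤ) (i j : Fin n) (x y : ℤ) :
    ∑ a, c a * (Pi.single i x + Pi.single j y : Fin n → ℤ) a = c i * x + c j * y := by
  simp [Pi.single_apply, mul_add, Finset.sum_add_distrib]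

theorem sum_mul_single (c : Fin n → ℤ) (i : Fin n) (x : ℤ) :
    ∑ a, c a * (Pi.single i x : Fin n → ℤ) a = c i * x := by
  simp [Pi.single_apply]

theorem sum_sq_single_sub_single {i j : Fin n} (h : i ≠ j) :
    ∑ a, (Pi.single i 1 - Pi.single j 1 : Fin n → ℤ) a ^ 2 = 2 := by
  simp only [sq]
  rw [sum_mul_single_sub_single]
  simp [h, h.symm]

theorem sum_sq_single_add_single {i j : Fin n} (h : i ≠ j) :
    ∑ a, (Pi.single i 1 + Pi.single j 1 : Fin n → ℤ) a ^ 2 = 2 := by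
  simp only [sq]
  rw [sum_mul_single_add_single]
  simp [h, h.symm]

theorem sum_sq_single (i : Fin n) (x : ℤ) :
    ∑ a, (Pi.single i x : Fin n → ℤ) a ^ 2 = x ^ 2 := by
  simp only [sq]
  rw [sum_mul_single]
  simp

theorem sum_sq_smul (m : ℤ) (x : Fin n → ℤ) : ∑ a, (m • x) a ^ 2 = m ^ 2 * ∑ a, x a ^ 2 := by
  rw [Finset.mul_sum]
  exact Finset.sum_congr rfl fun a _ => by rw [Pi.smul_apply, smul_eq_mul]; ring

theorem sum_sq_neg (x : Fin n → ℤ) : ∑ a, (-x) a ^ 2 = ∑ a, x a ^ 2 := by simp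

theorem lexPos_single {i : Fin n} {x : ℤ} (hx : 0 < x) : LexPos (Pi.single i x) :=
  ⟨i, fun b hb => by simp [hb.ne], by simpa⟩

theorem lexPos_single_sub_single {i j : Fin n} (h : i < j) :
    LexPos (Pi.single i 1 - Pi.single j 1) :=
  ⟨i, fun b hb => by simp [hb.ne, (hb.trans h).ne], by simp [h.ne]⟩

theorem lexPos_single_add_single {i j : Fin n} (h : i < j) :
    LexPos (Pi.single i 1 + Pi.single j 1) :=
  ⟨i, fun b hb => by simp [hb.ne, (hb.trans h).ne], by simp [h.ne]⟩

theorem ne_succ {i : Fin l} (h : i.val + 1 < l) : i ≠ ⟨i.val + 1, h⟩ := fun h' => by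
  have := congrArg Fin.val h'
  simp at this

theorem lt_succ {i : Fin l} (h : i.val + 1 < l) : i < ⟨i.val + 1, h⟩ := Nat.lt_succ_self _

theorem single_two_eq {a : Fin l} (ha : a.val + 1 < l) :
    (Pi.single a 2 : Fin l → ℤ) = (Pi.single a 1 - Pi.single ⟨a.val + 1, ha⟩ 1) +
      (Pi.single a 1 - Pi.single ⟨a.val + 1, ha⟩ 1) + Pi.single ⟨a.val + 1, ha⟩ 2 := by
  funext b
  simp only [Pi.single_apply, Pi.add_apply, Pi.sub_apply]
  split_ifs <;> simp

/-- Doubled unit vectors are used because they, unlike the unit vectors, lie in the root lattice for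
all of B, C and D. -/
theorem SignedPerm.ext_of_act_single {p q : SignedPerm n}
    (h : ∀ a, p.act (Pi.single a 2) = q.act (Pi.single a 2)) : p = q := by
  have h1 : ∀ a, p.1 a = q.1 a ∧ p.2 (p.1 a) = q.2 (q.1 a) := fun a => by
    have := h a
    rw [act_single, act_single] at this
    have h2 := congrFun this (p.1 a)
    rw [Pi.single_eq_same] at h2
    by_cases hpq : p.1 a = q.1 a
    · refine ⟨hpq, ?_⟩
      rw [hpq, Pi.single_eq_same] at h2
      rw [hpq]
      exact Units.ext (mul_right_cancel₀ two_ne_zero h2)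
    · rw [Pi.single_eq_of_ne hpq] at h2
      exact absurd h2 (mul_ne_zero (Units.ne_zero _) two_ne_zero)
  have h2 : p.1 = q.1 := Equiv.ext fun a => (h1 a).1
  refine Prod.ext h2 (funext fun b => ?_)
  have := (h1 (p.1.symm b)).2
  rw [Equiv.apply_symm_apply] at this
  rw [this, h2, Equiv.apply_symm_apply]

end NilpotentToda

namespace NilpotentToda

open Equiv (swap)

variable {l : ℕ}

/-! ### The types B and C -/

/-- The simple roots `e_i - e_{i+1}` and `c e_l`. -/
def rootBC (c : ℤ) (i : Fin l) : Fin l → ℤ :=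
  if h : i.val + 1 < l then Pi.single i 1 - Pi.single ⟨i.val + 1, h⟩ 1 else Pi.single i c

/-- The simple reflections of the types B and C. -/
def reflBC (i : Fin l) : SignedPerm l :=
  if h : i.val + 1 < l then (swap i ⟨i.val + 1, h⟩, 1) else (1, signFlip {i})

theorem rootBC_apply (c : ℤ) (i a : Fin l) : rootBC c i a =
    if i.val + 1 < l then (if a = i then 1 else 0) - (if a.val = i.val + 1 then 1 else 0)
      else if a = i then c else 0 := by
  unfold rootBC
  split_ifs <;> simp_all [Pi.single_apply, Fin.ext_iff]

/-- The model of a root system of type B or C. -/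
def modelBC (X : CartanDatum l) (hl : 0 < l) (c d : ℤ) (hc : c = 1 ∨ c = 2) (hcd : c * d = 2)
    (hX : ∀ i j : Fin l, X.mat j i =
      if h : i.val + 1 < l then rootBC c j i - rootBC c j ⟨i.val + 1, h⟩ else d * rootBC c j i) :
    SignedModel X l where
  root := rootBC c
  refl := reflBC
  G := Set.univ
  -- Besides `±e_i ± e_j` this contains `±e_i` if `c = 1` and `±2 e_i` if `c = 2`; divisibility
  -- excludes the other vectors of norm 4.
  roots := {x | ∑ a, x a ^ 2 = 2 ∨ ∑ a, x a ^ 2 = c ^ 2 ∧ ∀ a, c ∣ x a}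
  coef t a := if a ≤ t then 1 else 0
  -- The pairing of `e_1 + … + e_l` with the last root `c e_l` is `c`.
  mult t := if t.val + 1 < l then 1 else c
  mult_pos t := by split_ifs <;> omega
  coef_root t j := by
    unfold rootBC
    split_ifs with h1 h2 h3 h4 h5
    · subst h2; rw [sum_mul_single_sub_single]; simpa using lt_succ h1
    · subst h2; exact absurd h1 h3
    · rw [sum_mul_single_sub_single]
      simp only [Fin.le_def, mul_one]
      have := Fin.val_ne_of_ne h2
      split_ifs <;> omega
    · subst h4; exact absurd h5 h1
    · subst h4; rw [sum_mul_single]; simp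
    · rw [sum_mul_single, if_neg, zero_mul]
      rw [Fin.le_def]
      have := Fin.val_ne_of_ne h4
      omega
  coef_nonneg x hx hpos t := by
    obtain ⟨a₀, hz, ha₀⟩ := hpos
    refine sum_mul_nonneg_of_lexPos hz ?_ (fun a => by split_ifs <;> simp) ?_
    · rcases hx with hx | ⟨hx, hdvd⟩
      · rw [hx]; nlinarith
      · rw [hx]
        have := Int.le_of_dvd ha₀ (hdvd a₀)
        rcases hc with rfl | rfl <;> nlinarith
    · by_cases h : a₀ ≤ t
      · exact Or.inl (if_pos h)
      · exact Or.inr fun a ha => if_neg fun h' => h (ha.trans h')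
  root_mem i := by
    unfold rootBC
    split_ifs with h
    · exact Or.inl (sum_sq_single_sub_single (ne_succ h))
    · refine Or.inr ⟨sum_sq_single i c, fun a => ?_⟩
      rw [Pi.single_apply]; split_ifs <;> simp
  root_pos i := by
    unfold rootBC
    split_ifs with h
    · exact lexPos_single_sub_single (lt_succ h)
    · exact lexPos_single (by omega)
  act_mem p _ x hx := by
    rw [Set.mem_ofPred_eq, SignedPerm.sum_sq_act]
    exact hx.imp id fun h => ⟨h.1, fun a => (h.2 _).mul_left _⟩
  neg_mem x hx := by
    rw [Set.mem_ofPred_eq, sum_sq_neg]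
    exact hx.imp id fun h => ⟨h.1, fun a => (h.2 a).neg_right⟩
  zero_notMem := by
    rintro (h | h)
    · simp at h
    · have := h.1
      rcases hc with rfl | rfl <;> simp at this
  multiple i m hm := by
    by_contra! h
    have hm2 : 4 ≤ m ^ 2 := by nlinarith
    simp only [Set.mem_ofPred_eq, sum_sq_smul] at hm
    unfold rootBC at hm
    split_ifs at hm with h'
    · rw [sum_sq_single_sub_single (ne_succ h')] at hm
      rcases hc with rfl | rfl <;> omega
    · rw [sum_sq_single] at hm
      rcases hc with rfl | rfl <;> omega
  refl_mem _ := trivial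
  refl_chi i := by
    unfold reflBC
    split_ifs with h
    · exact SignedPerm.chi_swap (ne_succ h)
    · exact SignedPerm.chi_signFlip i
  refl_act i j := by
    rw [hX]
    by_cases h : i.val + 1 < l
    · simp only [reflBC, h, dif_pos]
      rw [SignedPerm.act_swap]
      congr 2
      simp [rootBC, h]
    · simp only [reflBC, h, dif_neg, not_false_eq_true]
      rw [SignedPerm.act_signFlip i _ d c (by rw [mul_comm, hcd])]
      congr 2
      simp [rootBC, h]
  comp_mem _ _ _ _ := trivial
  one_mem := trivial
  generated p _ R h1 hR hs := by
    have hlast : ¬ (l - 1) + 1 < l := by omega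
    refine mem_of_signFlip_mem h1 hR (perm_mem_of_swap_mem h1 hR fun i j hij => ?_)
      (a := ⟨l - 1, by omega⟩) ?_ p
    · have hi : i.val + 1 < l := hij ▸ j.isLt
      have hj : j = ⟨i.val + 1, hi⟩ := Fin.ext hij
      have := hs i
      rw [reflBC, dif_pos hi] at this
      rwa [hj]
    · have := hs ⟨l - 1, by omega⟩
      rwa [reflBC, dif_neg hlast] at this
  faithful p _ q _ h := by
    refine SignedPerm.ext_of_act_single fun a => ?_
    obtain ⟨m, hm⟩ : ∃ m, m + a.val + 1 = l := ⟨l - 1 - a.val, by omega⟩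
    induction m generalizing a with
    | zero =>
      have h1 := h a
      rw [rootBC, dif_neg (by omega)] at h1
      rcases hc with rfl | rfl
      · have : (Pi.single a 2 : Fin l → ℤ) = Pi.single a 1 + Pi.single a 1 := by
          rw [← Pi.single_add]; rfl
        rw [this, SignedPerm.act_add, h1, SignedPerm.act_add]
      · exact h1
    | succ m ih =>
      have ha : a.val + 1 < l := by omega
      have h1 := h a
      rw [rootBC, dif_pos ha] at h1
      have h2 := ih ⟨a.val + 1, ha⟩ (by simp only; omega)
      rw [single_two_eq ha, SignedPerm.act_add, SignedPerm.act_add, h1, h2, SignedPerm.act_add,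
        SignedPerm.act_add]

/-- The model of type B. -/
def modelB (hl : 0 < l) : SignedModel (typeB l) l :=
  modelBC (typeB l) hl 1 2 (Or.inl rfl) rfl fun i j => by
    have hi := i.isLt
    have hj := j.isLt
    simp only [typeB, CartanMatrix.B, Matrix.of_apply, rootBC_apply, Fin.ext_iff]
    split_ifs <;> omega

/-- The model of type C. -/
def modelC (hl : 0 < l) : SignedModel (typeC l) l :=
  modelBC (typeC l) hl 2 1 (Or.inr rfl) rfl fun i j => by
    have hi := i.isLt
    have hj := j.isLt
    simp only [typeC, CartanMatrix.C, Matrix.of_apply, rootBC_apply, Fin.ext_iff]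
    split_ifs <;> omega

end NilpotentToda

namespace NilpotentToda

open Equiv (swap)

variable {l : ℕ}

/-! ### The type D -/

/-- The predecessor. -/
def predFin (i : Fin l) : Fin l := ⟨i.val - 1, by omega⟩

theorem predFin_lt {i : Fin l} (hi : i.val ≠ 0) : predFin i < i := by
  rw [Fin.lt_def, predFin]; simp only; omega

/-- The simple roots `e_i - e_{i+1}` and `e_{l-1} + e_l`. -/
def rootD (i : Fin l) : Fin l → ℤ :=
  if h : i.val + 1 < l then Pi.single i 1 - Pi.single ⟨i.val + 1, h⟩ 1
  else Pi.single (predFin i) 1 + Pi.single i 1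

/-- The simple reflections of type D. -/
def reflD (i : Fin l) : SignedPerm l :=
  if h : i.val + 1 < l then (swap i ⟨i.val + 1, h⟩, 1)
  else (swap (predFin i) i, signFlip {predFin i, i})

theorem rootD_apply (i a : Fin l) : rootD i a =
    if i.val + 1 < l then (if a = i then 1 else 0) - (if a.val = i.val + 1 then 1 else 0)
      else (if a.val = i.val - 1 then 1 else 0) + if a = i then 1 else 0 := by
  by_cases h : i.val + 1 < l <;> simp [rootD, h, Pi.single_apply, Fin.ext_iff, predFin]

theorem prod_sign_comp (p q : SignedPerm l) :
    ∏ a, (p.comp q).2 a = (∏ a, p.2 a) * ∏ a, q.2 a := by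
  simp only [SignedPerm.comp, Finset.prod_mul_distrib]
  rw [Equiv.prod_comp p.1.symm q.2]

/-- The model of type D. -/
def modelD (hl : 3 ≤ l) : SignedModel (typeD l) l where
  root := rootD
  refl := reflD
  G := {p | ∏ a, p.2 a = 1}
  roots := {x | ∑ a, x a ^ 2 = 2}
  -- For the two end roots the fundamental coweights are half integral; their doubles are `(1, …, 1,
  -- -1)` and `(1, …, 1)`.
  coef t a := if t.val + 2 < l then if a ≤ t then 1 else 0
    else if t.val + 2 = l ∧ a.val + 1 = l then -1 else 1
  mult t := if t.val + 2 < l then 1 else 2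
  mult_pos t := by split_ifs <;> omega
  coef_root t j := by
    have ht := t.isLt
    have hj := j.isLt
    unfold rootD
    split_ifs with h
    all_goals
      first | rw [sum_mul_single_sub_single] | rw [sum_mul_single_add_single]
      simp only [Fin.le_def, mul_one, predFin]
      have := Fin.ext_iff (a := j) (b := t)
      split_ifs <;> omega
  coef_nonneg x hx hpos t := by
    obtain ⟨a₀, hz, ha₀⟩ := hpos
    rw [Set.mem_ofPred_eq] at hx
    refine sum_mul_nonneg_of_lexPos hz (by rw [hx]; nlinarith) (fun a => by
      split_ifs <;> simp) ?_
    -- A vector of norm 2 is not supported at the last place alone, as 2 is no square; so the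
    -- coefficient at the first nonzero place is 1.
    have ha : ¬ a₀.val + 1 = l := fun h => by
      rw [Finset.sum_eq_single a₀ (fun b _ hb => by
        rw [hz b (lt_of_le_of_ne (Fin.le_def.mpr (by omega)) hb)]; rfl) (by simp)] at hx
      have h1 : x a₀ ≤ 1 := by nlinarith
      have h2 : x a₀ = 1 := by omega
      rw [h2] at hx
      norm_num at hx
    by_cases ht : t.val + 2 < l
    · simp only [ht, if_true]
      by_cases h : a₀ ≤ t
      · exact Or.inl (if_pos h)
      · exact Or.inr fun a ha => if_neg fun h' => h (ha.trans h')
    · simp [ht, ha]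
  root_mem i := by
    unfold rootD
    split_ifs with h
    · exact sum_sq_single_sub_single (ne_succ h)
    · exact sum_sq_single_add_single (predFin_lt (by omega)).ne
  root_pos i := by
    unfold rootD
    split_ifs with h
    · exact lexPos_single_sub_single (lt_succ h)
    · exact lexPos_single_add_single (predFin_lt (by omega))
  act_mem p _ x hx := by rwa [Set.mem_ofPred_eq, SignedPerm.sum_sq_act]
  neg_mem x hx := by rwa [Set.mem_ofPred_eq, sum_sq_neg]
  zero_notMem := by simp
  multiple i m hm := by
    by_contra! h
    have hm2 : 4 ≤ m ^ 2 := by nlinarith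
    rw [Set.mem_ofPred_eq, sum_sq_smul] at hm
    have : ∑ a, rootD i a ^ 2 = 2 := by
      unfold rootD
      split_ifs with h
      · exact sum_sq_single_sub_single (ne_succ h)
      · exact sum_sq_single_add_single (predFin_lt (by omega)).ne
    rw [this] at hm
    omega
  refl_mem i := by
    unfold reflD
    split_ifs with h
    · simp
    · rw [Set.mem_ofPred_eq, prod_signFlip, Finset.card_pair (predFin_lt (by omega)).ne]
      rfl
  refl_chi i := by
    unfold reflD
    split_ifs with h
    · exact SignedPerm.chi_swap (ne_succ h)
    · exact SignedPerm.chi_swap_signFlip (predFin_lt (by omega)).ne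
  refl_act i j := by
    have hi := i.isLt
    have hj := j.isLt
    have hX : (typeD l).mat j i = if h : i.val + 1 < l then
        rootD j i - rootD j ⟨i.val + 1, h⟩ else rootD j (predFin i) + rootD j i := by
      simp only [typeD, CartanMatrix.D, Matrix.of_apply, rootD_apply, Fin.ext_iff, predFin]
      split_ifs <;> omega
    rw [hX]
    by_cases h : i.val + 1 < l
    · simp only [reflD, h, dif_pos]
      rw [SignedPerm.act_swap]
      congr 2
      simp [rootD, h]
    · simp only [reflD, h, dif_neg, not_false_eq_true]
      rw [SignedPerm.act_swap_signFlip (predFin_lt (by omega)).ne]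
      congr 2
      simp [rootD, h]
  comp_mem p hp q hq := by
    rw [Set.mem_ofPred_eq] at hp hq
    rw [Set.mem_ofPred_eq, prod_sign_comp, hp, hq, one_mul]
  one_mem := by simp
  generated p hp R h1 hR hs := by
    have hperm : ∀ f : Equiv.Perm (Fin l), (f, 1) ∈ R := by
      refine perm_mem_of_swap_mem h1 hR fun i j hij => ?_
      have hi : i.val + 1 < l := hij ▸ j.isLt
      have hj : j = ⟨i.val + 1, hi⟩ := Fin.ext hij
      have := hs i
      rw [reflD, dif_pos hi] at this
      rwa [hj]
    set z : Fin l := ⟨l - 1, by omega⟩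
    have hz : predFin z ≠ z := (predFin_lt (by simp only [z]; omega)).ne
    refine mem_of_signFlip_pair_mem h1 hR hperm hz ?_ p hp
    -- The last reflection composed with the swap of the last two places changes exactly their two
    -- signs.
    have := hs z
    rw [reflD, dif_neg (by simp only [z]; omega)] at this
    convert hR _ this _ (hperm (swap (predFin z) z)) using 1
    exact Prod.ext (by simp [SignedPerm.comp]) (by simp [SignedPerm.comp])
  faithful p _ q _ h := by
    refine SignedPerm.ext_of_act_single fun a => ?_
    obtain ⟨m, hm⟩ : ∃ m, m + a.val + 1 = l := ⟨l - 1 - a.val, by omega⟩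
    induction m generalizing a with
    | zero =>
      have h1 := h a
      have h2 := h (predFin a)
      have h3 : (predFin a).val + 1 < l := by simp only [predFin]; omega
      have h4 : (⟨(predFin a).val + 1, h3⟩ : Fin l) = a := Fin.ext (by simp only [predFin]; omega)
      rw [rootD, dif_neg (by omega)] at h1
      rw [rootD, dif_pos h3, h4] at h2
      have : (Pi.single a 2 : Fin l → ℤ) = (Pi.single (predFin a) 1 + Pi.single a 1) -
          (Pi.single (predFin a) 1 - Pi.single a 1) := by
        funext b
        simp only [Pi.single_apply, Pi.add_apply, Pi.sub_apply]
        split_ifs <;> simp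
      rw [this, SignedPerm.act_sub, h1, h2]
      exact (SignedPerm.act_sub _ _ _).symm
    | succ m ih =>
      have ha : a.val + 1 < l := by omega
      have h1 := h a
      rw [rootD, dif_pos ha] at h1
      have h2 := ih ⟨a.val + 1, ha⟩ (by simp only; omega)
      rw [single_two_eq ha, SignedPerm.act_add, SignedPerm.act_add, h1, h2, SignedPerm.act_add,
        SignedPerm.act_add]

end NilpotentToda

namespace NilpotentToda

open Equiv (swap)

variable {l : ℕ}

/-! ### The type A -/

/-- The simple roots `e_i - e_{i+1}`. -/
def rootA (i : Fin l) : Fin (l + 1) → ℤ := Pi.single i.castSucc 1 - Pi.single i.succ 1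

theorem SignedPerm.act_rootA {p : SignedPerm (l + 1)} (hp : p.2 = 1) (i : Fin l) :
    p.act (rootA i) = Pi.single (p.1 i.castSucc) 1 - Pi.single (p.1 i.succ) 1 := by
  rw [rootA, act_sub, act_single, act_single, hp]
  simp

/-- The model of type A. -/
def modelA : SignedModel (typeA l) (l + 1) where
  root := rootA
  refl i := (swap i.castSucc i.succ, 1)
  G := {p | p.2 = 1}
  roots := {x | ∑ a, x a ^ 2 = 2}
  coef t a := if a.val ≤ t.val then 1 else 0
  mult _ := 1
  mult_pos _ := one_pos
  coef_root t j := by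
    rw [rootA, sum_mul_single_sub_single]
    simp only [Fin.val_castSucc, Fin.val_succ, mul_one, Fin.ext_iff]
    split_ifs <;> omega
  coef_nonneg x hx hpos t := by
    obtain ⟨a₀, hz, ha₀⟩ := hpos
    rw [Set.mem_ofPred_eq] at hx
    refine sum_mul_nonneg_of_lexPos hz (by rw [hx]; nlinarith) (fun a => by
      split_ifs <;> simp) ?_
    by_cases h : a₀.val ≤ t.val
    · exact Or.inl (if_pos h)
    · exact Or.inr fun a ha => if_neg fun h' => h (le_trans ha h')
  root_mem i := sum_sq_single_sub_single (Fin.castSucc_lt_succ (i := i)).ne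
  root_pos i := lexPos_single_sub_single Fin.castSucc_lt_succ
  act_mem p _ x hx := by rwa [Set.mem_ofPred_eq, SignedPerm.sum_sq_act]
  neg_mem x hx := by rwa [Set.mem_ofPred_eq, sum_sq_neg]
  zero_notMem := by simp
  multiple i m hm := by
    by_contra! h
    have hm2 : 4 ≤ m ^ 2 := by nlinarith
    rw [Set.mem_ofPred_eq, sum_sq_smul, rootA,
      sum_sq_single_sub_single (Fin.castSucc_lt_succ (i := i)).ne] at hm
    omega
  refl_mem _ := rfl
  refl_chi i := SignedPerm.chi_swap (Fin.castSucc_lt_succ (i := i)).ne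
  refl_act i j := by
    rw [SignedPerm.act_swap]
    congr 2
    simp only [rootA, Pi.sub_apply, Pi.single_apply, typeA, CartanMatrix.A, Matrix.of_apply,
      Fin.ext_iff, Fin.val_castSucc, Fin.val_succ]
    split_ifs <;> omega
  comp_mem p hp q hq := by
    rw [Set.mem_ofPred_eq] at hp hq
    funext a
    simp [SignedPerm.comp, hp, hq]
  one_mem := rfl
  generated p hp R h1 hR hs := by
    have := perm_mem_of_swap_mem h1 hR (fun i j hij => by
      have := hs ⟨i.val, by omega⟩
      rwa [show j = Fin.succ ⟨i.val, by omega⟩ from Fin.ext hij]) p.1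
    rwa [show p = (p.1, 1) from Prod.ext rfl hp]
  faithful p hp q hq h := by
    rw [Set.mem_ofPred_eq] at hp hq
    have h1 : ∀ i : Fin l, p.1 i.castSucc = q.1 i.castSucc ∧ p.1 i.succ = q.1 i.succ := by
      intro i
      have h0 := h i
      rw [SignedPerm.act_rootA hp, SignedPerm.act_rootA hq] at h0
      have hne := (Fin.castSucc_lt_succ (i := i)).ne
      have e1 := congrFun h0 (p.1 i.castSucc)
      have e2 := congrFun h0 (p.1 i.succ)
      simp only [Pi.sub_apply, Pi.single_apply, EmbeddingLike.apply_eq_iff_eq, hne, hne.symm,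
        if_true, if_false] at e1 e2
      constructor
      · by_contra hc
        rw [if_neg hc] at e1
        split_ifs at e1 <;> omega
      · by_contra hc
        rw [if_neg hc] at e2
        split_ifs at e2 <;> omega
    refine Prod.ext (Equiv.ext fun a => ?_) (hp.trans hq.symm)
    induction a using Fin.lastCases with
    | cast i => exact (h1 i).1
    | last =>
      cases l with
      | zero => exact Fin.ext (by omega)
      | succ m => rw [← Fin.succ_last]; exact (h1 _).2

end NilpotentToda

namespace NilpotentToda

open Equiv (swap)

variable {n : ℕ}

/-! ### Cancellation in chains -/

section Unimodal

variable {V : ℕ → ℕ} {E : ℕ → ℤ} {K : ℕ}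
  (hch : ∀ a < K, (V a < V (a + 1) ∧ E a = 1) ∨ (V (a + 1) < V a ∧ E (a + 1) = -1))
include hch

/-- A descent ends at a place with sign `-1`, whereas an ascent has to start from a place with sign
1; so descents persist, and `V` rises and then falls. -/
theorem descent_of_descent {a b : ℕ} (ha : V (a + 1) < V a) (hab : a + 1 ≤ b) (hb : b ≤ K) :
    V b < V a := by
  have h : V b < V a ∧ V b < V (b - 1) := by
    induction b, hab using Nat.le_induction with
    | base => exact ⟨ha, ha⟩
    | succ b hab ih =>
      obtain ⟨h1, h2⟩ := ih (by omega)
      have h3 := hch b (by omega)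
      have h4 := hch (b - 1) (by omega)
      rw [show b - 1 + 1 = b by omega] at h4
      simp only [Nat.add_sub_cancel]
      omega
  exact h.1

theorem ascent_of_ascent {a b : ℕ} (hb : b < K) (h : V b < V (b + 1)) (hab : a ≤ b) :
    V a < V (b + 1) := by
  obtain ⟨m, rfl⟩ := Nat.exists_eq_add_of_le hab
  clear hab
  induction m generalizing a with
  | zero => exact h
  | succ m ih =>
    have h1 : V (a + 1) < V (a + 1 + m + 1) ∨ m = 0 := by
      rcases m with _ | m
      · exact Or.inr rfl
      · exact Or.inl (ih (a := a + 1) (by omega) (by convert h using 2 <;> omega))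
    by_contra hc
    have h2 : V (a + 1) < V a := by
      rcases h1 with h1 | rfl
      · rw [show a + 1 + m + 1 = a + (m + 1) + 1 by omega] at h1
        omega
      · simp only [zero_add] at h hc
        omega
    have h3 := hch a (by omega)
    have h4 : V (a + (m + 1) + 1) < V (a + (m + 1)) := by
      rcases Nat.eq_zero_or_pos m with rfl | hm
      · have := hch (a + 1) (by omega)
        simp only [zero_add] at *
        omega
      · have key : ∀ t, a + 1 + t ≤ K → V (a + 1 + t) < V (a + t) := by
          intro t
          induction t with
          | zero => intro _; exact h2
          | succ t iht =>
            intro ht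
            have e1 := hch (a + t) (by omega)
            have e2 := hch (a + t + 1) (by omega)
            have e3 := iht (by omega)
            rw [show a + 1 + t = a + t + 1 by omega] at e3
            rw [show a + 1 + (t + 1) = a + t + 1 + 1 by omega,
              show a + (t + 1) = a + t + 1 by omega]
            omega
        have := key (m + 1) (by omega)
        rwa [show a + 1 + (m + 1) = a + (m + 1) + 1 by omega] at this
    omega

/-- Induction on `r`: by unimodality the largest value outside the interval found so far is attained
next to it. -/
theorem exists_top_interval (hinj : ∀ a ≤ K, ∀ b ≤ K, V a = V b → a = b) {r : ℕ} (hr : 1 ≤ r)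
    (hrK : r ≤ K + 1) : ∃ i, i + r ≤ K + 1 ∧ ∀ a ≤ K, ∀ b ≤ K, i ≤ a → a < i + r →
      ¬ (i ≤ b ∧ b < i + r) → V b < V a := by
  induction r, hr using Nat.le_induction with
  | base =>
    obtain ⟨i, hi, hmax⟩ := Finset.exists_max_image (Finset.range (K + 1)) V ⟨0, by simp⟩
    rw [Finset.mem_range] at hi
    refine ⟨i, by omega, fun a ha b hb h1 h2 h3 => ?_⟩
    obtain rfl : a = i := by omega
    have h4 := hmax b (Finset.mem_range.mpr (by omega))
    have h5 := hinj a ha b hb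
    omega
  | succ r hr ih =>
    obtain ⟨i, hi, htop⟩ := ih (by omega)
    obtain ⟨m, hm, hmax⟩ := Finset.exists_max_image
      ((Finset.range (K + 1)).filter fun b => ¬ (i ≤ b ∧ b < i + r)) V (by
        by_cases h : i = 0
        · exact ⟨K, by simp; omega⟩
        · exact ⟨0, by simp; omega⟩)
    simp only [Finset.mem_filter, Finset.mem_range] at hm hmax
    have hadj : m = i + r ∨ m + 1 = i := by
      by_contra hc
      rcases lt_or_ge m i with h | h
      · have h1 := htop i (by omega) (i - 1) (by omega) le_rfl (by omega) (by omega)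
        have h2 := ascent_of_ascent hch (a := m) (b := i - 1 - 1) (by omega) (by
          have h4 := hch (i - 1) (by omega)
          have h5 := hch (i - 1 - 1) (by omega)
          rw [show i - 1 + 1 = i by omega] at h4
          rw [show i - 1 - 1 + 1 = i - 1 by omega] at h5 ⊢
          omega) (by omega)
        have h3 := hmax (i - 1) (by omega)
        rw [show i - 1 - 1 + 1 = i - 1 by omega] at h2
        omega
      · have h1 := htop (i + r - 1) (by omega) (i + r) (by omega) (by omega) (by omega) (by omega)
        have h2 := descent_of_descent hch (a := i + r) (b := m) (by
          have h4 := hch (i + r) (by omega)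
          have h5 := hch (i + r - 1) (by omega)
          rw [show i + r - 1 + 1 = i + r by omega] at h5
          omega) (by omega) (by omega)
        have h3 := hmax (i + r) (by omega)
        omega
    have hnew : ∀ b ≤ K, ¬ (i ≤ b ∧ b < i + r) → b ≠ m → V b < V m := fun b hb h h' => by
      have h1 := hmax b (by omega)
      have h2 := hinj b hb m (by omega)
      omega
    rcases hadj with rfl | hadj
    · refine ⟨i, by omega, fun a ha b hb h1 h2 h3 => ?_⟩
      by_cases h4 : a = i + r
      · subst h4
        exact hnew b hb (by omega) (by omega)
      · exact htop a ha b hb h1 (by omega) (by omega)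
    · refine ⟨m, by omega, fun a ha b hb h1 h2 h3 => ?_⟩
      by_cases h4 : a = m
      · subst h4
        exact hnew b hb (by omega) (by omega)
      · exact htop a ha b hb (by omega) (by omega) (by omega)

end Unimodal

namespace SignedPerm

/-- The place to which `e_a` is moved. -/
def val (p : SignedPerm n) (a : Fin n) : ℕ := (p.1 a).val

/-- The sign with which `e_a` is moved. -/
def sgn (p : SignedPerm n) (a : Fin n) : ℤ := p.2 (p.1 a)

theorem sgn_eq (p : SignedPerm n) (a : Fin n) : p.sgn a = 1 ∨ p.sgn a = -1 := by
  rcases Int.units_eq_one_or (p.2 (p.1 a)) with h | h <;> simp [sgn, h]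

theorem val_injective (p : SignedPerm n) {a b : Fin n} (h : p.val a = p.val b) : a = b :=
  p.1.injective (Fin.ext h)

theorem act_single_eq (p : SignedPerm n) (a : Fin n) (c : ℤ) :
    p.act (Pi.single a c) = Pi.single (p.1 a) (p.sgn a * c) := p.act_single a c

theorem act_congr {p q : SignedPerm n} {x : Fin n → ℤ}
    (h : ∀ a, x a ≠ 0 → p.val a = q.val a ∧ p.sgn a = q.sgn a) : p.act x = q.act x := by
  funext b
  simp only [act]
  by_cases h1 : x (p.1.symm b) = 0
  · by_cases h2 : x (q.1.symm b) = 0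
    · rw [h1, h2, mul_zero, mul_zero]
    · have h3 := Fin.ext (h _ h2).1
      rw [Equiv.apply_symm_apply] at h3
      rw [← h3, Equiv.symm_apply_apply] at h1
      exact absurd h1 h2
  · obtain ⟨h2, h3⟩ := h _ h1
    have h4 := Fin.ext h2
    simp only [sgn, Equiv.apply_symm_apply] at h3 h4
    rw [← h4] at h3
    rw [h3]
    conv_rhs => rw [h4]
    rw [Equiv.symm_apply_apply, ← h4]

/-- The vector `e_i - e_j` is mapped to a vector whose first nonzero coordinate is positive. -/
def PairPos (p : SignedPerm n) (i j : Fin n) : Prop :=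
  (p.val i < p.val j ∧ p.sgn i = 1) ∨ (p.val j < p.val i ∧ p.sgn j = -1)

/-- The first nonzero coordinate of the image is at the smaller of the two new places, so only the
sign belonging to that place matters. -/
theorem lexPos_act_sub_iff (p : SignedPerm n) {i j : Fin n} (hij : i ≠ j) :
    LexPos (p.act (Pi.single i 1 - Pi.single j 1)) ↔ p.PairPos i j := by
  have hne : p.1 i ≠ p.1 j := fun h => hij (p.1.injective h)
  rw [act_sub, act_single_eq, act_single_eq, mul_one, mul_one]
  have hi := p.sgn_eq i
  have hj := p.sgn_eq j
  have e1 : (Pi.single (p.1 i) (p.sgn i) - Pi.single (p.1 j) (p.sgn j) : Fin n → ℤ) (p.1 i) =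
      p.sgn i := by simp [hne]
  have e2 : (Pi.single (p.1 i) (p.sgn i) - Pi.single (p.1 j) (p.sgn j) : Fin n → ℤ) (p.1 j) =
      -p.sgn j := by simp [hne.symm]
  have e3 : ∀ b, b ≠ p.1 i → b ≠ p.1 j →
      (Pi.single (p.1 i) (p.sgn i) - Pi.single (p.1 j) (p.sgn j) : Fin n → ℤ) b = 0 := by
    intro b h1 h2; simp [h1, h2]
  generalize (Pi.single (p.1 i) (p.sgn i) - Pi.single (p.1 j) (p.sgn j) : Fin n → ℤ) = x at *
  constructor
  · rintro ⟨a, hz, ha⟩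
    by_cases h1 : a = p.1 i
    · refine Or.inl ⟨?_, by rw [h1, e1] at ha; omega⟩
      rcases lt_or_gt_of_ne hne with h | h
      · exact h
      · have := hz (p.1 j) (h1 ▸ h)
        omega
    · by_cases h2 : a = p.1 j
      · refine Or.inr ⟨?_, by rw [h2, e2] at ha; omega⟩
        rcases lt_or_gt_of_ne hne with h | h
        · have := hz (p.1 i) (h2 ▸ h)
          omega
        · exact h
      · rw [e3 a h1 h2] at ha
        exact absurd ha (lt_irrefl _)
  · rintro (⟨h1, h2⟩ | ⟨h1, h2⟩)
    · exact ⟨p.1 i, fun b hb => e3 b hb.ne (hb.trans h1).ne, by omega⟩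
    · exact ⟨p.1 j, fun b hb => e3 b (hb.trans h1).ne hb.ne, by omega⟩

/-- The roots `e_i - e_{i+1}` with `i < K` are mapped to positive vectors. -/
def Chain (p : SignedPerm n) (K : ℕ) : Prop :=
  ∀ a b : Fin n, b.val = a.val + 1 → b.val ≤ K → p.PairPos a b

/-- The interval from `i` to `i + r - 1` consists of the places with the `r` largest values among
the places from `0` to `K`. -/
def IsTop (p : SignedPerm n) (K r : ℕ) (i : Fin n) : Prop :=
  i.val + r ≤ K + 1 ∧ ∀ a b : Fin n, a.val ≤ K → b.val ≤ K → i.val ≤ a.val → a.val < i.val + r →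
    ¬ (i.val ≤ b.val ∧ b.val < i.val + r) → p.val b < p.val a

theorem Chain.exists_isTop {p : SignedPerm n} {K r : ℕ} (hp : p.Chain K) (hK : K < n)
    (hr : 1 ≤ r) (hrK : r ≤ K + 1) : ∃ i, p.IsTop K r i := by
  set V : ℕ → ℕ := fun t => if h : t < n then p.val ⟨t, h⟩ else 0 with hV
  set E : ℕ → ℤ := fun t => if h : t < n then p.sgn ⟨t, h⟩ else 0 with hE
  have hVa : ∀ a : Fin n, V a.val = p.val a := fun a => by simp [V]
  have hEa : ∀ a : Fin n, E a.val = p.sgn a := fun a => by simp [E]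
  obtain ⟨i, hi, h⟩ := exists_top_interval (V := V) (E := E) (K := K) (fun a ha => by
    have := hp ⟨a, by omega⟩ ⟨a + 1, by omega⟩ rfl (by simp only; omega)
    simpa only [PairPos, ← hVa, ← hEa] using this) (fun a ha b hb hab => by
      have := p.val_injective (a := ⟨a, by omega⟩) (b := ⟨b, by omega⟩) (by
        rw [← hVa, ← hVa]; exact hab)
      simpa using this) hr hrK
  refine ⟨⟨i, by omega⟩, hi, fun a b ha hb h1 h2 h3 => ?_⟩
  rw [← hVa, ← hVa]
  exact h a ha b hb h1 h2 h3

theorem IsTop.unique {p : SignedPerm n} {K r : ℕ} (hK : K < n) {i j : Fin n} (hr : 1 ≤ r)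
    (hi : p.IsTop K r i) (hj : p.IsTop K r j) : i = j := by
  by_contra hne
  wlog h : i < j generalizing i j
  · exact this hj hi (Ne.symm hne) (lt_of_le_of_ne (not_lt.mp h) (Ne.symm hne))
  rw [Fin.lt_def] at h
  have h1 := hi.1
  have h2 := hj.1
  have h3 := hi.2 i ⟨j.val + r - 1, by omega⟩ (by omega) (by simp only; omega) le_rfl (by omega)
    (by simp only; omega)
  have h4 := hj.2 ⟨j.val + r - 1, by omega⟩ i (by simp only; omega) (by omega)
    (by simp only; omega) (by simp only; omega) (by omega)
  exact lt_asymm h3 h4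

/-- Exchange the values at the places `i` and `j`, and change the signs at the values in `D`. -/
def swapFlip (p : SignedPerm n) (i j : Fin n) (D : Finset (Fin n)) : SignedPerm n :=
  (p.1 * swap i j, signFlip D * p.2)

theorem val_swapFlip (p : SignedPerm n) (i j : Fin n) (D : Finset (Fin n)) (a : Fin n) :
    (p.swapFlip i j D).val a = p.val (swap i j a) := rfl

theorem sgn_swapFlip (p : SignedPerm n) (i j : Fin n) (D : Finset (Fin n)) (a : Fin n) :
    (p.swapFlip i j D).sgn a =
      if p.1 (swap i j a) ∈ D then -p.sgn (swap i j a) else p.sgn (swap i j a) := by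
  simp only [sgn, swapFlip, signFlip, Equiv.Perm.mul_apply, Pi.mul_apply, Units.val_mul]
  split_ifs <;> simp

theorem chi_swapFlip (p : SignedPerm n) (i j : Fin n) (D : Finset (Fin n)) :
    (p.swapFlip i j D).chi = p.chi * ((if i = j then 1 else -1) * (-1) ^ D.card) := by
  simp only [chi, swapFlip, Equiv.Perm.sign_mul, Pi.mul_apply, Finset.prod_mul_distrib,
    prod_signFlip, Equiv.Perm.sign_swap']
  split_ifs <;> push_cast <;> ring

theorem swapFlip_swapFlip (p : SignedPerm n) (i j : Fin n) (D : Finset (Fin n)) :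
    (p.swapFlip i j D).swapFlip i j D = p := by
  refine Prod.ext ?_ (funext fun a => ?_)
  · simp [swapFlip, mul_assoc]
  · simp only [swapFlip, signFlip, Pi.mul_apply]
    split_ifs <;> simp

/-- The values at the places from `i` to `j`. -/
def values (p : SignedPerm n) (i j : Fin n) : Finset (Fin n) :=
  (Finset.Icc i j).map p.1.toEmbedding

theorem mem_values (p : SignedPerm n) (i j a : Fin n) :
    p.1 a ∈ p.values i j ↔ i.val ≤ a.val ∧ a.val ≤ j.val := by
  simp only [values, Finset.mem_map_equiv, Equiv.symm_apply_apply, Finset.mem_Icc, Fin.le_def]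

theorem card_values (p : SignedPerm n) (i j : Fin n) :
    (p.values i j).card = j.val + 1 - i.val := by
  rw [values, Finset.card_map, Fin.card_Icc]

theorem swap_mem_Icc_iff {i j : Fin n} (hij : i.val ≤ j.val) (a : Fin n) :
    (i.val ≤ (swap i j a).val ∧ (swap i j a).val ≤ j.val) ↔ i.val ≤ a.val ∧ a.val ≤ j.val := by
  rw [Equiv.swap_apply_def]
  split_ifs with h1 h2
  · subst h1; omega
  · subst h2; omega
  · rfl

theorem values_swapFlip (p : SignedPerm n) {i j : Fin n} (hij : i.val ≤ j.val)
    (D : Finset (Fin n)) : (p.swapFlip i j D).values i j = p.values i j := by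
  ext b
  obtain ⟨a, rfl⟩ := p.1.surjective b
  have h : p.1 a = (p.swapFlip i j D).1 (swap i j a) := by simp [swapFlip]
  rw [mem_values, h, mem_values, swap_mem_Icc_iff hij]

theorem IsTop.swapFlip {p : SignedPerm n} {K r : ℕ} {i j : Fin n} (h : p.IsTop K r i)
    (hr : 1 ≤ r) (hij : j.val + 1 = i.val + r) (D : Finset (Fin n)) :
    (p.swapFlip i j D).IsTop K r i := by
  have h1 := h.1
  have hswap := swap_mem_Icc_iff (i := i) (j := j) (by omega)
  have hle : ∀ a : Fin n, a.val ≤ K → (Equiv.swap i j a).val ≤ K := fun a ha => by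
    rw [Equiv.swap_apply_def]
    split_ifs <;> omega
  refine ⟨h1, fun a b ha hb h2 h3 h4 => ?_⟩
  rw [val_swapFlip, val_swapFlip]
  have ea := hswap a
  have eb := hswap b
  exact h.2 _ _ (hle a ha) (hle b hb) (by omega) (by omega) (by omega)

/-- The top interval and its set of values are unchanged by the exchange, so applying it twice gives
back `p`. The condition on `F` makes it reverse the determinant. -/
theorem sum_chi_eq_zero {K r : ℕ} (hK : K < n) (hr : 1 ≤ r) (hrK : r ≤ K + 1)
    (F : Finset (Fin n) → Finset (Fin n))
    (hF : ∀ T : Finset (Fin n), T.card = r →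
      (if r = 1 then 1 else -1) * (-1 : ℤ) ^ (F T).card = -1)
    (S : Finset (SignedPerm n)) (hS : ∀ p ∈ S, p.Chain K)
    (hstay : ∀ p ∈ S, ∀ i j : Fin n, j.val + 1 = i.val + r → p.IsTop K r i →
      p.swapFlip i j (F (p.values i j)) ∈ S) : ∑ p ∈ S, p.chi = 0 := by
  have hex : ∀ p : SignedPerm n, ∃ ij : Fin n × Fin n, p ∈ S →
      p.IsTop K r ij.1 ∧ ij.2.val + 1 = ij.1.val + r := fun p => by
    by_cases hp : p ∈ S
    · obtain ⟨i, hi⟩ := (hS p hp).exists_isTop hK hr hrK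
      have := hi.1
      exact ⟨(i, ⟨i.val + r - 1, by omega⟩), fun _ => ⟨hi, by simp only; omega⟩⟩
    · exact ⟨(⟨K, hK⟩, ⟨K, hK⟩), fun h => absurd h hp⟩
  choose ij hij using hex
  have hchi : ∀ p ∈ S, (p.swapFlip (ij p).1 (ij p).2
      (F (p.values (ij p).1 (ij p).2))).chi = -p.chi := fun p hp => by
    have h1 := hij p hp
    have h2 : (ij p).1 = (ij p).2 ↔ r = 1 := by rw [Fin.ext_iff]; omega
    rw [chi_swapFlip]
    simp only [h2]
    rw [hF _ (by rw [card_values]; omega)]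
    ring
  refine Finset.sum_involution (fun p _ => p.swapFlip (ij p).1 (ij p).2
    (F (p.values (ij p).1 (ij p).2))) (fun p hp => by rw [hchi p hp]; ring) ?_
    (fun p hp => hstay p hp _ _ (hij p hp).2 (hij p hp).1) ?_
  · intro p hp hne h
    have := hchi p hp
    rw [h] at this
    omega
  · intro p hp
    obtain ⟨h1, h2⟩ := hij p hp
    have hq := hstay p hp _ _ h2 h1
    obtain ⟨h3, h4⟩ := hij _ hq
    have e1 := IsTop.unique hK hr h3 (h1.swapFlip hr h2 _)
    have e2 := Fin.ext (a := (ij (p.swapFlip (ij p).1 (ij p).2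
      (F (p.values (ij p).1 (ij p).2)))).2) (b := (ij p).2) (by rw [e1] at h4; omega)
    simp only [e1, e2]
    rw [values_swapFlip _ (by omega), swapFlip_swapFlip]

/-! ### The three exchanges -/

/-- The sign at the largest value never decides a comparison with a neighbour. -/
theorem Chain.flip_top {p : SignedPerm n} {K : ℕ} (hp : p.Chain K) {i : Fin n}
    (hi : p.IsTop K 1 i) : (p.swapFlip i i (p.values i i)).Chain K := by
  intro a b hab hb
  have h := hp a b hab hb
  have ha := hi.2 i a (by have := hi.1; omega) (by omega) le_rfl (by omega)
  have hb := hi.2 i b (by have := hi.1; omega) (by omega) le_rfl (by omega)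
  simp only [PairPos, val_swapFlip, sgn_swapFlip, mem_values, Equiv.swap_self, Equiv.refl_apply]
    at h ⊢
  have e1 : i.val ≤ a.val ∧ a.val ≤ i.val → a = i := fun h => Fin.ext (by omega)
  have e2 : i.val ≤ b.val ∧ b.val ≤ i.val → b = i := fun h => Fin.ext (by omega)
  split_ifs <;> grind

theorem swapFlip_of_notMem (p : SignedPerm n) {i j c : Fin n} {D : Finset (Fin n)}
    (hD : D ⊆ p.values i j) (hij : i.val ≤ j.val) (hc : ¬ (i.val ≤ c.val ∧ c.val ≤ j.val)) :
    (p.swapFlip i j D).val c = p.val c ∧ (p.swapFlip i j D).sgn c = p.sgn c := by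
  have h1 : swap i j c = c :=
    Equiv.swap_apply_of_ne_of_ne (by rintro rfl; omega) (by rintro rfl; omega)
  rw [val_swapFlip, sgn_swapFlip, h1, if_neg fun h => hc ((mem_values p i j c).mp (hD h))]
  exact ⟨rfl, rfl⟩

/-- The parity condition for type C. -/
def ParityC (p : SignedPerm n) (a b : Fin n) : Prop :=
  (p.val a + p.val b) % 2 = 1 ↔ p.sgn a = p.sgn b

/-- Inside the pair an ascent with sign 1 becomes a descent with sign `-1`, and conversely; the
outer neighbours have smaller values, so only their own signs count. The parity condition says that
place number plus sign bit alternates in parity along the chain, and swapping two neighbours while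
changing both signs preserves this parity at each of them. -/
theorem Chain.swap_two_top {p : SignedPerm n} {K : ℕ} (hp : p.Chain K) {i j : Fin n}
    (hij : j.val + 1 = i.val + 2) (hi : p.IsTop K 2 i) :
    (p.swapFlip i j (p.values i j)).Chain K ∧
    ((∀ a b : Fin n, b.val = a.val + 1 → b.val ≤ K → p.ParityC a b) →
      ∀ a b : Fin n, b.val = a.val + 1 → b.val ≤ K →
        (p.swapFlip i j (p.values i j)).ParityC a b) := by
  have hK := hi.1
  have hout := fun c => p.swapFlip_of_notMem (c := c) (Finset.Subset.refl (p.values i j))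
    (by omega)
  have vi : (p.swapFlip i j (p.values i j)).val i = p.val j := by
    rw [val_swapFlip, Equiv.swap_apply_left]
  have vj : (p.swapFlip i j (p.values i j)).val j = p.val i := by
    rw [val_swapFlip, Equiv.swap_apply_right]
  have si : (p.swapFlip i j (p.values i j)).sgn i = -p.sgn j := by
    rw [sgn_swapFlip, Equiv.swap_apply_left, if_pos ((mem_values p i j j).mpr (by omega))]
  have sj : (p.swapFlip i j (p.values i j)).sgn j = -p.sgn i := by
    rw [sgn_swapFlip, Equiv.swap_apply_right, if_pos ((mem_values p i j i).mpr (by omega))]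
  have hcases : ∀ a b : Fin n, b.val = a.val + 1 → b.val ≤ K →
      b = i ∨ (a = i ∧ b = j) ∨ a = j ∨
        (¬ (i.val ≤ a.val ∧ a.val ≤ j.val) ∧ ¬ (i.val ≤ b.val ∧ b.val ≤ j.val)) := by
    intro a b hab hb
    simp only [Fin.ext_iff]
    omega
  have hpij := hp i j (by omega) (by omega)
  generalize p.swapFlip i j (p.values i j) = q at *
  have hsi := p.sgn_eq i
  have hsj := p.sgn_eq j
  refine ⟨fun a b hab hb => ?_, fun hpar a b hab hb => ?_⟩
  · have hpab := hp a b hab hb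
    unfold PairPos at *
    rcases hcases a b hab hb with rfl | ⟨rfl, rfl⟩ | rfl | ⟨h1, h2⟩
    · obtain ⟨v, s⟩ := hout a (by omega)
      have h1 := hi.2 b a (by omega) (by omega) le_rfl (by omega) (by omega)
      have h2 := hi.2 j a (by omega) (by omega) (by omega) (by omega) (by omega)
      omega
    · omega
    · obtain ⟨v, s⟩ := hout b (by omega)
      have h1 := hi.2 i b (by omega) (by omega) le_rfl (by omega) (by omega)
      have h2 := hi.2 a b (by omega) (by omega) (by omega) (by omega) (by omega)
      omega
    · obtain ⟨v, s⟩ := hout a h1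
      obtain ⟨v', s'⟩ := hout b h2
      omega
  · have hpab := hpar a b hab hb
    have hppij := hpar i j (by omega) (by omega)
    have hsa := p.sgn_eq a
    have hsb := p.sgn_eq b
    unfold ParityC at *
    rcases hcases a b hab hb with rfl | ⟨rfl, rfl⟩ | rfl | ⟨h1, h2⟩
    · obtain ⟨v, s⟩ := hout a (by omega)
      omega
    · omega
    · obtain ⟨v, s⟩ := hout b (by omega)
      omega
    · obtain ⟨v, s⟩ := hout a h1
      obtain ⟨v', s'⟩ := hout b h2
      omega

/-- The elements of `T` below the largest one. -/
def belowMax (T : Finset (Fin n)) : Finset (Fin n) := T.filter fun b => ∃ c ∈ T, b < c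

theorem card_belowMax {T : Finset (Fin n)} (hT : T.Nonempty) :
    (belowMax T).card + 1 = T.card := by
  have : belowMax T = T.erase (T.max' hT) := by
    ext b
    simp only [belowMax, Finset.mem_filter, Finset.mem_erase]
    refine ⟨fun ⟨h1, c, h2, h3⟩ => ⟨fun h => ?_, h1⟩, fun ⟨h1, h2⟩ => ⟨h2, _, T.max'_mem hT, ?_⟩⟩
    · exact absurd (T.le_max' c h2) (not_le.mpr (h ▸ h3))
    · exact lt_of_le_of_ne (T.le_max' b h2) h1
  rw [this, Finset.card_erase_add_one (T.max'_mem hT)]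

theorem mem_belowMax_values (p : SignedPerm n) {i j m : Fin n} (hm : m.val = i.val + 1)
    (hj : j.val = i.val + 2) (a : Fin n) : p.1 a ∈ belowMax (p.values i j) ↔
      (i.val ≤ a.val ∧ a.val ≤ j.val) ∧
        (p.val a < p.val i ∨ p.val a < p.val m ∨ p.val a < p.val j) := by
  rw [belowMax, Finset.mem_filter, mem_values]
  refine and_congr_right fun _ => ⟨?_, ?_⟩
  · rintro ⟨c, hc, hac⟩
    obtain ⟨d, rfl⟩ := p.1.surjective c
    rw [mem_values] at hc
    have : d = i ∨ d = m ∨ d = j := by simp only [Fin.ext_iff]; omega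
    rcases this with rfl | rfl | rfl
    · exact Or.inl hac
    · exact Or.inr (Or.inl hac)
    · exact Or.inr (Or.inr hac)
  · rintro (h | h | h)
    · exact ⟨p.1 i, (mem_values p i j i).mpr (by omega), h⟩
    · exact ⟨p.1 m, (mem_values p i j m).mpr (by omega), h⟩
    · exact ⟨p.1 j, (mem_values p i j j).mpr (by omega), h⟩

/-- The two end values have equal parity, so exchanging them keeps the parities alternating.
Reflecting the order pattern of the three values requires the opposite sign exactly at those below
their maximum. Two sign changes and a transposition reverse the determinant and keep the product of
the signs. -/
theorem Chain.swap_three_top {p : SignedPerm n} {K : ℕ} (hp : p.Chain K)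
    (hpar : ∀ a b : Fin n, b.val = a.val + 1 → b.val ≤ K → (p.val a + p.val b) % 2 = 1)
    {i j : Fin n} (hij : j.val + 1 = i.val + 3) (hi : p.IsTop K 3 i) :
    (p.swapFlip i j (belowMax (p.values i j))).Chain K ∧
      ∀ a b : Fin n, b.val = a.val + 1 → b.val ≤ K →
        ((p.swapFlip i j (belowMax (p.values i j))).val a +
          (p.swapFlip i j (belowMax (p.values i j))).val b) % 2 = 1 := by
  have hK := hi.1
  obtain ⟨m, hm⟩ : ∃ m : Fin n, m.val = i.val + 1 := ⟨⟨i.val + 1, by omega⟩, rfl⟩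
  have hj : j.val = i.val + 2 := by omega
  have hsub : belowMax (p.values i j) ⊆ p.values i j := Finset.filter_subset _ _
  have hout := fun c => p.swapFlip_of_notMem (c := c) hsub (by omega)
  have hmem := p.mem_belowMax_values hm hj
  have hmi : swap i j m = m :=
    Equiv.swap_apply_of_ne_of_ne (by rintro rfl; omega) (by rintro rfl; omega)
  have vi := p.val_swapFlip i j (belowMax (p.values i j)) i
  have vj := p.val_swapFlip i j (belowMax (p.values i j)) j
  have vm := p.val_swapFlip i j (belowMax (p.values i j)) m
  have si := p.sgn_swapFlip i j (belowMax (p.values i j)) i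
  have sj := p.sgn_swapFlip i j (belowMax (p.values i j)) j
  have sm := p.sgn_swapFlip i j (belowMax (p.values i j)) m
  rw [Equiv.swap_apply_left] at vi si
  rw [Equiv.swap_apply_right] at vj sj
  rw [hmi] at vm sm
  simp only [hmem] at si sj sm
  have hcases : ∀ a b : Fin n, b.val = a.val + 1 → b.val ≤ K →
      b = i ∨ (a = i ∧ b = m) ∨ (a = m ∧ b = j) ∨ a = j ∨
        (¬ (i.val ≤ a.val ∧ a.val ≤ j.val) ∧ ¬ (i.val ≤ b.val ∧ b.val ≤ j.val)) := by
    intro a b hab hb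
    simp only [Fin.ext_iff]
    omega
  have hpim := hp i m (by omega) (by omega)
  have hpmj := hp m j (by omega) (by omega)
  have qim := hpar i m (by omega) (by omega)
  have qmj := hpar m j (by omega) (by omega)
  generalize p.swapFlip i j (belowMax (p.values i j)) = q at *
  have hq : q.PairPos i m ∧ q.PairPos m j := by
    unfold PairPos at *
    rw [vi, vj, vm]
    rcases hpim with ⟨a1, a2⟩ | ⟨a1, a2⟩ <;> rcases hpmj with ⟨b1, b2⟩ | ⟨b1, b2⟩
    -- The cases are the order patterns of the three values: rising, peak in the middle, a valley
    -- (impossible, as the middle sign would be both 1 and `-1`), and falling.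
    · rw [if_pos (by omega), b2] at sm
      rw [if_pos (by omega), a2] at sj
      exact ⟨Or.inr ⟨b1, sm⟩, Or.inr ⟨a1, sj⟩⟩
    · rw [if_pos (by omega), b2] at si
      rw [if_pos (by omega), a2] at sj
      exact ⟨Or.inl ⟨b1, si⟩, Or.inr ⟨a1, sj⟩⟩
    · omega
    · rw [if_pos (by omega), b2] at si
      rw [if_pos (by omega), a2] at sm
      exact ⟨Or.inl ⟨b1, si⟩, Or.inl ⟨a1, sm⟩⟩
  clear si sj sm
  refine ⟨fun a b hab hb => ?_, fun a b hab hb => ?_⟩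
  · have hpab := hp a b hab hb
    rcases hcases a b hab hb with rfl | ⟨rfl, rfl⟩ | ⟨rfl, rfl⟩ | rfl | ⟨h1, h2⟩
    · obtain ⟨v, s⟩ := hout a (by omega)
      have h1 := hi.2 b a (by omega) (by omega) le_rfl (by omega) (by omega)
      have h2 := hi.2 j a (by omega) (by omega) (by omega) (by omega) (by omega)
      unfold PairPos at *
      rw [v, s, vi]
      exact Or.inl ⟨h2, by omega⟩
    · exact hq.1
    · exact hq.2
    · obtain ⟨v, s⟩ := hout b (by omega)
      have h1 := hi.2 i b (by omega) (by omega) le_rfl (by omega) (by omega)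
      have h2 := hi.2 a b (by omega) (by omega) (by omega) (by omega) (by omega)
      unfold PairPos at *
      rw [v, s, vj]
      exact Or.inr ⟨h1, by omega⟩
    · unfold PairPos at *
      rwa [(hout a h1).1, (hout a h1).2, (hout b h2).1, (hout b h2).2]
  · have hpab := hpar a b hab hb
    rcases hcases a b hab hb with rfl | ⟨rfl, rfl⟩ | ⟨rfl, rfl⟩ | rfl | ⟨h1, h2⟩
    · rw [(hout a (by omega)).1]
      omega
    · omega
    · omega
    · rw [(hout b (by omega)).1]
      omega
    · rwa [(hout a h1).1, (hout b h2).1]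

end SignedPerm

end NilpotentToda

namespace NilpotentToda

open Equiv (swap)

variable {l n : ℕ}

namespace SignedPerm

/-- The parity condition for the types A, B and D. -/
def ParityB (p : SignedPerm n) (a b : Fin n) : Prop := (p.val a + p.val b) % 2 = 1

/-- The pairs of consecutive places in the interval from `0` to `K` have a property. -/
def OnChain (K : ℕ) (Q : Fin n → Fin n → Prop) : Prop :=
  ∀ a b : Fin n, b.val = a.val + 1 → b.val ≤ K → Q a b

theorem prod_swapFlip (p : SignedPerm n) (i j : Fin n) (D : Finset (Fin n)) :
    ∏ a, (p.swapFlip i j D).2 a = (-1) ^ D.card * ∏ a, p.2 a := by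
  simp [swapFlip, Finset.prod_mul_distrib, prod_signFlip]

/-- A set closed under all changes in the places up to `K` that respect the conditions is closed
under the exchange. For `r ≠ 1` the sign rule for `F` forces an even number of sign changes, so the
total sign survives, as type D requires. -/
theorem sum_chi_eq_zero_of_closed {K r : ℕ} (hK : K < n) (hr : 1 ≤ r) (hrK : r ≤ K + 1)
    (Par : SignedPerm n → Fin n → Fin n → Prop) (F : Finset (Fin n) → Finset (Fin n))
    (hFs : ∀ T, F T ⊆ T)
    (hF : ∀ T : Finset (Fin n), T.card = r →
      (if r = 1 then 1 else -1) * (-1 : ℤ) ^ (F T).card = -1)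
    (hmod : ∀ p : SignedPerm n, p.Chain K → OnChain K (Par p) → ∀ i j : Fin n,
      j.val + 1 = i.val + r → p.IsTop K r i → (p.swapFlip i j (F (p.values i j))).Chain K ∧
        OnChain K (Par (p.swapFlip i j (F (p.values i j)))))
    (S : Finset (SignedPerm n)) (hS : ∀ p ∈ S, p.Chain K ∧ OnChain K (Par p))
    (hstay : ∀ p ∈ S, ∀ q : SignedPerm n,
      (∀ c : Fin n, K < c.val → q.val c = p.val c ∧ q.sgn c = p.sgn c) → q.Chain K →
      OnChain K (Par q) → (r ≠ 1 → ∏ a, q.2 a = ∏ a, p.2 a) → q ∈ S) :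
    ∑ p ∈ S, p.chi = 0 := by
  refine sum_chi_eq_zero hK hr hrK F hF S (fun p hp => (hS p hp).1) fun p hp i j hij hi => ?_
  have hi1 := hi.1
  obtain ⟨h1, h2⟩ := hmod p (hS p hp).1 (hS p hp).2 i j hij hi
  refine hstay p hp _ (fun c hc => p.swapFlip_of_notMem (hFs _) (by omega) (by omega)) h1 h2
    fun hr1 => ?_
  have h3 := hF (p.values i j) (by rw [card_values]; omega)
  rw [if_neg hr1] at h3
  rw [prod_swapFlip]
  have h4 : ((-1 : ℤˣ) ^ (F (p.values i j)).card) = 1 := by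
    rcases Nat.even_or_odd (F (p.values i j)).card with h | h
    · exact h.neg_one_pow
    · rw [h.neg_one_pow] at h3
      norm_num at h3
  rw [h4, one_mul]

theorem sum_chi_eq_zero_flip {K : ℕ} (hK : K < n) (Par : SignedPerm n → Fin n → Fin n → Prop)
    (hPar : ∀ p q : SignedPerm n, p.Chain K → (∀ a, q.val a = p.val a) → OnChain K (Par p) →
      OnChain K (Par q))
    (S : Finset (SignedPerm n)) (hS : ∀ p ∈ S, p.Chain K ∧ OnChain K (Par p))
    (hstay : ∀ p ∈ S, ∀ q : SignedPerm n,
      (∀ c : Fin n, K < c.val → q.val c = p.val c ∧ q.sgn c = p.sgn c) → q.Chain K →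
      OnChain K (Par q) → q ∈ S) : ∑ p ∈ S, p.chi = 0 := by
  refine sum_chi_eq_zero_of_closed hK le_rfl (by omega) Par id (fun _ => Finset.Subset.refl _)
    (fun T hT => by simp [hT]) (fun p hp hpar i j hij hi => ?_) S hS
    fun p hp q h1 h2 h3 _ => hstay p hp q h1 h2 h3
  obtain rfl : i = j := Fin.ext (by omega)
  exact ⟨hp.flip_top hi, hPar p _ hp (fun a => by rw [val_swapFlip, Equiv.swap_self]; rfl) hpar⟩

/-- For a single place there is no condition and its sign may be changed. Otherwise the two largest
values are exchanged, since the parity condition now depends on signs. -/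
theorem sum_chi_eq_zero_parityC {K : ℕ} (hK : K < n)
    (S : Finset (SignedPerm n)) (hS : ∀ p ∈ S, p.Chain K ∧ OnChain K p.ParityC)
    (hstay : ∀ p ∈ S, ∀ q : SignedPerm n,
      (∀ c : Fin n, K < c.val → q.val c = p.val c ∧ q.sgn c = p.sgn c) → q.Chain K →
      OnChain K q.ParityC → q ∈ S) : ∑ p ∈ S, p.chi = 0 := by
  rcases Nat.eq_zero_or_pos K with rfl | hK0
  · exact sum_chi_eq_zero_flip hK ParityC (fun _ _ _ _ _ a b hab hb => by omega) S hS hstay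
  · refine sum_chi_eq_zero_of_closed (r := 2) hK (by omega) (by omega) ParityC id
      (fun _ => Finset.Subset.refl _) (fun T hT => by simp [hT])
      (fun p hp hpar i j hij hi => ?_) S hS fun p hp q h1 h2 h3 _ => hstay p hp q h1 h2 h3
    obtain ⟨h1, h2⟩ := hp.swap_two_top hij hi
    exact ⟨h1, h2 hpar⟩

/-- The total sign has to be kept, so one sign change is not allowed. Three top values are exchanged
if available; with only two places the parity of their sum is symmetric and two suffice. -/
theorem sum_chi_eq_zero_parityB {K : ℕ} (hK : K < n) (hK0 : 0 < K)
    (S : Finset (SignedPerm n)) (hS : ∀ p ∈ S, p.Chain K ∧ OnChain K p.ParityB)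
    (hstay : ∀ p ∈ S, ∀ q : SignedPerm n,
      (∀ c : Fin n, K < c.val → q.val c = p.val c ∧ q.sgn c = p.sgn c) → q.Chain K →
      OnChain K q.ParityB → ∏ a, q.2 a = ∏ a, p.2 a → q ∈ S) : ∑ p ∈ S, p.chi = 0 := by
  obtain rfl | hK1 : K = 1 ∨ 2 ≤ K := by omega
  · refine sum_chi_eq_zero_of_closed (r := 2) hK (by omega) (by omega) ParityB id
      (fun _ => Finset.Subset.refl _) (fun T hT => by simp [hT])
      (fun p hp hpar i j hij hi => ⟨(hp.swap_two_top hij hi).1, fun a b hab hb => ?_⟩) S hS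
      fun p hp q h1 h2 h3 h4 => hstay p hp q h1 h2 h3 (h4 (by omega))
    have h1 := hi.1
    obtain rfl : a = i := Fin.ext (by omega)
    obtain rfl : b = j := Fin.ext (by omega)
    have := hpar a b hab hb
    unfold ParityB at *
    rwa [val_swapFlip, val_swapFlip, Equiv.swap_apply_left, Equiv.swap_apply_right, add_comm]
  · refine sum_chi_eq_zero_of_closed (r := 3) hK (by omega) (by omega) ParityB belowMax
      (fun _ => Finset.filter_subset _ _) (fun T hT => ?_)
      (fun p hp hpar i j hij hi => hp.swap_three_top hpar hij hi) S hS
      fun p hp q h1 h2 h3 h4 => hstay p hp q h1 h2 h3 (h4 (by omega))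
    have := card_belowMax (T := T) (Finset.card_pos.mp (by omega))
    rw [show (belowMax T).card = 2 by omega]
    norm_num

end SignedPerm

/-! ### Heights -/

theorem SignedModel.height_eq {X : CartanDatum l} (M : SignedModel X n) {h : Fin n → ℤ} {c : ℤ}
    (hM : ∀ j, ∑ a, h a * M.root j a = c) (v : RootLattice l) :
    ∑ a, h a * M.E v a = c * height v := by
  rw [M.sum_mul_E, height, Finset.mul_sum]
  exact Finset.sum_congr rfl fun j _ => by rw [hM, mul_comm]

theorem SignedPerm.sum_mul_act_sub (p : SignedPerm n) (h : Fin n → ℤ) (i j : Fin n) :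
    ∑ a, h a * p.act (Pi.single i 1 - Pi.single j 1) a =
      h (p.1 i) * p.sgn i - h (p.1 j) * p.sgn j := by
  rw [act_sub, act_single_eq, act_single_eq, sum_mul_single_sub_single]
  ring

/-- Oddness of the pairing with a weight `(m, m - 1, m - 2, …)`. -/
def OddHeight (m : ℤ) (x : Fin n → ℤ) : Prop := Odd (∑ a : Fin n, (m - a.val) * x a)

theorem oddHeight_act_sub_iff (m : ℤ) (p : SignedPerm n) (i j : Fin n) :
    OddHeight m (p.act (Pi.single i 1 - Pi.single j 1)) ↔ p.ParityB i j := by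
  rw [OddHeight, p.sum_mul_act_sub, SignedPerm.ParityB, Int.odd_iff, SignedPerm.val,
    SignedPerm.val]
  rcases p.sgn_eq i with hi | hi <;> rcases p.sgn_eq j with hj | hj <;> rw [hi, hj] <;> omega

/-- The height in type C is odd. -/
def OddHeightC (x : Fin n → ℤ) : Prop := (∑ a : Fin n, (2 * (n - a.val) - 1) * x a) % 4 = 2

/-- The weight `(2n - 1, 2n - 3, …, 1)` pairs to 2 with every simple root of type C, so it measures
twice the height, and oddness becomes a remainder modulo 4. There signs matter, unlike in the other
types. -/
theorem oddHeightC_act_sub_iff (p : SignedPerm n) (i j : Fin n) :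
    OddHeightC (p.act (Pi.single i 1 - Pi.single j 1)) ↔ p.ParityC i j := by
  rw [OddHeightC, p.sum_mul_act_sub fun a => 2 * ((n : ℤ) - a.val) - 1, SignedPerm.ParityC,
    SignedPerm.val, SignedPerm.val]
  rcases p.sgn_eq i with hi | hi <;> rcases p.sgn_eq j with hj | hj <;> rw [hi, hj] <;> omega

namespace SignedModel

variable {X : CartanDatum l} (M : SignedModel X n)

theorem mem_oddPerms {H : (Fin n → ℤ) → Prop} {k : Fin l} {p : SignedPerm n} :
    p ∈ M.oddPerms H k ↔ p ∈ M.G ∧ ∀ j, j ≠ k →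
      LexPos (p.act (M.root j)) ∧ H (p.act (M.root j)) := by
  simp [oddPerms]

end SignedModel

/-! ### Cancellation for the types B and C -/

theorem rootBC_ne_zero {c : ℤ} {j a : Fin l} (h : rootBC c j a ≠ 0) : j ≤ a := by
  rw [rootBC_apply] at h
  rw [Fin.le_def]
  simp only [Fin.ext_iff] at h
  split_ifs at h <;> omega

theorem act_rootBC_of_lt {c : ℤ} {j b : Fin l} (h : b.val = j.val + 1) :
    rootBC c j = Pi.single j 1 - Pi.single b 1 := by
  have hj : j.val + 1 < l := h ▸ b.isLt
  rw [rootBC, dif_pos hj, show b = ⟨j.val + 1, hj⟩ from Fin.ext h]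

/-- Removing `α_k` splits the conditions: the earlier roots form a chain on the places up to `k`,
and the later roots involve only later places. Changes up to `k` therefore leave the later
conditions alone. -/
theorem sum_oddPerms_rootBC {X : CartanDatum l} (M : SignedModel X l) {c : ℤ}
    (hM : M.root = rootBC c) (hG : M.G = Set.univ) {H : (Fin l → ℤ) → Prop}
    {Par : SignedPerm l → Fin l → Fin l → Prop}
    (hpar : ∀ p i j, H (p.act (Pi.single i 1 - Pi.single j 1)) ↔ Par p i j) (k : Fin l)
    (hsum : ∀ S : Finset (SignedPerm l),
      (∀ p ∈ S, p.Chain k ∧ SignedPerm.OnChain k (Par p)) →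
      (∀ p ∈ S, ∀ q : SignedPerm l,
        (∀ c : Fin l, k.val < c.val → q.val c = p.val c ∧ q.sgn c = p.sgn c) → q.Chain k →
        SignedPerm.OnChain k (Par q) → q ∈ S) → ∑ p ∈ S, p.chi = 0) :
    ∑ p ∈ M.oddPerms H k, p.chi = 0 := by
  refine hsum _ (fun p hp => ?_) fun p hp q h1 h2 h3 => ?_
  · have h := (M.mem_oddPerms.mp hp).2
    rw [hM] at h
    constructor <;> intro a b hab hb
    · have := (h a (fun h => by subst h; omega)).1
      rwa [act_rootBC_of_lt hab, p.lexPos_act_sub_iff (fun h => by subst h; omega)] at this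
    · have := (h a (fun h => by subst h; omega)).2
      rwa [act_rootBC_of_lt hab, hpar] at this
  · obtain ⟨-, h⟩ := M.mem_oddPerms.mp hp
    refine M.mem_oddPerms.mpr ⟨hG ▸ trivial, fun j hj => ?_⟩
    rw [hM] at h ⊢
    rcases lt_or_gt_of_ne (Fin.val_ne_of_ne hj) with hjk | hjk
    · have hb : (⟨j.val + 1, by omega⟩ : Fin l).val = j.val + 1 := rfl
      rw [act_rootBC_of_lt hb, q.lexPos_act_sub_iff (ne_succ _), hpar]
      exact ⟨h2 _ _ hb (by simp only; omega), h3 _ _ hb (by simp only; omega)⟩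
    · rw [SignedPerm.act_congr (q := p) fun a ha => h1 a (lt_of_lt_of_le hjk (rootBC_ne_zero ha))]
      exact h j hj

/-- The parity condition sees only values, so changing the sign at the largest value among the first
places is a sign reversing involution. -/
theorem detSum_typeB (hl : 0 < l) (k : Fin l) :
    detSum (oddReps (typeB l) (modelB hl).posRoots k) = 0 := by
  have hH : ∀ j : Fin l, ∑ a : Fin l, ((l : ℤ) - a.val) * (modelB hl).root j a = 1 := fun j => by
    change ∑ a : Fin l, ((l : ℤ) - a.val) * rootBC 1 j a = 1
    unfold rootBC
    split_ifs with h
    · rw [sum_mul_single_sub_single fun a : Fin l => (l : ℤ) - a.val]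
      push_cast
      ring
    · rw [sum_mul_single fun a : Fin l => (l : ℤ) - a.val]
      omega
  rw [(modelB hl).detSum_eq (OddHeight l) (fun v => by
    rw [OddHeight, (modelB hl).height_eq hH, one_mul])]
  refine sum_oddPerms_rootBC _ rfl rfl (oddHeight_act_sub_iff l) k
    (SignedPerm.sum_chi_eq_zero_flip k.isLt _ fun p q _ hval hpar a b hab hb => ?_)
  have := hpar a b hab hb
  rwa [SignedPerm.ParityB, hval, hval]

theorem detSum_typeC (hl : 0 < l) (k : Fin l) :
    detSum (oddReps (typeC l) (modelC hl).posRoots k) = 0 := by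
  have hH : ∀ j : Fin l, ∑ a : Fin l, (2 * ((l : ℤ) - a.val) - 1) * (modelC hl).root j a = 2 :=
    fun j => by
    change ∑ a : Fin l, (2 * ((l : ℤ) - a.val) - 1) * rootBC 2 j a = 2
    unfold rootBC
    split_ifs with h
    · rw [sum_mul_single_sub_single fun a : Fin l => 2 * ((l : ℤ) - a.val) - 1]
      push_cast
      ring
    · rw [sum_mul_single fun a : Fin l => 2 * ((l : ℤ) - a.val) - 1]
      omega
  rw [(modelC hl).detSum_eq OddHeightC (fun v => by
    rw [OddHeightC, (modelC hl).height_eq hH, Int.odd_iff]; omega)]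
  exact sum_oddPerms_rootBC _ rfl rfl oddHeightC_act_sub_iff k
    (SignedPerm.sum_chi_eq_zero_parityC k.isLt)

end NilpotentToda

namespace NilpotentToda

open Equiv (swap)

variable {l n : ℕ}

/-! ### The type D -/

namespace SignedPerm

/-- Change the sign of the image of `e_j`. -/
def flipAt (p : SignedPerm n) (j : Fin n) : SignedPerm n := p.comp (1, signFlip {j})

theorem val_flipAt (p : SignedPerm n) (j a : Fin n) : (p.flipAt j).val a = p.val a := rfl

theorem sgn_flipAt (p : SignedPerm n) (j a : Fin n) :
    (p.flipAt j).sgn a = if a = j then -p.sgn a else p.sgn a := by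
  simp only [sgn, flipAt, comp, signFlip, mul_one, Equiv.symm_apply_apply, Finset.mem_singleton,
    Units.val_mul]
  split_ifs <;> simp

theorem chi_flipAt (p : SignedPerm n) (j : Fin n) : (p.flipAt j).chi = -p.chi := by
  rw [flipAt, chi_comp, chi_signFlip, mul_neg, mul_one]

theorem prod_flipAt (p : SignedPerm n) (j : Fin n) : ∏ a, (p.flipAt j).2 a = -∏ a, p.2 a := by
  rw [flipAt, prod_sign_comp, prod_signFlip]
  simp

theorem flipAt_flipAt (p : SignedPerm n) (j : Fin n) : (p.flipAt j).flipAt j = p := by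
  refine Prod.ext rfl (funext fun a => ?_)
  simp only [flipAt, comp, signFlip, mul_one]
  split_ifs <;> simp

theorem act_flipAt (p : SignedPerm n) (j : Fin n) (x : Fin n → ℤ) :
    (p.flipAt j).act x = p.act (x - (2 * x j) • Pi.single j 1) := by
  rw [flipAt, act_comp, act_signFlip j x 2 1 rfl]

theorem act_add_eq (p : SignedPerm n) {i j : Fin n} (hij : i ≠ j) :
    p.act (Pi.single i 1 + Pi.single j 1) =
      (p.flipAt j).act (Pi.single i 1 - Pi.single j 1) := by
  rw [act_flipAt]
  congr 1
  funext a
  simp only [Pi.add_apply, Pi.sub_apply, Pi.smul_apply, Pi.single_apply, hij.symm, if_true,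
    if_false, smul_eq_mul]
  split_ifs <;> simp

end SignedPerm

theorem rootD_ne_zero {j a : Fin l} (h : rootD j a ≠ 0) :
    j ≤ a ∨ (j.val + 1 = l ∧ l ≤ a.val + 2) := by
  rw [rootD_apply] at h
  rw [Fin.le_def]
  simp only [Fin.ext_iff] at h
  split_ifs at h <;> omega

theorem rootD_of_succ {j b : Fin l} (h : b.val = j.val + 1) :
    rootD j = Pi.single j 1 - Pi.single b 1 := by
  have hj : j.val + 1 < l := h ▸ b.isLt
  rw [rootD, dif_pos hj, show b = ⟨j.val + 1, hj⟩ from Fin.ext h]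

theorem rootD_last {i j : Fin l} (hj : j.val + 1 = l) (h : j.val = i.val + 1) :
    rootD j = Pi.single i 1 + Pi.single j 1 := by
  rw [rootD, dif_neg (by omega), show predFin j = i from Fin.ext (by simp only [predFin]; omega)]

theorem detSum_typeD_eq (hl : 3 ≤ l) (k : Fin l) :
    detSum (oddReps (typeD l) (modelD hl).posRoots k) =
      ∑ p ∈ (modelD hl).oddPerms (OddHeight (l - 1)) k, p.chi := by
  have hH : ∀ j : Fin l, ∑ a : Fin l, ((l : ℤ) - 1 - a.val) * (modelD hl).root j a = 1 :=
    fun j => by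
    change ∑ a : Fin l, ((l : ℤ) - 1 - a.val) * rootD j a = 1
    unfold rootD
    split_ifs with h
    · rw [sum_mul_single_sub_single fun a : Fin l => (l : ℤ) - 1 - a.val]
      push_cast
      ring
    · rw [sum_mul_single_add_single fun a : Fin l => (l : ℤ) - 1 - a.val, predFin]
      simp only
      omega
  rw [(modelD hl).detSum_eq (OddHeight (l - 1)) fun v => by
    rw [OddHeight, (modelD hl).height_eq hH, one_mul]]

/-- Unless `k` is the place `l - 2`, the roots after `α_k` involve only later places, and the
exchange on the chain before `α_k` applies while keeping the total sign. -/
theorem detSum_typeD_of_ne (hl : 3 ≤ l) {k : Fin l} (hk : 0 < k.val) (hk2 : k.val + 2 ≠ l) :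
    detSum (oddReps (typeD l) (modelD hl).posRoots k) = 0 := by
  rw [detSum_typeD_eq]
  refine SignedPerm.sum_chi_eq_zero_parityB k.isLt hk _ (fun p hp => ?_)
    fun p hp q h1 h2 h3 h4 => ?_
  · have h := ((modelD hl).mem_oddPerms.mp hp).2
    change ∀ j, j ≠ k → LexPos (p.act (rootD j)) ∧ OddHeight (l - 1) (p.act (rootD j)) at h
    constructor <;> intro a b hab hb
    · have := (h a (fun h => by subst h; omega)).1
      rwa [rootD_of_succ hab, p.lexPos_act_sub_iff (fun h => by subst h; omega)] at this
    · have := (h a (fun h => by subst h; omega)).2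
      rwa [rootD_of_succ hab, oddHeight_act_sub_iff] at this
  · obtain ⟨hG, h⟩ := (modelD hl).mem_oddPerms.mp hp
    refine (modelD hl).mem_oddPerms.mpr ⟨h4.trans hG, fun j hj => ?_⟩
    change LexPos (q.act (rootD j)) ∧ OddHeight (l - 1) (q.act (rootD j))
    rcases lt_or_gt_of_ne (Fin.val_ne_of_ne hj) with hjk | hjk
    · have hb : (⟨j.val + 1, by omega⟩ : Fin l).val = j.val + 1 := rfl
      rw [rootD_of_succ hb, q.lexPos_act_sub_iff (ne_succ _), oddHeight_act_sub_iff]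
      exact ⟨h2 _ _ hb (by simp only; omega), h3 _ _ hb (by simp only; omega)⟩
    · rw [SignedPerm.act_congr (q := p) fun a ha => h1 a (by
        rcases rootD_ne_zero ha with h | ⟨h, h'⟩
        · exact lt_of_lt_of_le hjk h
        · omega)]
      exact h j hj

/-- Changing the sign of the last coordinate turns `e_{l-1} + e_l` into `e_{l-1} - e_l`. The
remaining roots then form a chain on all places, at the cost of total sign `-1`, and the exchange
works there too. -/
theorem detSum_typeD_of_add_two_eq (hl : 3 ≤ l) {k : Fin l} (hk : k.val + 2 = l) :
    detSum (oddReps (typeD l) (modelD hl).posRoots k) = 0 := by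
  classical
  rw [detSum_typeD_eq]
  obtain ⟨z, hz⟩ : ∃ z : Fin l, z.val + 1 = l := ⟨⟨l - 1, by omega⟩, by simp only; omega⟩
  have hkz : k ≠ z := fun h => by subst h; omega
  set T : Finset (SignedPerm l) := Finset.univ.filter fun p => ∏ a, p.2 a = -1 ∧ p.Chain z ∧
    SignedPerm.OnChain z p.ParityB with hT
  have hTsum : ∑ p ∈ T, p.chi = 0 := by
    refine SignedPerm.sum_chi_eq_zero_parityB z.isLt (by omega) T
      (fun p hp => (Finset.mem_filter.mp hp).2.2) fun p hp q _ h2 h3 h4 => ?_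
    exact Finset.mem_filter.mpr ⟨Finset.mem_univ _, h4.trans (Finset.mem_filter.mp hp).2.1, h2, h3⟩
  have hroot : ∀ (p : SignedPerm l) (j b : Fin l), j ≠ k → b.val = j.val + 1 →
      p.act (rootD j) = (p.flipAt z).act (Pi.single j 1 - Pi.single b 1) := by
    intro p j b hj hb
    have hjz : z ≠ j := fun h => by subst h; omega
    have hbz : z ≠ b := fun h => by
      subst h
      exact hj (Fin.ext (by omega))
    rw [rootD_of_succ hb, SignedPerm.act_flipAt]
    simp [hjz, hbz]
  have hlast : ∀ p : SignedPerm l, p.act (rootD z) =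
      (p.flipAt z).act (Pi.single k 1 - Pi.single z 1) := by
    intro p
    rw [rootD_last (i := k) hz (by omega), p.act_add_eq hkz]
  have hmem : ∀ p : SignedPerm l, p ∈ (modelD hl).oddPerms (OddHeight (l - 1)) k ↔
      p.flipAt z ∈ T := by
    intro p
    rw [SignedModel.mem_oddPerms, hT, Finset.mem_filter, SignedPerm.prod_flipAt, neg_inj]
    simp only [Finset.mem_univ, true_and]
    refine and_congr_right fun _ => ?_
    change (∀ j, j ≠ k → LexPos (p.act (rootD j)) ∧ OddHeight (l - 1) (p.act (rootD j))) ↔ _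
    constructor
    · intro h
      have key : ∀ a b : Fin l, b.val = a.val + 1 →
          (p.flipAt z).PairPos a b ∧ (p.flipAt z).ParityB a b := by
        intro a b hab
        have hne : a ≠ b := fun h => by subst h; omega
        rw [← SignedPerm.lexPos_act_sub_iff _ hne, ← oddHeight_act_sub_iff (l - 1)]
        by_cases ha : a = k
        · have hb : b = z := Fin.ext (by rw [hab, ha]; omega)
          subst ha hb
          rw [← hlast]
          exact h b hne.symm
        · rw [← hroot p a b ha hab]
          exact h a ha
      exact ⟨fun a b hab _ => (key a b hab).1, fun a b hab _ => (key a b hab).2⟩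
    · rintro ⟨h1, h2⟩ j hj
      by_cases hjz : j = z
      · subst hjz
        rw [hlast, SignedPerm.lexPos_act_sub_iff _ hkz, oddHeight_act_sub_iff]
        exact ⟨h1 _ _ (by omega) le_rfl, h2 _ _ (by omega) le_rfl⟩
      · have hjl : j.val + 1 < l := by
          have := Fin.val_ne_of_ne hjz
          omega
        rw [hroot p j ⟨j.val + 1, hjl⟩ hj rfl, SignedPerm.lexPos_act_sub_iff _ (ne_succ _),
          oddHeight_act_sub_iff]
        exact ⟨h1 _ _ rfl (by simp only; omega), h2 _ _ rfl (by simp only; omega)⟩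
  have hsum : ∑ p ∈ (modelD hl).oddPerms (OddHeight (l - 1)) k, p.chi = ∑ p ∈ T, -p.chi := by
    refine Finset.sum_nbij' (fun p => p.flipAt z) (fun p => p.flipAt z)
      (fun p hp => (hmem p).mp hp) (fun p hp => (hmem _).mpr (by rwa [SignedPerm.flipAt_flipAt]))
      (fun p _ => p.flipAt_flipAt z) (fun p _ => p.flipAt_flipAt z)
      fun p _ => by rw [SignedPerm.chi_flipAt, neg_neg]
  rw [hsum, Finset.sum_neg_distrib, hTsum, neg_zero]

/-- A signed permutation counts for `k = 0` in type D if it maps the places after the first one to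
consecutive places, with positive signs except perhaps for the last place. -/
theorem mem_oddPerms_typeD_zero_iff (hl : 3 ≤ l) {k : Fin l} (hk : k.val = 0) (p : SignedPerm l) :
    p ∈ (modelD hl).oddPerms (OddHeight (l - 1)) k ↔ ∏ a, p.2 a = 1 ∧
      ∀ i j : Fin l, 0 < i.val → j.val = i.val + 1 → p.val j = p.val i + 1 ∧ p.sgn i = 1 := by
  rw [SignedModel.mem_oddPerms]
  refine and_congr_right fun _ => ?_
  change (∀ j, j ≠ k → LexPos (p.act (rootD j)) ∧ OddHeight (l - 1) (p.act (rootD j))) ↔ _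
  have hne : ∀ i j : Fin l, j.val = i.val + 1 → i ≠ j := fun i j h h' => by subst h'; omega
  have hk' : ∀ i : Fin l, 0 < i.val → i ≠ k := fun i h h' => by subst h'; omega
  constructor
  · intro h
    have hpair : ∀ i j : Fin l, 0 < i.val → j.val = i.val + 1 →
        p.PairPos i j ∧ p.ParityB i j := by
      intro i j hi hij
      have := h i (hk' i hi)
      rwa [rootD_of_succ hij, p.lexPos_act_sub_iff (hne i j hij), oddHeight_act_sub_iff] at this
    -- Backwards along the chain: for the last two places both the difference and the sum are mapped
    -- to positive vectors, which forces an ascent and a positive sign; a positive sign at a place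
    -- then rules out a descent into it.
    have hmono : ∀ m : ℕ, ∀ i j : Fin l, 0 < i.val → j.val = i.val + 1 → i.val + 2 + m = l →
        p.val i < p.val j ∧ p.sgn i = 1 := by
      intro m
      induction m with
      | zero =>
        intro i j hi hij hm
        have h1 := (hpair i j hi hij).1
        have h2 := (h j (hk' j (by omega))).1
        rw [rootD_last (i := i) (by omega) hij, p.act_add_eq (hne i j hij),
          SignedPerm.lexPos_act_sub_iff _ (hne i j hij)] at h2
        unfold SignedPerm.PairPos at h1 h2
        rw [SignedPerm.val_flipAt, SignedPerm.val_flipAt, SignedPerm.sgn_flipAt,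
          SignedPerm.sgn_flipAt, if_neg (hne i j hij), if_pos rfl] at h2
        omega
      | succ m ih =>
        intro i j hi hij hm
        have h1 := (hpair i j hi hij).1
        have h2 := (ih j ⟨j.val + 1, by omega⟩ (by omega) rfl (by omega)).2
        unfold SignedPerm.PairPos at h1
        omega
    have hlt : ∀ i j : Fin l, 0 < i.val → j.val = i.val + 1 → p.val i < p.val j ∧ p.sgn i = 1 :=
      fun i j hi hij => hmono (l - 2 - i.val) i j hi hij (by have := j.isLt; omega)
    have hle : ∀ m : ℕ, ∀ i : Fin l, 0 < i.val → i.val + m + 1 = l → p.val i + m + 1 ≤ l := by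
      intro m
      induction m with
      | zero => intro i _ _; exact (p.1 i).isLt
      | succ m ih =>
        intro i hi hm
        have h1 := hlt i ⟨i.val + 1, by omega⟩ hi rfl
        have h2 := ih ⟨i.val + 1, by omega⟩ (by simp only; omega) (by simp only; omega)
        omega
    have hge : ∀ m : ℕ, ∀ i : Fin l, i.val = m + 1 → m ≤ p.val i := by
      intro m
      induction m with
      | zero => intro i _; exact Nat.zero_le _
      | succ m ih =>
        intro i hi
        have h1 := hlt ⟨m + 1, by omega⟩ i (by simp only; omega) hi
        have h2 := ih ⟨m + 1, by omega⟩ rfl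
        omega
    intro i j hi hij
    obtain ⟨h1, h2⟩ := hlt i j hi hij
    refine ⟨?_, h2⟩
    -- The values increase and lie in `l` places, which bounds the difference of neighbours by 2;
    -- being odd, it is 1.
    have h3 := (hpair i j hi hij).2
    have h4 := hge (i.val - 1) i (by omega)
    have h5 := hle (l - 1 - j.val) j (by omega) (by omega)
    unfold SignedPerm.ParityB at h3
    omega
  · intro h j hj
    have hj0 : 0 < j.val := by
      have := Fin.val_ne_of_ne hj
      omega
    by_cases hjl : j.val + 1 < l
    · obtain ⟨h1, h2⟩ := h j ⟨j.val + 1, hjl⟩ hj0 rfl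
      rw [rootD_of_succ (b := ⟨j.val + 1, hjl⟩) rfl, p.lexPos_act_sub_iff (ne_succ _),
        oddHeight_act_sub_iff]
      refine ⟨Or.inl ⟨by omega, h2⟩, ?_⟩
      unfold SignedPerm.ParityB
      omega
    · obtain ⟨i, hi⟩ : ∃ i : Fin l, j.val = i.val + 1 :=
        ⟨⟨j.val - 1, by omega⟩, by simp only; omega⟩
      obtain ⟨h1, h2⟩ := h i j (by omega) hi
      rw [rootD_last (by omega) hi, p.act_add_eq (hne i j hi),
        SignedPerm.lexPos_act_sub_iff _ (hne i j hi), oddHeight_act_sub_iff]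
      unfold SignedPerm.PairPos SignedPerm.ParityB
      rw [SignedPerm.val_flipAt, SignedPerm.val_flipAt, SignedPerm.sgn_flipAt,
        if_neg (hne i j hi)]
      exact ⟨Or.inl ⟨by omega, h2⟩, by omega⟩

end NilpotentToda

/-! ### The first root in type D, and conclusions for the types B, C and D -/

namespace NilpotentToda

variable {l : ℕ}

theorem finRotate_inv_succ {i j : Fin l} (h : j.val = i.val + 1) : (finRotate l)⁻¹ j = i := by
  rw [Equiv.Perm.inv_eq_iff_eq]
  obtain ⟨m, rfl⟩ : ∃ m, l = m + 1 := ⟨l - 1, by have := i.isLt; omega⟩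
  have := finRotate_of_lt (n := m) (k := i.val) (by have := j.isLt; omega)
  rw [show i = ⟨i.val, i.isLt⟩ from rfl, this]
  exact Fin.ext h

theorem finRotate_inv_zero {k z : Fin l} (hk : k.val = 0) (hz : z.val + 1 = l) :
    (finRotate l)⁻¹ k = z := by
  rw [Equiv.Perm.inv_eq_iff_eq]
  obtain ⟨m, rfl⟩ : ∃ m, l = m + 1 := ⟨l - 1, by omega⟩
  rw [show z = Fin.last m from Fin.ext (by simp only [Fin.val_last]; omega), finRotate_last]
  exact Fin.ext hk

/-- The `l - 1` consecutive values start at 1 or at 0, and the first place gets the value left over: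
the identity or an inverse rotation. Only the first and the last sign are free, and they agree
because the total sign is 1. -/
theorem mem_oddPerms_typeD_zero_iff' (hl : 3 ≤ l) {k z : Fin l} (hk : k.val = 0)
    (hz : z.val + 1 = l) (p : SignedPerm l) :
    p ∈ (modelD hl).oddPerms (OddHeight (l - 1)) k ↔
      p.1 ∈ ({1, (finRotate l)⁻¹} : Finset (Equiv.Perm (Fin l))) ∧
      p.2 ∈ ({1, signFlip {p.1 k, p.1 z}} : Finset (Fin l → ℤˣ)) := by
  have hkz : k ≠ z := fun h => by subst h; omega
  rw [mem_oddPerms_typeD_zero_iff hl hk]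
  simp only [Finset.mem_insert, Finset.mem_singleton]
  constructor
  · rintro ⟨hprod, h⟩
    have hval : ∀ m : ℕ, ∀ i : Fin l, i.val = m + 1 → p.val i = p.val ⟨1, by omega⟩ + m := by
      intro m
      induction m with
      | zero => intro i hi; congr 1; exact Fin.ext hi
      | succ m ih =>
        intro i hi
        rw [(h ⟨m + 1, by omega⟩ i (by simp only; omega) hi).1, ih _ rfl]
        omega
    have hsgn : ∀ i : Fin l, i ≠ k → i ≠ z → p.2 (p.1 i) = 1 := by
      intro i hik hiz
      have h1 := Fin.val_ne_of_ne hik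
      have h2 := Fin.val_ne_of_ne hiz
      exact Units.ext (h i ⟨i.val + 1, by omega⟩ (by omega) rfl).2
    constructor
    · have hz1 := hval (l - 2) z (by omega)
      have hz2 : p.val z < l := (p.1 z).isLt
      obtain h0 | h0 : p.val ⟨1, by omega⟩ = 1 ∨ p.val ⟨1, by omega⟩ = 0 := by omega
      · left
        refine Equiv.ext fun a => Fin.ext ?_
        change p.val a = a.val
        by_cases ha : a = k
        · obtain ⟨b, hb⟩ := p.1.surjective k
          by_cases hb0 : b.val = 0
          · rw [show a = b from Fin.ext (by rw [ha, hk, hb0]), SignedPerm.val, hb, hk, hb0]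
          · have := hval (b.val - 1) b (by omega)
            rw [SignedPerm.val, hb] at this
            omega
        · have := Fin.val_ne_of_ne ha
          have := hval (a.val - 1) a (by omega)
          omega
      · right
        refine Equiv.ext fun a => ?_
        by_cases ha : a = k
        · subst ha
          rw [finRotate_inv_zero hk hz]
          obtain ⟨b, hb⟩ := p.1.surjective z
          by_cases hb0 : b.val = 0
          · rw [show a = b from Fin.ext (by rw [hk, hb0]), hb]
          · have := hval (b.val - 1) b (by omega)
            rw [SignedPerm.val, hb] at this
            omega
        · have := Fin.val_ne_of_ne ha
          have h1 := hval (a.val - 1) a (by omega)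
          rw [finRotate_inv_succ (i := ⟨a.val - 1, by omega⟩) (by simp only; omega)]
          refine Fin.ext ?_
          change p.val a = a.val - 1
          omega
    · rw [← Equiv.prod_comp p.1, Finset.prod_eq_mul k z hkz (fun c _ hc => hsgn c hc.1 hc.2)
        (by simp) (by simp)] at hprod
      rcases Int.units_eq_one_or (p.2 (p.1 k)) with h1 | h1
      · left
        rw [h1, one_mul] at hprod
        funext a
        obtain ⟨b, rfl⟩ := p.1.surjective a
        by_cases hbk : b = k
        · rw [hbk, h1]; rfl
        · by_cases hbz : b = z
          · rw [hbz, hprod]; rfl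
          · rw [hsgn b hbk hbz]; rfl
      · right
        have h2 : p.2 (p.1 z) = -1 := by
          rw [h1] at hprod
          rcases Int.units_eq_one_or (p.2 (p.1 z)) with h2 | h2
          · rw [h2] at hprod
            exact absurd hprod (by decide)
          · exact h2
        funext a
        obtain ⟨b, rfl⟩ := p.1.surjective a
        simp only [signFlip, Finset.mem_insert, Finset.mem_singleton,
          EmbeddingLike.apply_eq_iff_eq]
        by_cases hbk : b = k
        · rw [hbk, h1, if_pos (Or.inl rfl)]
        · by_cases hbz : b = z
          · rw [hbz, h2, if_pos (Or.inr rfl)]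
          · rw [hsgn b hbk hbz, if_neg (by tauto)]
  · rintro ⟨hf, hη⟩
    constructor
    · rcases hη with h | h <;> rw [h]
      · simp
      · rw [prod_signFlip, Finset.card_pair fun h => hkz (p.1.injective h)]
        rfl
    · intro i j hi hij
      constructor
      · rw [SignedPerm.val, SignedPerm.val]
        rcases hf with h | h <;> rw [h]
        · exact hij
        · rw [finRotate_inv_succ hij, finRotate_inv_succ (i := ⟨i.val - 1, by omega⟩)
            (by simp only; omega)]
          simp only
          omega
      · rw [SignedPerm.sgn]
        rcases hη with h | h <;> rw [h]
        · rfl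
        · rw [signFlip, if_neg]
          · rfl
          · simp only [Finset.mem_insert, Finset.mem_singleton, EmbeddingLike.apply_eq_iff_eq]
            rintro (rfl | rfl) <;> omega

/-- Both sign choices give the sign of the permutation, and the rotation of `l` places has sign
`(-1) ^ (l - 1)`. -/
theorem detSum_typeD_zero (hl : 3 ≤ l) {k : Fin l} (hk : k.val = 0) :
    detSum (oddReps (typeD l) (modelD hl).posRoots k) = 2 + 2 * (-1) ^ (l - 1) := by
  obtain ⟨z, hz⟩ : ∃ z : Fin l, z.val + 1 = l := ⟨⟨l - 1, by omega⟩, by simp only; omega⟩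
  have hkz : k ≠ z := fun h => by subst h; omega
  rw [detSum_typeD_eq]
  have h1 := Finset.sum_finset_product' (f := fun f η => SignedPerm.chi (f, η)) _ _
    (fun f : Equiv.Perm (Fin l) => ({1, signFlip {f k, f z}} : Finset (Fin l → ℤˣ)))
    (mem_oddPerms_typeD_zero_iff' hl hk hz)
  simp only [Prod.mk.eta] at h1
  rw [h1]
  have h2 : ∀ f : Equiv.Perm (Fin l), ∑ η ∈ ({1, signFlip {f k, f z}} : Finset (Fin l → ℤˣ)),
      SignedPerm.chi (f, η) = 2 * Equiv.Perm.sign f := by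
    intro f
    have hne : (1 : Fin l → ℤˣ) ≠ signFlip {f k, f z} := fun h => by
      have := congrFun h (f k)
      simp [signFlip] at this
    rw [Finset.sum_pair hne, SignedPerm.chi, SignedPerm.chi, prod_signFlip,
      Finset.card_pair fun h => hkz (f.injective h)]
    simp
    ring
  rw [Finset.sum_congr rfl fun f _ => h2 f, Finset.sum_pair]
  · rw [Equiv.Perm.sign_inv, sign_finRotate]
    simp
  · intro h
    have := congrArg (fun f => f k) h
    simp only [Equiv.Perm.one_apply, finRotate_inv_zero hk hz] at this
    exact hkz this

theorem typeB_top (hl : 2 ≤ l) :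
    (∀ k : Fin l, ¬ TopEdge (typeB l) k) ∧ Orientable (typeB l) :=
  not_topEdge_and_orientable (modelB (by omega)).isPositiveSystem (detSum_typeB (by omega))

theorem typeC_top (hl : 2 ≤ l) :
    (∀ k : Fin l, ¬ TopEdge (typeC l) k) ∧ Orientable (typeC l) :=
  not_topEdge_and_orientable (modelC (by omega)).isPositiveSystem (detSum_typeC (by omega))

theorem detSum_typeD_pos (hl : 3 ≤ l) {k : Fin l} (hk : k.val ≠ 0) :
    detSum (oddReps (typeD l) (modelD hl).posRoots k) = 0 := by
  by_cases h : k.val + 2 = l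
  · exact detSum_typeD_of_add_two_eq hl h
  · exact detSum_typeD_of_ne hl (by omega) h

theorem typeD_even_top (hl : 3 ≤ l) (he : Even l) :
    (∀ k : Fin l, ¬ TopEdge (typeD l) k) ∧ Orientable (typeD l) := by
  refine not_topEdge_and_orientable (modelD hl).isPositiveSystem fun k => ?_
  by_cases hk : k.val = 0
  · rw [detSum_typeD_zero hl hk, Odd.neg_one_pow (Nat.Even.sub_odd (by omega) he odd_one)]
    norm_num
  · exact detSum_typeD_pos hl hk

theorem typeD_odd_top (hl : 3 ≤ l) (ho : Odd l) :
    (∀ k : Fin l, TopEdge (typeD l) k ↔ k.val = 0) ∧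
    (∀ k : Fin l, k.val = 0 → incidence (typeD l) k = 4) ∧ Nonorientable (typeD l) := by
  have h4 : ∀ k : Fin l, k.val = 0 → incidence (typeD l) k = 4 := fun k hk => by
    rw [(modelD hl).isPositiveSystem.incidence_eq, detSum_typeD_zero hl hk,
      (Nat.Odd.sub_odd ho odd_one).neg_one_pow, hk]
    norm_num
  have h0 : ∀ k : Fin l, TopEdge (typeD l) k ↔ k.val = 0 := fun k => by
    refine ⟨fun h => ?_, fun h => by rw [TopEdge, h4 k h]; norm_num⟩
    by_contra hk
    refine h ?_
    rw [(modelD hl).isPositiveSystem.incidence_eq, detSum_typeD_pos hl hk]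
    simp
  exact ⟨h0, h4, nonorientable_of_topEdge ((h0 ⟨0, by omega⟩).mpr rfl)⟩

end NilpotentToda

namespace NilpotentToda

variable {l : ℕ}

/-! ### The type A -/

theorem detSum_typeA_eq (k : Fin l) : detSum (oddReps (typeA l) modelA.posRoots k) =
    ∑ p ∈ modelA.oddPerms (OddHeight 0) k, p.chi := by
  have hH : ∀ j : Fin l, ∑ a : Fin (l + 1), ((0 : ℤ) - a.val) * modelA.root j a = 1 :=
    fun j => by
    change ∑ a : Fin (l + 1), ((0 : ℤ) - a.val) * rootA j a = 1
    rw [rootA, sum_mul_single_sub_single fun a : Fin (l + 1) => (0 : ℤ) - a.val]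
    simp
  rw [modelA.detSum_eq (OddHeight 0) fun v => by
    rw [OddHeight, modelA.height_eq hH, one_mul]]

/-- The elements are the shuffles of the blocks before and after the gap at `k`, with values of
alternating parity in each block. -/
theorem mem_oddPerms_typeA_iff (k : Fin l) (p : SignedPerm (l + 1)) :
    p ∈ modelA.oddPerms (OddHeight 0) k ↔ p.2 = 1 ∧ ∀ i j : Fin (l + 1), j.val = i.val + 1 →
      i.val ≠ k.val → p.val i < p.val j ∧ (p.val i + p.val j) % 2 = 1 := by
  rw [SignedModel.mem_oddPerms]
  refine and_congr_right fun hp => ?_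
  change p.2 = 1 at hp
  change (∀ j, j ≠ k → LexPos (p.act (rootA j)) ∧ OddHeight 0 (p.act (rootA j))) ↔ _
  have key : ∀ j : Fin l, LexPos (p.act (rootA j)) ∧ OddHeight 0 (p.act (rootA j)) ↔
      p.val j.castSucc < p.val j.succ ∧ (p.val j.castSucc + p.val j.succ) % 2 = 1 := fun j => by
    rw [rootA, p.lexPos_act_sub_iff (Fin.castSucc_lt_succ (i := j)).ne, oddHeight_act_sub_iff,
      SignedPerm.PairPos, SignedPerm.ParityB]
    simp [SignedPerm.sgn, hp]
  constructor
  · intro h i j hij hik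
    have := (key ⟨i.val, by omega⟩).mp (h _ (Fin.ne_of_val_ne hik))
    rwa [show j = Fin.succ ⟨i.val, by omega⟩ from Fin.ext hij]
  · intro h j hj
    exact (key j).mpr (h j.castSucc j.succ rfl (Fin.val_ne_of_ne hj))

section Vanishing

variable {n₁ n₂ : ℕ}

/-- The permutation that reverses the places up to `n₁` and the other places. -/
def blockRev (n₁ n₂ : ℕ) : Equiv.Perm (Fin (n₁ + 1 + n₂ + 1)) :=
  Function.Involutive.toPerm
    (fun i => if h : i.val ≤ n₁ then ⟨n₁ - i.val, by omega⟩
      else ⟨2 * n₁ + n₂ + 2 - i.val, by omega⟩)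
    fun i => by
      have := i.isLt
      by_cases h : i.val ≤ n₁
      · simp only [h, dif_pos]
        rw [dif_pos (by omega)]
        exact Fin.ext (by simp only; omega)
      · simp only [h, dif_neg, not_false_eq_true]
        rw [dif_neg (by omega)]
        exact Fin.ext (by simp only; omega)

theorem val_blockRev (i : Fin (n₁ + 1 + n₂ + 1)) : (blockRev n₁ n₂ i).val =
    if i.val ≤ n₁ then n₁ - i.val else 2 * n₁ + n₂ + 2 - i.val := by
  change (if h : i.val ≤ n₁ then (⟨n₁ - i.val, by omega⟩ : Fin (n₁ + 1 + n₂ + 1))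
    else ⟨2 * n₁ + n₂ + 2 - i.val, by omega⟩).val = _
  split_ifs <;> rfl

theorem blockRev_mul_self : blockRev n₁ n₂ * blockRev n₁ n₂ = 1 :=
  Equiv.ext fun i => Function.Involutive.toPerm_involutive _ i

theorem val_finRotate_pow (m : ℕ) {n : ℕ} (i : Fin (n + 1)) :
    ((finRotate (n + 1) ^ m) i).val = (i.val + m) % (n + 1) := by
  induction m with
  | zero => simp [Nat.mod_eq_of_lt i.isLt]
  | succ m ih =>
    rw [pow_succ', Equiv.Perm.mul_apply, coe_finRotate]
    simp only [Fin.ext_iff, ih, Fin.val_last]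
    have := Nat.mod_lt (i.val + m) (show 0 < n + 1 by omega)
    rw [← add_assoc, ← Nat.mod_add_mod (i.val + m)]
    split_ifs with h
    · rw [h, Nat.mod_self]
    · rw [Nat.mod_eq_of_lt (a := (i.val + m) % (n + 1) + 1) (by omega)]

/-- Reversing both blocks and then everything exchanges the blocks, which is a power of a rotation;
this gives the sign needed for the involution. -/
theorem revPerm_mul_blockRev : Fin.revPerm * blockRev n₁ n₂ =
    finRotate (n₁ + 1 + n₂ + 1) ^ (n₂ + 1) := by
  refine Equiv.ext fun i => Fin.ext ?_
  have := i.isLt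
  rw [val_finRotate_pow, Equiv.Perm.mul_apply, Fin.revPerm_apply, Fin.val_rev, val_blockRev]
  split_ifs with h
  · rw [Nat.mod_eq_of_lt (by omega)]
    omega
  · rw [show i.val + (n₂ + 1) = (i.val - (n₁ + 1)) + (n₁ + 1 + n₂ + 1) by omega, Nat.add_mod_right,
      Nat.mod_eq_of_lt (by omega)]
    omega

/-- Reversing the values and the places within each block keeps ascents and parities of neighbours.
The sign changes by that of an exchange of blocks of the odd lengths `n₁ + 1` and `n₂ + 1`, which is
`-1`. -/
theorem detSum_typeA_eq_zero (h₁ : Even n₁) (h₂ : Even n₂) (hn : n₁ < n₁ + 1 + n₂) :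
    detSum (oddReps (typeA (n₁ + 1 + n₂)) modelA.posRoots ⟨n₁, hn⟩) = 0 := by
  rw [detSum_typeA_eq]
  set φ : SignedPerm (n₁ + 1 + n₂ + 1) → SignedPerm (n₁ + 1 + n₂ + 1) :=
    fun p => (Fin.revPerm * p.1 * blockRev n₁ n₂, p.2) with hφ
  have hchi : ∀ p, (φ p).chi = -p.chi := fun p => by
    have h : Equiv.Perm.sign (Fin.revPerm * blockRev n₁ n₂) = -1 := by
      rw [revPerm_mul_blockRev, map_pow, sign_finRotate, ← pow_mul, Odd.neg_one_pow]
      rw [Nat.add_sub_cancel]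
      exact (by grind : Odd (n₁ + 1 + n₂)).mul (h₂.add_one)
    rw [Equiv.Perm.sign_mul] at h
    simp only [SignedPerm.chi, hφ, Equiv.Perm.sign_mul]
    rw [show ∀ a b c d : ℤˣ, a * b * c * d = a * c * (b * d) by intros; ac_rfl, h]
    simp
  have hval : ∀ p a, (φ p).val a = n₁ + 1 + n₂ - p.val (blockRev n₁ n₂ a) := fun p a => by
    change (Fin.rev (p.1 (blockRev n₁ n₂ a))).val = _
    rw [Fin.val_rev, SignedPerm.val]
    omega
  refine Finset.sum_involution (fun p _ => φ p) (fun p _ => by rw [hchi]; ring)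
    (fun p _ hne h => ?_) (fun p hp => ?_) fun p _ => ?_
  · have := hchi p
    rw [h] at this
    omega
  · rw [mem_oddPerms_typeA_iff] at hp ⊢
    refine ⟨hp.1, fun i j hij hik => ?_⟩
    simp only at hik
    have hi := i.isLt
    have hj := j.isLt
    have h3 := hp.2 (blockRev n₁ n₂ j) (blockRev n₁ n₂ i)
      (by rw [val_blockRev, val_blockRev]; split_ifs <;> omega)
      (by rw [val_blockRev]; simp only; split_ifs <;> omega)
    rw [hval, hval]
    have h4 : p.val (blockRev n₁ n₂ i) < n₁ + 1 + n₂ + 1 := (p.1 _).isLt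
    omega
  · refine Prod.ext ?_ rfl
    have h : (Fin.revPerm : Equiv.Perm (Fin (n₁ + 1 + n₂ + 1))) * Fin.revPerm = 1 :=
      Equiv.ext fun i => Fin.rev_rev i
    simp only [hφ]
    rw [mul_assoc, mul_assoc, mul_assoc, blockRev_mul_self, mul_one, ← mul_assoc, h, one_mul]

end Vanishing

section Positive

variable {k : Fin l} {p : SignedPerm (l + 1)}

theorem block_typeA (hp : p ∈ modelA.oddPerms (OddHeight 0) k) {i j : Fin (l + 1)} (hij : i < j)
    (hk : j.val ≤ k.val ∨ k.val < i.val) :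
    p.val i < p.val j ∧ (p.val i + i.val + (p.val j + j.val)) % 2 = 0 := by
  obtain ⟨-, h⟩ := (mem_oddPerms_typeA_iff k p).mp hp
  obtain ⟨m, hm⟩ := Nat.exists_eq_add_of_lt (Fin.lt_def.mp hij)
  clear hij
  induction m generalizing j with
  | zero =>
    obtain ⟨h1, h2⟩ := h i j hm (by omega)
    omega
  | succ m ih =>
    have hj := j.isLt
    obtain ⟨h1, h2⟩ := ih (j := ⟨i.val + m + 1, by omega⟩) (by simp only; omega) rfl
    obtain ⟨h3, h4⟩ := h ⟨i.val + m + 1, by omega⟩ j (by simp only; omega) (by simp only; omega)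
    simp only at h2
    omega

/-- All inversions lead from the first block to the second. The values below that of a place `i` in
the first block come from the earlier places and from its inversions, so there are `p.val i - i` of
the latter. -/
theorem sign_eq_prod_typeA (hp : p ∈ modelA.oddPerms (OddHeight 0) k) :
    Equiv.Perm.sign p.1 = ∏ i with i.val ≤ k.val, (-1) ^ (p.val i + i.val) := by
  rw [Equiv.Perm.sign_eq_prod_prod_Ioi, Finset.prod_filter]
  refine Finset.prod_congr rfl fun i _ => ?_
  split_ifs with hi
  · rw [Finset.prod_ite, Finset.prod_const_one, one_mul, Finset.prod_const]
    have h1 : (Finset.univ.filter fun j => p.1 j < p.1 i).card = p.val i := by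
      rw [← Finset.card_map p.1.toEmbedding, SignedPerm.val, ← Fin.card_Iio]
      congr 1
      ext b
      simp [Finset.mem_map_equiv]
    have h2 : (Finset.univ.filter fun j => p.1 j < p.1 i) = Finset.Iio i ∪
        (Finset.Ioi i).filter fun j => ¬ p.1 i < p.1 j := by
      ext j
      simp only [Finset.mem_filter, Finset.mem_univ, true_and, Finset.mem_union, Finset.mem_Iio,
        Finset.mem_Ioi, not_lt]
      constructor
      · intro h
        rcases lt_trichotomy j i with hj | rfl | hj
        · exact Or.inl hj
        · exact absurd h (lt_irrefl _)
        · exact Or.inr ⟨hj, h.le⟩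
      · rintro (h | ⟨h, h'⟩)
        · exact (block_typeA hp h (Or.inl hi)).1
        · exact lt_of_le_of_ne h' fun e => h.ne' (p.1.injective e)
    rw [h2, Finset.card_union_of_disjoint, Fin.card_Iio] at h1
    · rw [← h1, show ∀ a b : ℕ, a + b + a = b + 2 * a by intros; omega, pow_add, pow_mul]
      simp
    · rw [Finset.disjoint_left]
      intro j hj hj'
      exact lt_asymm (Finset.mem_Iio.mp hj) (Finset.mem_Ioi.mp (Finset.mem_filter.mp hj').1)
  · refine Finset.prod_eq_one fun j hj => if_pos ?_
    exact (block_typeA hp (Finset.mem_Ioi.mp hj) (Or.inr (not_le.mp hi))).1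

/-- The product of the signs `(-1) ^ (f i + i)` over one of the two blocks. -/
theorem prod_block_typeA (hp : p ∈ modelA.oddPerms (OddHeight 0) k) {B : Finset (Fin (l + 1))}
    (hB : ∀ i ∈ B, ∀ j ∈ B, i < j → j.val ≤ k.val ∨ k.val < i.val) (hc : Even B.card) :
    ∏ i ∈ B, (-1 : ℤˣ) ^ (p.val i + i.val) = 1 := by
  rcases B.eq_empty_or_nonempty with rfl | ⟨i, hi⟩
  · rfl
  · have h : ∀ j ∈ B, (-1 : ℤˣ) ^ (p.val j + j.val) = (-1) ^ (p.val i + i.val) := by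
      intro j hj
      rcases lt_trichotomy i j with hij | rfl | hij
      · have := (block_typeA hp hij (hB i hi j hj hij)).2
        exact neg_one_pow_congr (by rw [Nat.even_iff, Nat.even_iff]; omega)
      · rfl
      · have := (block_typeA hp hij (hB j hj i hi hij)).2
        exact neg_one_pow_congr (by rw [Nat.even_iff, Nat.even_iff]; omega)
    rw [Finset.prod_congr rfl h, Finset.prod_const, ← pow_mul, Even.neg_one_pow (hc.mul_left _)]

/-- If `n₁` is odd the first block has even size and equal factors, so the product is 1. If `n₂` is
odd this holds for the second block, and the product over all places is 1 because `p` permutes them.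
-/
theorem chi_eq_one_typeA (hp : p ∈ modelA.oddPerms (OddHeight 0) k)
    (hk : Odd k.val ∨ Odd (l - 1 - k.val)) : p.chi = 1 := by
  have hkl := k.isLt
  have hcard : (Finset.univ.filter fun i : Fin (l + 1) => i.val ≤ k.val) =
      Finset.Iic k.castSucc := by
    ext i; simp [Fin.le_def]
  have hcard' : (Finset.univ.filter fun i : Fin (l + 1) => ¬ i.val ≤ k.val) =
      Finset.Ioi k.castSucc := by
    ext i; simp [Fin.lt_def]
  have hsign : Equiv.Perm.sign p.1 = 1 := by
    rw [sign_eq_prod_typeA hp]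
    rcases hk with hk | hk
    · refine prod_block_typeA hp (fun i _ j hj _ => Or.inl (Finset.mem_filter.mp hj).2) ?_
      rw [hcard, Fin.card_Iic]
      exact hk.add_one
    · have h1 : ∏ i, (-1 : ℤˣ) ^ (p.val i + i.val) = 1 := by
        have h2 : ∏ i, (-1 : ℤˣ) ^ (p.val i) = ∏ i : Fin (l + 1), (-1 : ℤˣ) ^ i.val :=
          Equiv.prod_comp p.1 fun i => (-1 : ℤˣ) ^ i.val
        simp only [pow_add]
        rw [Finset.prod_mul_distrib, h2, Int.units_mul_self]
      rw [← Finset.prod_filter_mul_prod_filter_not _ (fun i : Fin (l + 1) => i.val ≤ k.val),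
        prod_block_typeA hp (B := Finset.univ.filter fun i : Fin (l + 1) => ¬ i.val ≤ k.val)
          (fun i hi j _ _ => Or.inr (not_le.mp (Finset.mem_filter.mp hi).2)) ?_, mul_one] at h1
      · exact h1
      · rw [hcard', Fin.card_Ioi, Fin.val_castSucc]
        rw [show l + 1 - 1 - k.val = l - 1 - k.val + 1 by omega]
        exact hk.add_one
  have hG : p.2 = 1 := ((mem_oddPerms_typeA_iff k p).mp hp).1
  rw [SignedPerm.chi, hsign, hG]
  simp

/-- All summands are 1, and the identity occurs among them. -/
theorem detSum_typeA_pos (k : Fin l) (hk : Odd k.val ∨ Odd (l - 1 - k.val)) :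
    0 < detSum (oddReps (typeA l) modelA.posRoots k) := by
  rw [detSum_typeA_eq, Finset.sum_congr rfl fun p hp => chi_eq_one_typeA hp hk, Finset.sum_const,
    nsmul_eq_mul, mul_one, Nat.cast_pos, Finset.card_pos]
  refine ⟨(1, 1), (mem_oddPerms_typeA_iff k _).mpr ⟨rfl, fun i j hij _ => ?_⟩⟩
  change i.val < j.val ∧ (i.val + j.val) % 2 = 1
  omega

end Positive

theorem typeA_topEdge_iff (n₁ n₂ : ℕ) (hn : n₁ < n₁ + 1 + n₂) :
    TopEdge (typeA (n₁ + 1 + n₂)) ⟨n₁, hn⟩ ↔ Odd n₁ ∨ Odd n₂ := by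
  rw [TopEdge, (modelA (l := n₁ + 1 + n₂)).isPositiveSystem.incidence_eq]
  constructor
  · intro h
    by_contra! hodd
    rw [Nat.not_odd_iff_even, Nat.not_odd_iff_even] at hodd
    rw [detSum_typeA_eq_zero hodd.1 hodd.2] at h
    simp at h
  · intro h
    have := detSum_typeA_pos (l := n₁ + 1 + n₂) ⟨n₁, hn⟩ (by
      simpa only [show n₁ + 1 + n₂ - 1 - n₁ = n₂ by omega] using h)
    simp [this.ne']

end NilpotentToda

theorem mainTheorem2 :
    (∀ n₁ n₂ : ℕ,
      NilpotentToda.TopEdge (NilpotentToda.typeA (n₁ + 1 + n₂)) ⟨n₁, by omega⟩ ↔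
        (Odd n₁ ∨ Odd n₂)) ∧
    (∀ l : ℕ, 2 ≤ l →
      (∀ k : Fin l, ¬ NilpotentToda.TopEdge (NilpotentToda.typeB l) k) ∧
      NilpotentToda.Orientable (NilpotentToda.typeB l)) ∧
    (∀ l : ℕ, 2 ≤ l →
      (∀ k : Fin l, ¬ NilpotentToda.TopEdge (NilpotentToda.typeC l) k) ∧
      NilpotentToda.Orientable (NilpotentToda.typeC l)) ∧
    (∀ l : ℕ, 3 ≤ l → Even l →
      (∀ k : Fin l, ¬ NilpotentToda.TopEdge (NilpotentToda.typeD l) k) ∧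
      NilpotentToda.Orientable (NilpotentToda.typeD l)) ∧
    (∀ l : ℕ, 3 ≤ l → Odd l →
      (∀ k : Fin l, NilpotentToda.TopEdge (NilpotentToda.typeD l) k ↔ k.val = 0) ∧
      (∀ k : Fin l, k.val = 0 → NilpotentToda.incidence (NilpotentToda.typeD l) k = 4) ∧
      NilpotentToda.Nonorientable (NilpotentToda.typeD l)) ∧
    ((∀ k : Fin 6, NilpotentToda.TopEdge NilpotentToda.typeE₆ k ↔ (k.val = 0 ∨ k.val = 4)) ∧
      (∀ k : Fin 6, (k.val = 0 ∨ k.val = 4) →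
        NilpotentToda.incidence NilpotentToda.typeE₆ k = 6) ∧
      NilpotentToda.Nonorientable NilpotentToda.typeE₆) ∧
    ((∀ k : Fin 7, ¬ NilpotentToda.TopEdge NilpotentToda.typeE₇ k) ∧
      NilpotentToda.Orientable NilpotentToda.typeE₇) ∧
    ((∀ k : Fin 8, ¬ NilpotentToda.TopEdge NilpotentToda.typeE₈ k) ∧
      NilpotentToda.Orientable NilpotentToda.typeE₈) ∧
    ((∀ k : Fin 4, ¬ NilpotentToda.TopEdge NilpotentToda.typeF₄ k) ∧
      NilpotentToda.Orientable NilpotentToda.typeF₄) ∧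
    ((∀ k : Fin 2, ¬ NilpotentToda.TopEdge NilpotentToda.typeG₂ k) ∧
      NilpotentToda.Orientable NilpotentToda.typeG₂) := by
  open NilpotentToda in
  exact ⟨fun n₁ n₂ => typeA_topEdge_iff n₁ n₂ _, fun _ hl => typeB_top hl, fun _ hl => typeC_top hl,
    fun _ hl he => typeD_even_top hl he, fun _ hl ho => typeD_odd_top hl ho, typeE₆_top, typeE₇_top,
    typeE₈_top, typeF₄_top, typeG₂_top⟩
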